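/- **Setting.** Let $\mathfrak h$ be a complex vector space of dimension $2M$ with a nondegenerate symmetric bilinear form $(\cdot,\cdot)$, and let $\mathfrak h=\mathfrak p\oplus\mathfrak q$ with $\mathfrak p,\mathfrak q$ isotropic of dimension $M$. Let $e_1,\dots,e_M$ and $\bar e_1,\dots,\bar e_M$ be bases of $\mathfrak p$ and $\mathfrak q$ with $(e_i,\bar e_j)=\delta_{ij}$. Write $\mathbb N=\{0,1,2,\dots\}$. Let $N$ be the quotient of the tensor algebra of $\mathfrak h\otimes t^{1/2}\mathbb C[t,t^{-1}]\oplus\mathbb C\mathbf k$ by the two-sided ideal generated by the relations $$(a\otimes t^{m+\frac12})(b\otimes t^{-n-\frac12})+(b\otimes t^{-n-\frac12})(a\otimes t^{m+\frac12})=(a,b)\,\delta_{mn}\,\mathbf k\quad(a,b\in\mathfrak h,\ m,n\in\mathbb N)$$ and $(a\otimes t^{n+\frac12})\mathbf k=\mathbf k(a\otimes t^{n+\frac12})$ for $a\in\mathfrak h$, $n\in\mathbb Z$ (no relation is imposed between two positive modes or between two negative modes). Let $V$ be the $N$-module induced from the one-dimensional module $\mathbb C\mathbf 1$ on which $a\otimes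 t^{n+1/2}$ acts by $0$ for $n\ge 0$ and $\mathbf k$ acts by $1$. Write $a(n+\frac12)$ for the action of $a\otimes t^{n+1/2}$ on $V$. For $a\in\mathfrak h$ and $m\in\mathbb N$ put $$a^{(m)}(x)_V^-=\sum_{n\ge0}\binom nm a(-n-\tfrac12)x^{n-m},\qquad a^{(m)}(x)_V^+=\sum_{n\ge0}\binom{-n-1}m a(n+\tfrac12)x^{-n-1-m}.$$ The normal-ordered product is $$:\!a_1^{(m_1)}(x)_V\cdots a_r^{(m_r)}(x)_V\!:\ =\sum_{\mu=0}^r\sum_\sigma(-1)^\sigma\, a_{\sigma(1)}^{(m_{\sigma(1)})}(x)_V^-\cdots a_{\sigma(\mu)}^{(m_{\sigma(\mu)})}(x)_V^-\; a_{\sigma(\mu+1)}^{(m_{\sigma(\mu+1)})}(x)_V^+\cdots a_{\sigma(r)}^{(m_{\sigma(r)})}(x)_V^+,$$ where $\sigma$ runs over the permutations of $\{1,\dots,r\}$ with $\sigma(1)<\dots<\sigma(\mu)$ and $\sigma(\mu+1)<\dots<\sigma(r)$, and $(-1)^\sigma$ is the sign of $\sigma$. Let $$C_{mn}=\frac12\,\frac{m-n}{m+n+1}\binom{-1/2}m\binom{-1/2}n,\qquad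 \Delta(y)=\sum_{i=1}^M\sum_{m,n\ge0}C_{mn}\,e_i(m+\tfrac12)\,\bar e_i(n+\tfrac12)\,y^{-m-n-1}.$$ Let $$g(X,Y)=\tfrac12X^{-1/2}Y^{-1/2}\frac{X+Y}{X-Y},\qquad g_{mn}=\frac1{m!\,n!}\frac{\partial^{m+n}}{\partial X^m\,\partial Y^n}\,g.$$ Let $\iota_{yx}$ denote the expansion of powers of $y+x$ in nonnegative powers of $x$; thus $\iota_{yx}g_{mn}(x+y,y)\in\mathbb C((y))((x))$. For $a_1,\dots,a_r\in\mathfrak h$, $m_1,\dots,m_r\in\mathbb N$ and $1\le i_1<\dots<i_{2t}\le r$, the total contraction number is defined recursively: it is $1$ for $t=0$, and for $t\ge1$ $$T_{a_1,\dots,a_r}^{m_1,\dots,m_r}(i_1,\dots,i_{2t})=\sum_{k=2}^{2t}(-1)^k(a_{i_1},a_{i_k})\,C_{m_{i_1}m_{i_k}}\,T_{a_1,\dots,a_r}^{m_1,\dots,m_r}(i_2,\dots,\widehat{i_k},\dots,i_{2t}).$$ **Theorem.** Let $r,s\in\mathbb N$, $a_1,\dots,a_r,b_1,\dots,b_s\in\mathfrak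 h$ and $m_1,\dots,m_r,n_1,\dots,n_s\in\mathbb N$. Then, as series in $V[[x,x^{-1},y,y^{-1}]]$, $$\begin{aligned} &\exp(\Delta(y)):\!a_1^{(m_1)}(x)_V\cdots a_r^{(m_r)}(x)_V\!:\;b_1(-n_1-\tfrac12)\cdots b_s(-n_s-\tfrac12)\mathbf 1\\ &=\sum_{k\ge0}\ \sum_{1\le p_1<\dots<p_{2k}\le r}(-1)^{p_1+\dots+p_{2k}}\,T_{a_1,\dots,a_r}^{m_1,\dots,m_r}(p_1,\dots,p_{2k})\;\iota_{yx}(y+x)^{-m_{p_1}-\dots-m_{p_{2k}}-k}\\ &\quad\cdot\sum_{l\ge0}\ \sum_{1\le q_1<\dots<q_{2l}\le s}(-1)^{q_1+\dots+q_{2l}}\,T_{b_1,\dots,b_s}^{n_1,\dots,n_s}(q_1,\dots,q_{2l})\;y^{-n_{q_1}-\dots-n_{q_{2l}}-l}\\ &\quad\cdot\sum_{\rho=0}^{\min\{r-2k,\,s-2l\}}\ \sum_{\substack{1\le i_1<\dots<i_\rho\le r-2k\\1\le j_1<\dots<j_\rho\le s-2l}}(-1)^{i_1+\dots+i_\rho+j_1+\dots+j_\rho}\,(-1)^{(r-2k)\rho+\frac{\rho(\rho+1)}2}\\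 &\qquad\cdot\det\Bigl[(a_{p^c_{i_\alpha}},b_{q^c_{j_\beta}})\;\iota_{yx}\,g_{m_{p^c_{i_\alpha}}\,n_{q^c_{j_\beta}}}(x+y,y)\Bigr]_{\alpha,\beta=1}^{\rho}\\ &\qquad\cdot\prod_{\gamma=1}^{r-2k-\rho}a_{u_\gamma}^{(m_{u_\gamma})}(x)_V^-\;\prod_{\gamma=1}^{s-2l-\rho}b_{v_\gamma}(-n_{v_\gamma}-\tfrac12)\;\mathbf 1 . \end{aligned}$$ Here $p^c_1<\dots<p^c_{r-2k}$, $q^c_1<\dots<q^c_{s-2l}$, $i^c_1<\dots<i^c_{r-2k-\rho}$ and $j^c_1<\dots<j^c_{s-2l-\rho}$ are the increasing sequences complementary to $p$ in $\{1,\dots,r\}$, to $q$ in $\{1,\dots,s\}$, to $i$ in $\{1,\dots,r-2k\}$ and to $j$ in $\{1,\dots,s-2l\}$; $u_\gamma=p^c_{i^c_\gamma}$ and $v_\gamma=q^c_{j^c_\gamma}$; the noncommutative products are taken from left to right in increasing order of $\gamma$; and the empty determinant is $1$. -/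

import Mathlib

open scoped Nat

noncomputable section

namespace FermionicFock

/-! ### The algebra of modes and the Fock space `V` -/

section FockSpace

variable {𝔥 : Type*} [AddCommGroup 𝔥] [Module ℂ 𝔥] (B : LinearMap.BilinForm ℂ 𝔥)

variable (𝔥) in
/-- The affinization `𝔥 ⊗ t^{1/2} ℂ[t, t⁻¹] ⊕ ℂ 𝐤`. A finitely supported `f : ℤ →₀ 𝔥` stands for
the sum of the `f n ⊗ t^{n + 1/2}`. -/
abbrev Affinization : Type _ := (ℤ →₀ 𝔥) × ℂ

/-- The element `a ⊗ t^{n + 1/2}` in the tensor algebra of the affinization. -/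
def tensorMode (a : 𝔥) (n : ℤ) : TensorAlgebra ℂ (Affinization 𝔥) :=
  TensorAlgebra.ι ℂ (Finsupp.single n a, 0)

variable (𝔥) in
/-- The element `𝐤` in the tensor algebra of the affinization. -/
def tensorCentral : TensorAlgebra ℂ (Affinization 𝔥) :=
  TensorAlgebra.ι ℂ (0, 1)

/-- The defining relations: a positive mode and a negative mode anticommute up to the contraction,
and `𝐤` is central. Nothing is imposed on two positive modes or on two negative modes. -/
inductive ModeRel :
    TensorAlgebra ℂ (Affinization 𝔥) → TensorAlgebra ℂ (Affinization 𝔥) → Prop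
  | anticomm (a b : 𝔥) (m n : ℕ) :
      ModeRel
        (tensorMode a m * tensorMode b (-n - 1) + tensorMode b (-n - 1) * tensorMode a m)
        (if m = n then B a b • tensorCentral 𝔥 else 0)
  | central (a : 𝔥) (n : ℤ) :
      ModeRel (tensorMode a n * tensorCentral 𝔥) (tensorCentral 𝔥 * tensorMode a n)

/-- The quotient `N` of the tensor algebra by the two-sided ideal of the relations above. -/
def ModeAlgebra : Type _ := RingQuot (ModeRel B)

instance : Ring (ModeAlgebra B) := inferInstanceAs (Ring (RingQuot (ModeRel B)))

instance : Algebra ℂ (ModeAlgebra B) := inferInstanceAs (Algebra ℂ (RingQuot (ModeRel B)))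

/-- The quotient map onto `N`. -/
def toModeAlgebra : TensorAlgebra ℂ (Affinization 𝔥) →ₐ[ℂ] ModeAlgebra B :=
  RingQuot.mkAlgHom ℂ (ModeRel B)

/-- The left ideal of `N` generated by the positive modes `a ⊗ t^{n + 1/2}`, `n ≥ 0`,
and by `𝐤 - 1`. -/
def vacuumIdeal : Submodule (ModeAlgebra B) (ModeAlgebra B) :=
  Submodule.span (ModeAlgebra B)
    ({x | ∃ (a : 𝔥) (n : ℕ), x = toModeAlgebra B (tensorMode a n)} ∪
      {toModeAlgebra B (tensorCentral 𝔥) - 1})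

/-- The Fock space `V`: the `N`-module induced from the one-dimensional module `ℂ 𝟏` on which
the positive modes act by zero and `𝐤` acts by one. -/
def Fock : Type _ := ModeAlgebra B ⧸ vacuumIdeal B

instance : AddCommGroup (Fock B) := inferInstanceAs (AddCommGroup (ModeAlgebra B ⧸ vacuumIdeal B))

instance : Module (ModeAlgebra B) (Fock B) :=
  inferInstanceAs (Module (ModeAlgebra B) (ModeAlgebra B ⧸ vacuumIdeal B))

instance : Module ℂ (Fock B) :=
  inferInstanceAs (Module ℂ (ModeAlgebra B ⧸ vacuumIdeal B))

instance : IsScalarTower ℂ (ModeAlgebra B) (Fock B) :=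
  inferInstanceAs (IsScalarTower ℂ (ModeAlgebra B) (ModeAlgebra B ⧸ vacuumIdeal B))

/-- The vacuum vector `𝟏`. -/
def vac : Fock B := Submodule.Quotient.mk (p := vacuumIdeal B) 1

/-- The mode `a(n + 1/2)` acting on `V`, for an integer `n`. -/
def mode (a : 𝔥) (n : ℤ) : Module.End ℂ (Fock B) :=
  Algebra.lsmul ℂ ℂ (Fock B) (toModeAlgebra B (tensorMode a n))

/-- The vector `b_1(-n_1 - 1/2) ⋯ b_s(-n_s - 1/2) 𝟏`. -/
def fockVec {s : ℕ} (b : Fin s → 𝔥) (n : Fin s → ℕ) : Fock B :=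
  (List.ofFn fun j => mode B (b j) (-(n j : ℤ) - 1)).prod (vac B)

end FockSpace

/-! ### Increasing sequences and their complements -/

instance (k n : ℕ) : Fintype (Fin k ↪o Fin n) :=
  Fintype.ofInjective (fun p : Fin k ↪o Fin n => (p : Fin k → Fin n)) DFunLike.coe_injective

theorem card_complement {k n : ℕ} (p : Fin k ↪o Fin n) :
    (Finset.univ.map p.toEmbedding)ᶜ.card = n - k := by
  simp [Finset.card_compl]

/-- The increasing sequence of the elements that do not occur in the increasing sequence `p`. -/
def complSeq {k n : ℕ} (p : Fin k ↪o Fin n) : Fin (n - k) ↪o Fin n :=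
  (Finset.univ.map p.toEmbedding)ᶜ.orderEmbOfFin (card_complement p)

/-- The sum `p_1 + ⋯ + p_k` of an increasing sequence in `{1, …, n}`. -/
def seqSum {k n : ℕ} (p : Fin k ↪o Fin n) : ℕ := ∑ α, ((p α : ℕ) + 1)

/-- The number of inversions of the 2-shuffle `(p_1, …, p_k, pᶜ_1, …, pᶜ_{n-k})`. -/
def inversions {k n : ℕ} (p : Fin k ↪o Fin n) : ℕ :=
  (Finset.univ.filter fun q : Fin k × Fin (n - k) => complSeq p q.2 < p q.1).card

/-! ### Negative and positive parts of the fields, normal ordering -/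

section Fields

variable {𝔥 : Type*} [AddCommGroup 𝔥] [Module ℂ 𝔥] (B : LinearMap.BilinForm ℂ 𝔥)

/-- `a^{(m)}(x)⁻ = ∑_{n ≥ 0} (n choose m) a(-n - 1/2) x^{n - m}`, a power series in `x`
(the terms with `n < m` vanish, and `n = k + m` below). -/
def negSeries (a : 𝔥) (m : ℕ) : PowerSeries (Module.End ℂ (Fock B)) :=
  PowerSeries.mk fun k => ((k + m).choose m : ℂ) • mode B a (-((k + m : ℕ) : ℤ) - 1)

/-- `a^{(m)}(x)⁺ = ∑_{n ≥ 0} (-n-1 choose m) a(n + 1/2) x^{-n-1-m}`, a power series in `x⁻¹`. -/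
def posSeries (a : 𝔥) (m : ℕ) : PowerSeries (Module.End ℂ (Fock B)) :=
  PowerSeries.X ^ (m + 1) *
    PowerSeries.mk fun n : ℕ => Ring.choose (-(n : ℂ) - 1) m • mode B a n

/-- `a_1^{(m_1)}(x)⁻ ⋯ a_r^{(m_r)}(x)⁻`, a power series in `x`. -/
def negProd {r : ℕ} (a : Fin r → 𝔥) (m : Fin r → ℕ) : PowerSeries (Module.End ℂ (Fock B)) :=
  (List.ofFn fun i => negSeries B (a i) (m i)).prod

/-- `a_1^{(m_1)}(x)⁺ ⋯ a_r^{(m_r)}(x)⁺`, a power series in `x⁻¹`. -/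
def posProd {r : ℕ} (a : Fin r → 𝔥) (m : Fin r → ℕ) : PowerSeries (Module.End ℂ (Fock B)) :=
  (List.ofFn fun i => posSeries B (a i) (m i)).prod

/-- `P(x) Q(x⁻¹) v`, for power series `P(x)` in `x` and `Q(x⁻¹)` in `x⁻¹`, as a series
`∑_N w_N x^N` with coefficients in `V`. The sum is finite for products of negative and
positive parts of fields, as `Q_k v = 0` for large `k`. -/
def applyNegPos (P Q : PowerSeries (Module.End ℂ (Fock B))) (v : Fock B) : ℤ → Fock B :=
  fun N => ∑ᶠ p : ℕ × ℕ,
    if (p.1 : ℤ) - p.2 = N then PowerSeries.coeff p.1 P (PowerSeries.coeff p.2 Q v) else 0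

/-- The normal-ordered product `:a_1^{(m_1)}(x) ⋯ a_r^{(m_r)}(x):` applied to `v`, as a series in
`x` with coefficients in `V`: the sum over all 2-shuffles `p` of the sign of `p` times the product
of the negative parts at the places `p` followed by the positive parts at the other places. -/
def normalOrdered {r : ℕ} (a : Fin r → 𝔥) (m : Fin r → ℕ) (v : Fock B) : ℤ → Fock B :=
  ∑ μ ∈ Finset.range (r + 1), ∑ p : Fin μ ↪o Fin r,
    (-1 : ℂ) ^ inversions p •
      applyNegPos B (negProd B (a ∘ p) (m ∘ p)) (posProd B (a ∘ complSeq p) (m ∘ complSeq p)) v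

end Fields

/-! ### The operator `exp (Δ(y))` -/

/-- `C_{mn} = (1/2) (m - n)/(m + n + 1) (-1/2 choose m) (-1/2 choose n)`. -/
def cCoeff (m n : ℕ) : ℂ :=
  1 / 2 * (((m : ℂ) - n) / ((m : ℂ) + n + 1)) *
    Ring.choose (-1 / 2 : ℂ) m * Ring.choose (-1 / 2 : ℂ) n

section ExpDelta

variable {𝔥 : Type*} [AddCommGroup 𝔥] [Module ℂ 𝔥] (B : LinearMap.BilinForm ℂ 𝔥)

/-- `Δ(y) = ∑_i ∑_{m, n ≥ 0} C_{mn} e_i(m + 1/2) e'_i(n + 1/2) y^{-m-n-1}`,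
a power series in `y⁻¹` without constant term. -/
def deltaSeries {M : ℕ} (e e' : Fin M → 𝔥) : PowerSeries (Module.End ℂ (Fock B)) :=
  PowerSeries.X * PowerSeries.mk fun N =>
    ∑ p ∈ Finset.HasAntidiagonal.antidiagonal N, ∑ i : Fin M,
      cCoeff p.1 p.2 • (mode B (e i) p.1 * mode B (e' i) p.2)

/-- `exp (Δ(y)) = ∑_k Δ(y)^k / k!`, a power series in `y⁻¹`. As `Δ(y)` has no constant term,
`Δ(y)^k` does not contribute to the coefficient of `y^{-N}` when `k > N`. -/
def expDelta {M : ℕ} (e e' : Fin M → 𝔥) : PowerSeries (Module.End ℂ (Fock B)) :=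
  PowerSeries.mk fun N => ∑ k ∈ Finset.range (N + 1),
    ((k ! : ℂ)⁻¹) • PowerSeries.coeff N (deltaSeries B e e' ^ k)

/-- `exp (Δ(y))` applied to a series `∑_i w_i x^i`; the value at `i`, `j` is the coefficient
of `x^i y^j`. -/
def expDeltaApply {M : ℕ} (e e' : Fin M → 𝔥) (w : ℤ → Fock B) : ℤ → ℤ → Fock B :=
  fun i j => if j ≤ 0 then PowerSeries.coeff (-j).toNat (expDelta B e e') (w i) else 0

end ExpDelta

/-! ### Scalar series in `x` and `y`, the functions `g_{mn}` and their expansions -/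

/-- The ring `ℂ((y))((x))`: the outer variable is `x`, the inner one is `y`. The expansion
`ι_{yx}` in nonnegative powers of `x` takes values here. -/
abbrev ScalarSeries : Type := LaurentSeries (LaurentSeries ℂ)

/-- A complex constant as a series. -/
def const (z : ℂ) : ScalarSeries := HahnSeries.C (HahnSeries.C z)

/-- The monomial `y^d`. -/
def yPow (d : ℤ) : ScalarSeries := HahnSeries.C (HahnSeries.single d 1)

/-- The monomial `x^c`. -/
def xPow (c : ℤ) : ScalarSeries := HahnSeries.single c 1

/-- `∑_{k ≥ 0} (α choose k) x^k y^{d-k}`, the expansion `ι_{yx}` of `(y + x)^α y^{d-α}`. -/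
def expandBinom (α : ℂ) (d : ℤ) : ScalarSeries :=
  HahnSeries.ofPowerSeries ℤ (LaurentSeries ℂ)
    (PowerSeries.mk fun k : ℕ => HahnSeries.single (d - k) (Ring.choose α k))

/-- Formal linear combinations of the functions `X^{a-1/2} Y^{b-1/2} (X - Y)^c` with integers
`a`, `b`, `c`; the basis element `single (a, b, c) 1` stands for that function. -/
abbrev AlgFun : Type := ℤ × ℤ × ℤ →₀ ℂ

/-- The partial derivative in `X`. -/
def partialX : AlgFun →ₗ[ℂ] AlgFun :=
  Finsupp.linearCombination ℂ fun t : ℤ × ℤ × ℤ =>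
    Finsupp.single (t.1 - 1, t.2.1, t.2.2) ((t.1 : ℂ) - 1 / 2) +
      Finsupp.single (t.1, t.2.1, t.2.2 - 1) (t.2.2 : ℂ)

/-- The partial derivative in `Y`. -/
def partialY : AlgFun →ₗ[ℂ] AlgFun :=
  Finsupp.linearCombination ℂ fun t : ℤ × ℤ × ℤ =>
    Finsupp.single (t.1, t.2.1 - 1, t.2.2) ((t.2.1 : ℂ) - 1 / 2) -
      Finsupp.single (t.1, t.2.1, t.2.2 - 1) (t.2.2 : ℂ)

/-- `g(X, Y) = (1/2) X^{-1/2} Y^{-1/2} (X + Y) (X - Y)^{-1}`. -/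
def gFun : AlgFun :=
  Finsupp.single (1, 0, -1) (1 / 2) + Finsupp.single (0, 1, -1) (1 / 2)

/-- `g_{mn}(X, Y) = (1 / (m! n!)) ∂_X^m ∂_Y^n g(X, Y)`. -/
def gDeriv (m n : ℕ) : AlgFun :=
  ((m ! : ℂ) * (n ! : ℂ))⁻¹ • (partialX ^ m) ((partialY ^ n) gFun)

/-- The substitution `X = x + y`, `Y = y` followed by the expansion `ι_{yx}`: the function
`X^{a-1/2} Y^{b-1/2} (X - Y)^c` becomes `x^c (y + x)^{a-1/2} y^{b-1/2}`, in which the power of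
`y + x` is expanded in nonnegative powers of `x`. -/
def iotaYX : AlgFun →ₗ[ℂ] ScalarSeries :=
  Finsupp.linearCombination ℂ fun t : ℤ × ℤ × ℤ =>
    xPow t.2.2 * expandBinom ((t.1 : ℂ) - 1 / 2) (t.1 + t.2.1 - 1)

/-! ### Total contraction numbers and the product of a scalar series with a vector series -/

/-- The total contraction number of a list of indices `i_1, …, i_{2t}`, where `c i j` is the
contraction of `i` and `j`: the first index is contracted with each of the others, with
alternating signs. For `t = 0` it is `1`. -/
def contractList {ι : Type*} (c : ι → ι → ℂ) : ℕ → List ι → ℂ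
  | 0, _ => 1
  | _ + 1, [] => 0
  | t + 1, i :: L =>
      ∑ k : Fin L.length, (-1 : ℂ) ^ (k : ℕ) * c i (L.get k) * contractList c t (L.eraseIdx k)

section Formula

variable {𝔥 : Type*} [AddCommGroup 𝔥] [Module ℂ 𝔥] (B : LinearMap.BilinForm ℂ 𝔥)

/-- The total contraction number `T_{a_1, …, a_r}^{m_1, …, m_r}(p_1, …, p_{2t})`. -/
def totalContraction {r : ℕ} (a : Fin r → 𝔥) (m : Fin r → ℕ) {t : ℕ} (p : Fin (2 * t) ↪o Fin r) :
    ℂ :=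
  contractList (fun i j => B (a i) (a j) * cCoeff (m i) (m j)) t (List.ofFn p)

/-- The product of a scalar series in `ℂ((y))((x))` and a series `∑_{n ≥ 0} w_n x^n` with
coefficients in `V`; the value at `i`, `j` is the coefficient of `x^i y^j`. The sum is finite,
as a scalar series has only finitely many negative powers of `x`. -/
def scalarMul (f : ScalarSeries) (w : ℕ → Fock B) : ℤ → ℤ → Fock B :=
  fun i j => ∑ᶠ n : ℕ, (f.coeff (i - n)).coeff j • w n

end Formula

end FermionicFock

end

open FermionicFock

/-! The formula is Wick's theorem for a conjugated word. For each `b` the commutator of `Δ(y)` with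
`b(-n-1/2)` is the series `D = ∑ C_{jn} b(j+1/2) y^{-j-n-1}` in positive modes
(`deltaSeries_mul_C`). Positive modes anticommute on `V`, although not by a relation of `N`
(`mode_mul_mode_pos`), so `D` commutes with the quadratic `Δ(y)` and `exp(Δ) b = b exp(Δ) + exp(Δ)
D` (`expDelta_mul_C`). As `exp(Δ)` fixes the vacuum, it shifts every creation operator by its `D`.
By linearity it shifts every field `a^{(m)}(x)⁻` in the same way.

Moving all annihilating operators to the vacuum leaves the sum over partial contractions. Two fields
contract through the shift of one of them, and so do two modes. A field and a mode contract through
`a^{(m)}(x)⁺`, which gives the polar part in `x`, and through the shift, which gives the regular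
part. The abstract form is `contraction_formula`: the conjugated word and the sum over contractions
satisfy the same recursion in the first letter (`contractionSum_cons_left`). The signs are handled
on lists, where `contr` is an interior product and `splitSum` is a signed unshuffle coproduct.

For the series to become honest operators, `V` is replaced by Laurent series in `x` over `ℂ((y)) ⊗
V`, a module over `ℂ((y))((x))`. The series in `y⁻¹` may be evaluated there because only finitely
many coefficients act nontrivially on any given vector (`locallyFinite_expDelta`).

The contractions are then computed. The recursion `cCoeff_succ` says that `f = ∑ C_{mn} X^m Z^n
y^{-m-n-1}` is killed by `∂_X + ∂_Z - ∂_y`, so translating `X` and `Z` by `x` amounts to replacing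
`y` by `y + x`. This produces the powers of `y + x` (`sum_choose_mul_cCoeff`, `fieldPairing_invY`).
The same recursion governs the expansion of `g_{mn}` (`coeff_iotaYX_partialY_pow`), whose polar and
regular parts are the two contributions above (`mixedPairing_invY`). -/

namespace FermionicFock

/-! ### Interior products and signed unshuffles of lists -/

section Contractions

variable {α β K W W' : Type*} [CommRing K] [AddCommGroup W] [Module K W]
  [AddCommGroup W'] [Module K W']

/-- The contraction `∑_k (-1)^k χ(L_k) F(L with L_k removed)`. -/
def contr (χ : α → K) (F : List α → W) : List α → W
  | [] => 0
  | x :: L => χ x • F L - contr χ (fun L' => F (x :: L')) L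

/-- The sum over all unshuffles `(p, c)` of a list of the sign of the unshuffle times `F p c`. -/
def splitSum (F : List α → List α → W) : List α → W
  | [] => F [] []
  | x :: L => splitSum (fun p c => F (x :: p) c) L +
      splitSum (fun p c => (-1 : ℤ) ^ p.length • F p (x :: c)) L

theorem contr_congr {χ : α → K} {F G : List α → W} (L : List α)
    (h : ∀ L', L'.length + 1 = L.length → F L' = G L') : contr χ F L = contr χ G L := by
  induction L generalizing F G with
  | nil => rfl
  | cons x L ih =>
    rw [contr, contr, h L (by simp), ih fun L' hL' => h _ (by simp [hL'])]

theorem splitSum_congr {F G : List α → List α → W} (L : List α)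
    (h : ∀ p c, p.length + c.length = L.length → F p c = G p c) :
    splitSum F L = splitSum G L := by
  induction L generalizing F G with
  | nil => exact h _ _ rfl
  | cons x L ih =>
    rw [splitSum, splitSum]
    congr 1
    · exact ih fun p c hpc => h _ _ (by simp [← hpc]; ring)
    · exact ih fun p c hpc => by rw [h _ _ (by simp [← hpc]; ring)]

theorem map_contr (f : W →ₗ[K] W') (χ : α → K) (F : List α → W) (L : List α) :
    f (contr χ F L) = contr χ (fun L' => f (F L')) L := by
  induction L generalizing F with
  | nil => simp [contr]
  | cons x L ih => simp [contr, ih]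

theorem contr_add (χ : α → K) (F G : List α → W) (L : List α) :
    contr χ (fun L' => F L' + G L') L = contr χ F L + contr χ G L := by
  induction L generalizing F G with
  | nil => simp [contr]
  | cons x L ih => simp only [contr, ih]; module

theorem contr_add_left (χ ψ : α → K) (F : List α → W) (L : List α) :
    contr (fun x => χ x + ψ x) F L = contr χ F L + contr ψ F L := by
  induction L generalizing F with
  | nil => simp [contr]
  | cons x L ih => simp only [contr, ih]; module

theorem contr_smul (χ : α → K) (k : K) (F : List α → W) (L : List α) :
    contr χ (fun L' => k • F L') L = k • contr χ F L :=
  (map_contr (LinearMap.lsmul K W k) χ F L).symm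

theorem contr_zsmul (χ : α → K) (k : ℤ) (F : List α → W) (L : List α) :
    contr χ (fun L' => k • F L') L = k • contr χ F L := by
  simpa only [Int.cast_smul_eq_zsmul] using contr_smul χ (k : K) F L

theorem contr_neg (χ : α → K) (F : List α → W) (L : List α) :
    contr χ (fun L' => -F L') L = -contr χ F L := by
  simpa using contr_smul χ (-1 : K) F L

theorem contr_sub (χ : α → K) (F G : List α → W) (L : List α) :
    contr χ (fun L' => F L' - G L') L = contr χ F L - contr χ G L := by
  simp only [sub_eq_add_neg, contr_add, contr_neg]

theorem contr_smul_right (χ : α → K) (f : List α → K) (w : W) (L : List α) :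
    contr χ (fun L' => f L' • w) L = contr χ f L • w :=
  (map_contr (LinearMap.toSpanSingleton K W w) χ f L).symm

theorem contr_parity (χ : α → K) (F : List α → W) (L : List α) :
    contr χ (fun L' => (-1 : ℤ) ^ L'.length • F L') L = -((-1 : ℤ) ^ L.length • contr χ F L) := by
  rw [contr_congr (G := fun L' => -((-1 : ℤ) ^ L.length • F L'))]
  · rw [contr_neg, contr_zsmul]
  · intro L' h
    rw [← h, pow_succ]
    module

/-- Interior products anticommute. This is the source of the anticommutation of positive modes on
`V`. -/
theorem contr_contr (χ ψ : α → K) (F : List α → W) (L : List α) :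
    contr χ (contr ψ F) L = -contr ψ (contr χ F) L := by
  induction L generalizing F with
  | nil => simp [contr]
  | cons x L ih =>
    simp only [contr, contr_sub, contr_smul]
    rw [ih]
    module

theorem contr_comm {χ : α → K} {ψ : β → K} (F : List α → List β → W) (L : List α) (L' : List β) :
    contr χ (fun l => contr ψ (F l) L') L = contr ψ (fun l' => contr χ (fun l => F l l') L) L' := by
  induction L generalizing F with
  | nil =>
    have := contr_smul ψ (0 : K) (fun _ => (0 : W)) L'
    simpa [contr] using this.symm
  | cons x L ih =>
    simp only [contr, ih, contr_sub, contr_smul]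

theorem map_splitSum (f : W →+ W') (F : List α → List α → W) (L : List α) :
    f (splitSum F L) = splitSum (fun p c => f (F p c)) L := by
  induction L generalizing F with
  | nil => simp [splitSum]
  | cons x L ih => simp [splitSum, ih]

theorem splitSum_add (F G : List α → List α → W) (L : List α) :
    splitSum (fun p c => F p c + G p c) L = splitSum F L + splitSum G L := by
  induction L generalizing F G with
  | nil => simp [splitSum]
  | cons x L ih => simp only [splitSum, smul_add, ih]; abel

theorem splitSum_smul (k : K) (F : List α → List α → W) (L : List α) :
    splitSum (fun p c => k • F p c) L = k • splitSum F L :=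
  (map_splitSum (LinearMap.lsmul K W k).toAddMonoidHom F L).symm

theorem splitSum_zsmul (k : ℤ) (F : List α → List α → W) (L : List α) :
    splitSum (fun p c => k • F p c) L = k • splitSum F L :=
  splitSum_smul k F L

theorem splitSum_neg (F : List α → List α → W) (L : List α) :
    splitSum (fun p c => -F p c) L = -splitSum F L := by
  simpa using splitSum_zsmul (-1) F L

theorem splitSum_sub (F G : List α → List α → W) (L : List α) :
    splitSum (fun p c => F p c - G p c) L = splitSum F L - splitSum G L := by
  simp only [sub_eq_add_neg, splitSum_add, splitSum_neg]

theorem splitSum_nil_left (F : List α → List α → W) (hF : ∀ p c, p ≠ [] → F p c = 0)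
    (L : List α) : splitSum F L = F [] L := by
  induction L generalizing F with
  | nil => rfl
  | cons x L ih =>
    rw [splitSum, ih (fun p c => F (x :: p) c) fun p c _ => hF _ _ (by simp),
      ih (fun p c => (-1 : ℤ) ^ p.length • F p (x :: c)) fun p c hp => by simp [hF p _ hp]]
    simp [hF [x] L (by simp)]

theorem contr_splitSum (χ : β → K) (F : List β → List α → List α → W) (L : List α)
    (L' : List β) :
    contr χ (fun l => splitSum (F l) L) L' = splitSum (fun p c => contr χ (F · p c) L') L := by
  induction L generalizing F with
  | nil => rfl
  | cons x L ih => simp only [splitSum, contr_add, ih, contr_zsmul]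

/-- Together with `splitSum_contr_right`: the interior product is an antiderivation for the
unshuffle coproduct. The removed entry is first brought to the front of its block; from the right
block it must also pass `p`, whence the sign `(-1)^|p|` there. -/
theorem splitSum_contr_left (χ : α → K) (F : List α → List α → W) (L : List α) :
    splitSum (fun p c => contr χ (fun p' => F p' c) p) L = contr χ (splitSum F) L := by
  induction L generalizing F with
  | nil => simp [splitSum, contr]
  | cons x L ih =>
    have h : ∀ p c : List α, (-1 : ℤ) ^ p.length • contr χ (fun p' => F p' (x :: c)) p =
        -contr χ (fun p' => (-1 : ℤ) ^ p'.length • F p' (x :: c)) p := fun p c => by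
      rw [contr_parity, neg_neg]
    simp only [splitSum, contr, h, splitSum_sub, splitSum_neg, splitSum_smul, ih, contr_add]
    abel

theorem splitSum_contr_right (χ : α → K) (F : List α → List α → W) (L : List α) :
    splitSum (fun p c => (-1 : ℤ) ^ p.length • contr χ (F p) c) L = contr χ (splitSum F) L := by
  induction L generalizing F with
  | nil => simp [splitSum, contr]
  | cons x L ih =>
    have h : ∀ p c : List α, (-1 : ℤ) ^ (x :: p).length • contr χ (F (x :: p)) c =
        -((-1 : ℤ) ^ p.length • contr χ (F (x :: p)) c) := fun p c => by
      rw [List.length_cons, pow_succ]; module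
    have h' : ∀ p c : List α,
        (-1 : ℤ) ^ p.length • (-1 : ℤ) ^ p.length • contr χ (F p) (x :: c) =
        χ x • F p c -
          (-1 : ℤ) ^ p.length • contr χ (fun c' => (-1 : ℤ) ^ p.length • F p (x :: c')) c := by
      intro p c
      rw [contr_zsmul, smul_smul, smul_smul, ← mul_pow]
      simp [contr]
    rw [splitSum, splitSum_congr L fun p c _ => h p c, splitSum_congr L fun p c _ => h' p c,
      splitSum_neg, splitSum_sub, splitSum_smul, ih (fun p c => F (x :: p) c),
      ih (fun p c => (-1 : ℤ) ^ p.length • F p (x :: c))]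
    simp only [splitSum, contr, contr_add]
    abel

end Contractions

/-! ### The abstract contraction formula -/

section ContractionFormula

variable {α β K W : Type*} [CommRing K] [AddCommGroup W] [Module K W]

/-- The total contraction of a list: its first entry is contracted with each of the others, with
alternating signs. -/
def pf (χ : α → α → K) : List α → K
  | [] => 1
  | x :: L => ∑ k : Fin L.length, (-1) ^ (k : ℕ) * χ x (L.get k) * pf χ (L.eraseIdx k)
termination_by L => L.length
decreasing_by
  exact Nat.lt_succ_of_le (List.length_eraseIdx_le L k)

theorem contr_eq_sum (χ : α → K) (F : List α → W) (L : List α) :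
    contr χ F L =
      ∑ k : Fin L.length, ((-1) ^ (k : ℕ) * χ (L.get k)) • F (L.eraseIdx k) := by
  induction L generalizing F with
  | nil => simp [contr]
  | cons x L ih =>
    rw [contr, ih]
    simp only [List.length_cons]
    rw [Fin.sum_univ_succ]
    simp [pow_succ, Finset.sum_neg_distrib, sub_eq_add_neg]

theorem pf_cons (χ : α → α → K) (x : α) (L : List α) :
    pf χ (x :: L) = contr (χ x) (pf χ) L := by
  rw [pf, contr_eq_sum]
  simp

/-- A total contraction pairs off the entries, so it vanishes in odd length and the parity sign is
invisible. The bound `n` serves an induction that removes two entries at a time. -/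
theorem neg_one_pow_smul_pf (χ : α → α → K) (n : ℕ) (L : List α) (hn : L.length ≤ n) :
    (-1 : ℤ) ^ L.length • pf χ L = pf χ L := by
  induction n generalizing L with
  | zero => simp [List.length_eq_zero_iff.mp (Nat.le_zero.mp hn)]
  | succ n ih =>
    cases L with
    | nil => simp
    | cons x L =>
      rw [pf_cons, ← contr_zsmul]
      refine contr_congr L fun L' hL' => ?_
      have := ih L' (by simp at hn; omega)
      rwa [List.length_cons, ← hL', pow_succ, pow_succ, mul_assoc, neg_one_mul, neg_neg, mul_one]

/-- The determinant `det [g x_i y_j]` for two lists, `0` if their lengths are different. -/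
def detList (g : α → β → K) : List α → List β → K
  | [], [] => 1
  | [], _ :: _ => 0
  | x :: L, L' => contr (g x) (detList g L) L'

/-- The sum over the partial matchings of two lists. -/
def matchSum (g : α → β → K) (w : List α → List β → W) (c : List α) (c' : List β) : W :=
  splitSum (fun i ic => splitSum (fun j jc =>
    (-1 : ℤ) ^ (c.length * i.length + i.length * (i.length + 1) / 2) •
      detList g i j • w ic jc) c') c

/-- The right-hand side of the contraction formula for two lists of operators. -/
def contractionSum (χ : α → α → K) (θ : β → β → K) (g : α → β → K) (w : List α → List β → W)
    (La : List α) (Lb : List β) : W :=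
  splitSum (fun p c => pf χ p • splitSum (fun q c' => pf θ q • matchSum g w c c') Lb) La

/-- Matching one more letter raises both `c` and `i` by one. The exponent then grows by `c` plus an
even number, which is the sign for carrying that letter past the other `c`. -/
theorem neg_one_pow_triangle (c i : ℕ) :
    (-1 : ℤ) ^ ((c + 1) * (i + 1) + (i + 1) * (i + 1 + 1) / 2) =
      (-1) ^ c * (-1) ^ (c * i + i * (i + 1) / 2) := by
  have h : (i + 1) * (i + 1 + 1) / 2 = i * (i + 1) / 2 + (i + 1) := by
    rw [show (i + 1) * (i + 1 + 1) = i * (i + 1) + (i + 1) * 2 by ring]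
    exact Nat.add_mul_div_right _ _ (by norm_num)
  rw [h, ← pow_add, show (c + 1) * (i + 1) + (i * (i + 1) / 2 + (i + 1)) =
    c + (c * i + i * (i + 1) / 2) + 2 * (i + 1) by ring, pow_add _ _ (2 * (i + 1)), pow_mul]
  simp

theorem matchSum_nil (g : α → β → K) (w : List α → List β → W) (c' : List β) :
    matchSum g w [] c' = w [] c' := by
  rw [matchSum, splitSum, splitSum_nil_left]
  · simp [detList]
  · intro p c hp
    cases p with
    | nil => exact absurd rfl hp
    | cons y p => simp [detList]

/-- An unmatched `x` stays in front as `A x`; a matched `x` gives the expansion of the determinant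
along its first row. -/
theorem matchSum_cons (g : α → β → K) (w : List α → List β → W) (A : α → W →ₗ[K] W)
    (hw : ∀ x L L', w (x :: L) L' = A x (w L L')) (x : α) (c : List α) (c' : List β) :
    matchSum g w (x :: c) c' =
      A x (matchSum g w c c') + (-1 : ℤ) ^ c.length • contr (g x) (matchSum g w c) c' := by
  rw [matchSum, splitSum, add_comm]
  congr 1
  · rw [matchSum, ← LinearMap.toAddMonoidHom_coe, map_splitSum]
    refine splitSum_congr c fun i ic _ => ?_
    rw [← splitSum_zsmul, map_splitSum]
    refine splitSum_congr c' fun j jc _ => ?_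
    simp only [LinearMap.toAddMonoidHom_coe, map_zsmul, map_smul, hw, List.length_cons, smul_smul,
      ← pow_add]
    congr 1
    rw [show i.length + ((c.length + 1) * i.length + i.length * (i.length + 1) / 2) =
      c.length * i.length + i.length * (i.length + 1) / 2 + 2 * i.length by ring, pow_add, pow_mul]
    simp
  · rw [← contr_zsmul]
    simp only [matchSum, ← splitSum_zsmul, contr_splitSum]
    refine splitSum_congr c fun i ic _ => ?_
    rw [← splitSum_contr_left]
    refine splitSum_congr c' fun j jc _ => ?_
    rw [List.length_cons, List.length_cons, neg_one_pow_triangle, detList, contr_zsmul,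
      contr_zsmul, contr_smul_right, mul_smul]

theorem splitSum_matchSum_cons (θ : β → β → K) (g : α → β → K) (w : List α → List β → W)
    (A : α → W →ₗ[K] W) (hw : ∀ x L L', w (x :: L) L' = A x (w L L')) (x : α) (c : List α)
    (Lb : List β) :
    splitSum (fun q c' => pf θ q • matchSum g w (x :: c) c') Lb =
      A x (splitSum (fun q c' => pf θ q • matchSum g w c c') Lb) + (-1 : ℤ) ^ c.length •
        contr (g x) (fun Lb' => splitSum (fun q c' => pf θ q • matchSum g w c c') Lb') Lb := by
  rw [← splitSum_contr_right, ← LinearMap.toAddMonoidHom_coe, map_splitSum, ← splitSum_zsmul,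
    ← splitSum_add]
  refine splitSum_congr Lb fun q c' _ => ?_
  rw [matchSum_cons g w A hw, contr_smul, ← smul_assoc ((-1 : ℤ) ^ q.length),
    neg_one_pow_smul_pf θ _ q le_rfl, smul_add, smul_comm (pf θ q)]
  simp

/-- The three terms are the three fates of the first letter: left alone, contracted with another
letter of `La`, or contracted with a letter of `Lb`. The last one must pass all of `La`. -/
theorem contractionSum_cons_left (χ : α → α → K) (θ : β → β → K) (g : α → β → K)
    (w : List α → List β → W) (A : α → W →ₗ[K] W)
    (hw : ∀ x L L', w (x :: L) L' = A x (w L L')) (x : α) (La : List α) (Lb : List β) :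
    contractionSum χ θ g w (x :: La) Lb =
      A x (contractionSum χ θ g w La Lb) + contr (χ x) (fun L => contractionSum χ θ g w L Lb) La +
        (-1 : ℤ) ^ La.length • contr (g x) (contractionSum χ θ g w La) Lb := by
  rw [contractionSum, splitSum, add_comm, add_right_comm]
  congr 1
  · rw [contractionSum, ← LinearMap.toAddMonoidHom_coe, map_splitSum, ← contr_zsmul]
    simp only [contractionSum, ← splitSum_zsmul, contr_splitSum]
    rw [← splitSum_add]
    refine splitSum_congr La fun p c hpc => ?_
    rw [splitSum_matchSum_cons θ g w A hw, ← smul_assoc, neg_one_pow_smul_pf χ _ p le_rfl,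
      contr_zsmul, contr_smul, smul_add, ← hpc, pow_add, mul_comm, mul_smul,
      ← smul_assoc ((-1 : ℤ) ^ p.length) (pf χ p), neg_one_pow_smul_pf χ _ p le_rfl,
      smul_comm (pf χ p)]
    simp
  -- Here `x` lies in the contracted block, as its first entry, and `pf_cons` chooses its partner.
  · simp only [contractionSum, pf_cons]
    rw [← splitSum_contr_left]
    exact splitSum_congr La fun p c _ => (contr_smul_right _ _ _ _).symm

theorem contractionSum_nil_nil (χ : α → α → K) (θ : β → β → K) (g : α → β → K)
    (w : List α → List β → W) : contractionSum χ θ g w [] [] = w [] [] := by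
  simp [contractionSum, splitSum, pf, matchSum_nil]

theorem contractionSum_nil_cons (χ : α → α → K) (θ : β → β → K) (g : α → β → K)
    (w : List α → List β → W) (ψ : β → W →ₗ[K] W)
    (hw : ∀ y L', w [] (y :: L') = ψ y (w [] L')) (y : β) (Lb : List β) :
    contractionSum χ θ g w [] (y :: Lb) =
      ψ y (contractionSum χ θ g w [] Lb) + contr (θ y) (contractionSum χ θ g w []) Lb := by
  have h : ∀ L, contractionSum χ θ g w [] L = splitSum (fun q c' => pf θ q • w [] c') L := by
    intro L
    simp [contractionSum, splitSum, pf, matchSum_nil]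
  rw [funext h, splitSum, add_comm]
  congr 1
  · rw [← LinearMap.toAddMonoidHom_coe, map_splitSum]
    refine splitSum_congr Lb fun q c' _ => ?_
    rw [← smul_assoc, neg_one_pow_smul_pf θ _ q le_rfl, hw]
    simp
  · rw [← splitSum_contr_left]
    refine splitSum_congr Lb fun p c _ => ?_
    rw [pf_cons, contr_smul_right]

/-- A normal-ordered product of operators, applied to the vectors `v`, where `h` are the
contractions of its positive parts with the entries of the vector. -/
def normalWord (A : α → W →ₗ[K] W) (h : α → β → K) (v : List β → W) : List α → List β → W
  | [], Lb => v Lb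
  | x :: La, Lb => A x (normalWord A h v La Lb) +
      (-1 : ℤ) ^ La.length • contr (h x) (normalWord A h v La) Lb

/-- On its way to the vector, `D x` meets negative parts, which it passes at the cost of `χ`, and
positive parts, which act as interior products and simply anticommute with it (`contr_contr`). -/
theorem apply_normalWord (A D : α → W →ₗ[K] W) (h d : α → β → K) (χ : α → α → K)
    (v : List β → W) (hDA : ∀ x z w, D x (A z w) = -A z (D x w) + χ x z • w)
    (hDv : ∀ x Lb, D x (v Lb) = contr (d x) v Lb) (x : α) (La : List α) (Lb : List β) :
    D x (normalWord A h v La Lb) = contr (χ x) (fun L => normalWord A h v L Lb) La +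
      (-1 : ℤ) ^ La.length • contr (d x) (normalWord A h v La) Lb := by
  induction La generalizing Lb with
  | nil =>
    change D x (v Lb) = _ + _ • contr (d x) v Lb
    simp [contr, hDv]
  | cons z La ih =>
    have e1 : contr (χ x) (fun L => normalWord A h v (z :: L) Lb) La =
        A z (contr (χ x) (fun L => normalWord A h v L Lb) La) - (-1 : ℤ) ^ La.length •
          contr (h z) (fun Lb' => contr (χ x) (fun L => normalWord A h v L Lb') La) Lb := by
      simp only [normalWord, contr_add]
      rw [← map_contr, contr_parity (χ x) (fun L => contr (h z) (normalWord A h v L) Lb),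
        contr_comm, sub_eq_add_neg]
    have e2 : contr (d x) (normalWord A h v (z :: La)) Lb =
        A z (contr (d x) (normalWord A h v La) Lb) - (-1 : ℤ) ^ La.length •
          contr (h z) (contr (d x) (normalWord A h v La)) Lb := by
      rw [show normalWord A h v (z :: La) = fun Lb => normalWord A h v (z :: La) Lb from rfl]
      simp only [normalWord, contr_add, contr_zsmul]
      rw [← map_contr, contr_contr (d x)]
      module
    rw [e2, contr, e1, normalWord, map_add, hDA, map_zsmul, map_contr, ih]
    simp only [ih, contr_add, contr_zsmul, map_add, map_zsmul, List.length_cons, pow_succ]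
    module

/-- Conjugating a normal-ordered product by an operator that shifts each factor `A x` by `D x`
and each factor `ψ y` by `Δ y` produces the sum over all partial contractions. -/
theorem contraction_formula (A D : α → W →ₗ[K] W) (ψ Δ : β → W →ₗ[K] W) (E : W →ₗ[K] W)
    (h d : α → β → K) (χ : α → α → K) (θ : β → β → K) (v : List β → W)
    (hDA : ∀ x z w, D x (A z w) = -A z (D x w) + χ x z • w)
    (hDv : ∀ x Lb, D x (v Lb) = contr (d x) v Lb)
    (hEA : ∀ x w, E (A x w) = A x (E w) + E (D x w))
    (hv : ∀ y Lb, v (y :: Lb) = ψ y (v Lb))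
    (hΔ : ∀ y Lb, Δ y (v Lb) = contr (θ y) v Lb)
    (hEψ : ∀ y w, E (ψ y w) = ψ y (E w) + E (Δ y w))
    (hE : E (v []) = v [])
    (w : List α → List β → W) (hw0 : ∀ L', w [] L' = v L')
    (hw : ∀ x L L', w (x :: L) L' = A x (w L L')) (La : List α) (Lb : List β) :
    E (normalWord A h v La Lb) = contractionSum χ θ (fun x y => h x y + d x y) w La Lb := by
  induction hn : La.length using Nat.strong_induction_on generalizing La Lb with
  | _ n ih =>
  subst hn
  cases La with
  | nil =>
    clear ih
    rw [normalWord]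
    induction hm : Lb.length using Nat.strong_induction_on generalizing Lb with
    | _ m ih =>
      subst hm
      cases Lb with
      | nil => rw [contractionSum_nil_nil, hw0, hE]
      | cons y Lb =>
        rw [contractionSum_nil_cons χ θ _ w ψ (by simp [hw0, hv]), hv, hEψ, hΔ, map_contr,
          ih _ (by simp) Lb rfl]
        congr 1
        exact contr_congr Lb fun L hL => ih _ (by simp; omega) L rfl
  | cons x La =>
    -- The contractions `h` (from the positive part of `x`) and `d` (from its shift) carry the same
    -- sign, so they merge into `h + d`, and the recursion becomes that of
    -- `contractionSum_cons_left`.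
    rw [normalWord, map_add, hEA, apply_normalWord A D h d χ v hDA hDv, ih _ (by simp) La Lb rfl,
      contractionSum_cons_left χ θ _ w A hw, contr_add_left, map_add, map_zsmul, map_zsmul,
      map_contr, map_contr, map_contr,
      contr_congr La fun L hL => ih _ (by simp; omega) L Lb rfl,
      funext fun L => ih _ (by simp) La L rfl]
    module

end ContractionFormula

end FermionicFock


namespace FermionicFock

/-! ### From unshuffles of lists to sums over increasing sequences -/

section OrderEmbeddings

variable {α β K W : Type*} [CommRing K] [AddCommGroup W] [Module K W]

theorem ofFn_orderEmb {k n : ℕ} (p : Fin k ↪o Fin n) :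
    List.ofFn p = (Finset.univ.map p.toEmbedding).sort := by
  have h : (Finset.univ.map p.toEmbedding).card = k := by simp
  rw [← Finset.listMap_orderEmbOfFin_finRange _ h, List.ofFn_eq_map,
    ← Finset.orderEmbOfFin_unique' h (f := p) (by simp)]

theorem ofFn_complSeq {k n : ℕ} (p : Fin k ↪o Fin n) :
    List.ofFn (complSeq p) = (Finset.univ.map p.toEmbedding)ᶜ.sort := by
  rw [← Finset.listMap_orderEmbOfFin_finRange _ (card_complement p), List.ofFn_eq_map]
  rfl

theorem range_complSeq {k n : ℕ} (p : Fin k ↪o Fin n) :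
    Finset.univ.map (complSeq p).toEmbedding = (Finset.univ.map p.toEmbedding)ᶜ :=
  Finset.map_orderEmbOfFin_univ _ _

theorem inversions_eq {k n : ℕ} (p : Fin k ↪o Fin n) :
    inversions p = ((Finset.univ.map p.toEmbedding ×ˢ (Finset.univ.map p.toEmbedding)ᶜ).filter
      fun q => q.2 < q.1).card := by
  have h : Finset.univ.map p.toEmbedding ×ˢ Finset.univ.map (complSeq p).toEmbedding =
      (Finset.univ ×ˢ Finset.univ).map (p.toEmbedding.prodMap (complSeq p).toEmbedding) := by
    ext ⟨u, v⟩
    simp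
  rw [← range_complSeq, h, Finset.filter_map, Finset.card_map]
  rfl

theorem sort_eq_filter_finRange {n : ℕ} (s : Finset (Fin n)) :
    s.sort = (List.finRange n).filter (· ∈ s) := by
  have h : ((List.finRange n).filter (· ∈ s)).toFinset = s := by ext; simp
  have h2 := (List.toFinset_sort (r := (· ≤ ·)) ((List.nodup_finRange n).filter (· ∈ s))).2
    (((List.pairwise_le_finRange n)).filter _)
  rwa [h] at h2

/-- The head `x` is the least entry. In the left block it creates no inversion; in the right block
it is inverted with every element of `s`, which accounts for the sign `(-1)^|p|` in `splitSum`. -/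
theorem splitSum_eq_sum_powerset {α : Type*} [LinearOrder α] (L : List α)
    (hL : L.Pairwise (· < ·)) (G : List α → List α → W) :
    splitSum G L = ∑ s ∈ L.toFinset.powerset,
      (-1 : ℤ) ^ ((s ×ˢ (L.toFinset \ s)).filter fun q => q.2 < q.1).card •
        G (L.filter (· ∈ s)) (L.filter (· ∉ s)) := by
  induction L generalizing G with
  | nil => simp [splitSum]
  | cons x L ih =>
    obtain ⟨hx, hL⟩ := List.pairwise_cons.mp hL
    have hxL : x ∉ L.toFinset := fun h => lt_irrefl x (hx x (by simpa using h))
    rw [splitSum, ih hL, ih hL, List.toFinset_cons, Finset.sum_powerset_insert hxL, add_comm]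
    congr 1
    · refine Finset.sum_congr rfl fun s hs => ?_
      have hs := Finset.mem_powerset.mp hs
      have hxs : x ∉ s := fun h => hxL (hs h)
      have hfs : (L.filter (· ∈ s)).toFinset = s := by
        ext y
        simpa using fun hy => List.mem_toFinset.mp (hs hy)
      have hlen : (L.filter (· ∈ s)).length = s.card := by
        rw [← List.toFinset_card_of_nodup ((hL.imp ne_of_lt).filter _), hfs]
      have hcard : ((s ×ˢ (insert x L.toFinset \ s)).filter fun q => q.2 < q.1).card =
          ((s ×ˢ (L.toFinset \ s)).filter fun q => q.2 < q.1).card + s.card := by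
        rw [Finset.insert_sdiff_of_notMem _ hxs, Finset.insert_eq, Finset.product_union,
          Finset.filter_union, Finset.card_union_of_disjoint, add_comm]
        · congr 1
          rw [Finset.filter_true_of_mem, Finset.card_product, Finset.card_singleton, mul_one]
          rintro ⟨u, v⟩ huv
          simp only [Finset.mem_product, Finset.mem_singleton] at huv
          rw [huv.2]
          exact hx u (List.mem_toFinset.mp (hs huv.1))
        · refine Finset.disjoint_filter_filter (Finset.disjoint_product.mpr (Or.inr ?_))
          simp [hxL]
      rw [hcard, hlen, smul_smul, ← pow_add]
      simp [hxs]
    · refine Finset.sum_congr rfl fun s hs => ?_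
      have hs := Finset.mem_powerset.mp hs
      have hxs : x ∉ s := fun h => hxL (hs h)
      have hcard : ((insert x s ×ˢ (insert x L.toFinset \ insert x s)).filter
          fun q => q.2 < q.1).card =
          ((s ×ˢ (L.toFinset \ s)).filter fun q => q.2 < q.1).card := by
        congr 1
        rw [show insert x L.toFinset \ insert x s = L.toFinset \ s by
          ext y; simp only [Finset.mem_sdiff, Finset.mem_insert]; grind,
          Finset.insert_eq, Finset.union_product, Finset.filter_union, Finset.union_eq_right]
        rintro ⟨u, v⟩ huv
        simp only [Finset.mem_filter, Finset.mem_product, Finset.mem_singleton,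
          Finset.mem_sdiff] at huv
        obtain ⟨⟨rfl, hv, _⟩, hlt⟩ := huv
        exact absurd hlt (hx v (List.mem_toFinset.mp hv)).le.not_gt
      have h1 : L.filter (· ∈ insert x s) = L.filter (· ∈ s) :=
        List.filter_congr fun y hy => by simp [(hx y hy).ne']
      have h2 : L.filter (· ∉ insert x s) = L.filter (· ∉ s) :=
        List.filter_congr fun y hy => by simp [(hx y hy).ne']
      rw [hcard, List.filter_cons_of_pos (by simp), List.filter_cons_of_neg (by simp), h1, h2]

theorem splitSum_map (f : β → α) (G : List α → List α → W) (L : List β) :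
    splitSum G (L.map f) = splitSum (fun p c => G (p.map f) (c.map f)) L := by
  induction L generalizing G with
  | nil => rfl
  | cons x L ih => simp [splitSum, ih]

theorem splitSum_ofFn {n : ℕ} (f : Fin n → α) (G : List α → List α → W) :
    splitSum G (List.ofFn f) = ∑ k ∈ Finset.range (n + 1), ∑ p : Fin k ↪o Fin n,
      (-1 : ℤ) ^ inversions p • G (List.ofFn (f ∘ p)) (List.ofFn (f ∘ complSeq p)) := by
  rw [List.ofFn_eq_map, splitSum_map, splitSum_eq_sum_powerset _ (List.pairwise_lt_finRange n),
    List.toFinset_finRange, Finset.sum_powerset, Finset.card_univ, Fintype.card_fin]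
  refine Finset.sum_congr rfl fun k _ => ?_
  symm
  refine Finset.sum_bij (fun p _ => Finset.univ.map p.toEmbedding) ?_ ?_ ?_ ?_
  · intro p _
    simp [Finset.mem_powersetCard]
  · intro p _ q _ h
    refine DFunLike.coe_injective (List.ofFn_injective ?_)
    rw [ofFn_orderEmb, ofFn_orderEmb, h]
  · intro s hs
    exact ⟨s.orderEmbOfFin (Finset.mem_powersetCard.mp hs).2, Finset.mem_univ _, by simp⟩
  · intro p _
    have h := sort_eq_filter_finRange (Finset.univ.map p.toEmbedding)ᶜ
    simp only [Finset.mem_compl] at h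
    rw [inversions_eq, ← Finset.compl_eq_univ_sdiff, ← sort_eq_filter_finRange, ← h,
      ← ofFn_orderEmb, ← ofFn_complSeq, List.map_ofFn, List.map_ofFn]

/-- Below `p α` lie `α` earlier terms of the sequence and the complementary elements inverted with
it. Summing over `α` gives the inversions plus a triangular number. -/
theorem seqSum_eq {k n : ℕ} (p : Fin k ↪o Fin n) :
    seqSum p = inversions p + k * (k + 1) / 2 := by
  have h : ∀ α : Fin k, (p α : ℕ) =
      (Finset.univ.filter fun β => complSeq p β < p α).card + (α : ℕ) := by
    intro α
    have h1 : (Finset.univ.filter fun β => complSeq p β < p α).card =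
        ((Finset.univ.map p.toEmbedding)ᶜ.filter (· < p α)).card := by
      rw [← range_complSeq, Finset.filter_map, Finset.card_map]
      rfl
    have h2 : (α : ℕ) = ((Finset.univ.map p.toEmbedding).filter (· < p α)).card := by
      rw [Finset.filter_map, Finset.card_map]
      simp [Finset.filter_gt_eq_Iio]
    have h3 : (p α : ℕ) = (Finset.univ.filter (· < p α)).card := by
      simp [Finset.filter_gt_eq_Iio]
    rw [h1]
    conv_rhs => rw [h2]
    rw [h3, ← Finset.card_union_of_disjoint, ← Finset.filter_union, Finset.union_comm,
      Finset.union_compl]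
    exact Finset.disjoint_filter_filter (disjoint_compl_left)
  have h4 : inversions p = ∑ α, (Finset.univ.filter fun β => complSeq p β < p α).card := by
    rw [inversions, Finset.card_filter, Fintype.sum_prod_type]
    exact Finset.sum_congr rfl fun α _ => (Finset.card_filter _ _).symm
  have h5 : ∑ α : Fin k, ((α : ℕ) + 1) = k * (k + 1) / 2 := by
    rw [Fin.sum_univ_eq_sum_range (fun i => i + 1), ← add_zero (∑ i ∈ _, _),
      ← Finset.sum_range_succ' (fun i => i),
      Finset.sum_range_id, mul_comm]
    rfl
  rw [seqSum, h4, ← h5, ← Finset.sum_add_distrib]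
  exact Finset.sum_congr rfl fun α _ => by rw [h α]; ring

/-- For sequences of length `2k` the triangular number `k(2k+1)` has the parity of `k`, hence the
extra `(-1)^k`. It later cancels the sign in `pf_eq_contractList`. -/
theorem splitSum_ofFn_of_even {n : ℕ} (f : Fin n → α) (G : List α → List α → W)
    (hG : ∀ p c, ¬ Even p.length → G p c = 0) :
    splitSum G (List.ofFn f) = ∑ k ∈ Finset.range (n / 2 + 1), ∑ p : Fin (2 * k) ↪o Fin n,
      (-1 : ℤ) ^ seqSum p •
        (-1 : ℤ) ^ k • G (List.ofFn (f ∘ p)) (List.ofFn (f ∘ complSeq p)) := by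
  have himg : (Finset.range (n / 2 + 1)).image (2 * ·) ⊆ Finset.range (n + 1) := by
    intro j
    simp only [Finset.mem_image, Finset.mem_range]
    rintro ⟨k, hk, rfl⟩
    omega
  rw [splitSum_ofFn, ← Finset.sum_subset himg, Finset.sum_image (by simp)]
  · refine Finset.sum_congr rfl fun k _ => Finset.sum_congr rfl fun p _ => ?_
    rw [seqSum_eq, smul_smul, ← pow_add, mul_assoc, Nat.mul_div_cancel_left _ (by norm_num)]
    congr 1
    rw [show inversions p + k * (2 * k + 1) + k = inversions p + 2 * (k * k + k) by ring,
      pow_add _ _ (2 * _), pow_mul]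
    simp
  · intro j hj hj'
    refine Finset.sum_eq_zero fun p _ => ?_
    rw [hG, smul_zero]
    rw [List.length_ofFn]
    rintro ⟨k, hk⟩
    simp only [Finset.mem_image, Finset.mem_range, not_exists, not_and] at hj hj'
    exact hj' k (by omega) (by omega)

/-- Both sequences have the same length `ρ`, so their two triangular signs cancel. -/
theorem splitSum_splitSum_ofFn {c c' : ℕ} (f : Fin c → α) (f' : Fin c' → β)
    (G : List α → List α → List β → List β → W)
    (hG : ∀ i ic j jc, i.length ≠ j.length → G i ic j jc = 0) :
    splitSum (fun i ic => splitSum (G i ic) (List.ofFn f')) (List.ofFn f) =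
      ∑ ρ ∈ Finset.range (min c c' + 1), ∑ i : Fin ρ ↪o Fin c, ∑ j : Fin ρ ↪o Fin c',
        (-1 : ℤ) ^ (seqSum i + seqSum j) • G (List.ofFn (f ∘ i)) (List.ofFn (f ∘ complSeq i))
          (List.ofFn (f' ∘ j)) (List.ofFn (f' ∘ complSeq j)) := by
  have hsub : Finset.range (min c c' + 1) ⊆ Finset.range (c + 1) :=
    Finset.range_subset_range.2 (by omega)
  rw [splitSum_ofFn, ← Finset.sum_subset hsub]
  · refine Finset.sum_congr rfl fun ρ hρ => Finset.sum_congr rfl fun i _ => ?_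
    rw [splitSum_ofFn, Finset.sum_eq_single ρ, Finset.smul_sum]
    · refine Finset.sum_congr rfl fun j _ => ?_
      rw [smul_smul, seqSum_eq, seqSum_eq, ← pow_add,
        show ∀ a b d : ℕ, a + d + (b + d) = a + b + 2 * d by intros; ring, pow_add _ _ (2 * _),
        pow_mul]
      simp
    · intro σ _ hσ
      refine Finset.sum_eq_zero fun j _ => ?_
      rw [hG _ _ _ _ (by simpa using hσ.symm), smul_zero]
    · intro h
      simp at h hρ
      omega
  · intro ρ hρ hρ'
    refine Finset.sum_eq_zero fun i _ => ?_
    rw [splitSum_ofFn, Finset.sum_eq_zero, smul_zero]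
    intro σ hσ
    refine Finset.sum_eq_zero fun j _ => ?_
    rw [hG, smul_zero]
    simp at hρ hρ' hσ ⊢
    omega

theorem contr_ofFn {n : ℕ} (χ : α → K) (F : List α → W) (f : Fin (n + 1) → α) :
    contr χ F (List.ofFn f) =
      ∑ k : Fin (n + 1), ((-1) ^ (k : ℕ) * χ (f k)) • F (List.ofFn (f ∘ k.succAbove)) := by
  induction n generalizing F with
  | zero => simp [contr, Function.comp_def]
  | succ n ih =>
    rw [List.ofFn_succ, contr, ih, Fin.sum_univ_succ (n := n + 1)]
    simp [Function.comp_def, List.ofFn_succ, pow_succ, Finset.sum_neg_distrib, sub_eq_add_neg]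

theorem detList_ofFn (g : α → β → K) {ρ : ℕ} (f : Fin ρ → α) (f' : Fin ρ → β) :
    detList g (List.ofFn f) (List.ofFn f') = Matrix.det (Matrix.of fun i j => g (f i) (f' j)) := by
  induction ρ with
  | zero => simp [detList]
  | succ ρ ih =>
    rw [List.ofFn_succ, detList, contr_ofFn, Matrix.det_succ_row_zero]
    refine Finset.sum_congr rfl fun k _ => ?_
    rw [ih, smul_eq_mul]
    rfl

theorem detList_eq_zero (g : α → β → K) (L : List α) (L' : List β) (h : L.length ≠ L'.length) :
    detList g L L' = 0 := by
  induction L generalizing L' with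
  | nil =>
    cases L' with
    | nil => simp at h
    | cons y L' => rfl
  | cons x L ih =>
    rw [detList, contr_congr (G := fun _ => (0 : K) • (0 : K)) L' fun l hl =>
      by rw [ih _ (by simp at h; omega), smul_zero], contr_smul, zero_smul]

theorem pf_eq_zero (χ : α → α → K) (n : ℕ) (L : List α) (hn : L.length ≤ n)
    (h : ¬ Even L.length) : pf χ L = 0 := by
  induction n generalizing L with
  | zero => simp [Nat.le_zero.mp hn] at h
  | succ n ih =>
    cases L with
    | nil => simp at h
    | cons x L =>
      rw [pf_cons, contr_congr (G := fun _ => (0 : K) • (0 : K)) L fun l hl => ?_, contr_smul,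
        zero_smul]
      rw [smul_zero, ih l (by simp at hn; omega)]
      simpa [← hl, Nat.even_add_one] using h

end OrderEmbeddings

end FermionicFock


noncomputable section
namespace FermionicFock

/-! ### Structure of the Fock space -/

section FockSpace

variable {𝔥 : Type*} [AddCommGroup 𝔥] [Module ℂ 𝔥] (B : LinearMap.BilinForm ℂ 𝔥)

/-- The mode `a(n + 1/2)` as a linear function of `a`. -/
def modeHom (n : ℤ) : 𝔥 →ₗ[ℂ] Module.End ℂ (Fock B) :=
  (Algebra.lsmul ℂ ℂ (Fock B)).toLinearMap ∘ₗ (toModeAlgebra B).toLinearMap ∘ₗ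
    TensorAlgebra.ι ℂ ∘ₗ LinearMap.inl ℂ (ℤ →₀ 𝔥) ℂ ∘ₗ Finsupp.lsingle n

theorem modeHom_apply (a : 𝔥) (n : ℤ) : modeHom B n a = mode B a n := rfl

theorem mode_apply (a : 𝔥) (n : ℤ) (v : Fock B) :
    mode B a n v = toModeAlgebra B (tensorMode a n) • v := rfl

theorem smul_vac (x : ModeAlgebra B) : x • vac B = Submodule.Quotient.mk (p := vacuumIdeal B) x := by
  have h := (Submodule.Quotient.mk_smul (vacuumIdeal B) (x := (1 : ModeAlgebra B)) x).symm
  rwa [smul_eq_mul, mul_one] at h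

theorem exists_smul_vac (v : Fock B) : ∃ x : ModeAlgebra B, v = x • vac B := by
  obtain ⟨x, rfl⟩ := Submodule.Quotient.mk_surjective (vacuumIdeal B) v
  exact ⟨x, (smul_vac B x).symm⟩

theorem toModeAlgebra_surjective : Function.Surjective (toModeAlgebra B) :=
  RingQuot.mkAlgHom_surjective ℂ (ModeRel B)

theorem mode_vac (a : 𝔥) (n : ℕ) : mode B a n (vac B) = 0 := by
  rw [mode_apply, smul_vac]
  exact (Submodule.Quotient.mk_eq_zero _).2 (Submodule.subset_span (Or.inl ⟨a, n, rfl⟩))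

theorem central_smul_vac : toModeAlgebra B (tensorCentral 𝔥) • vac B = vac B := by
  rw [smul_vac]
  exact (Submodule.Quotient.eq _).2 (Submodule.subset_span (Or.inr rfl))

theorem ι_eq_sum_tensorMode (f : Affinization 𝔥) :
    TensorAlgebra.ι ℂ f =
      f.1.sum (fun n a => tensorMode a n) + f.2 • tensorCentral 𝔥 := by
  have h : f = (f.1.sum fun n a => ((Finsupp.single n a, 0) : Affinization 𝔥)) + f.2 • (0, 1) := by
    refine Prod.ext ?_ ?_
    · simp only [Finsupp.sum, Prod.fst_add, Prod.fst_sum, Prod.smul_fst, smul_zero, add_zero]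
      exact (Finsupp.sum_single f.1).symm
    · simp [Finsupp.sum, Prod.snd_sum]
  conv_lhs => rw [h]
  simp only [Finsupp.sum, map_add, map_sum, map_smul]
  rfl

/-- The normalization of `𝐤` is imposed on the vacuum only. Centrality, checked on generators,
spreads it to all of `V` in `central_smul`. -/
theorem toModeAlgebra_central_comm (t : TensorAlgebra ℂ (Affinization 𝔥)) :
    toModeAlgebra B t * toModeAlgebra B (tensorCentral 𝔥) =
      toModeAlgebra B (tensorCentral 𝔥) * toModeAlgebra B t := by
  induction t using TensorAlgebra.induction with
  | algebraMap r => rw [AlgHom.commutes, Algebra.commutes]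
  | ι f =>
    have h : ∀ (a : 𝔥) (n : ℤ), toModeAlgebra B (tensorMode a n) *
        toModeAlgebra B (tensorCentral 𝔥) =
        toModeAlgebra B (tensorCentral 𝔥) * toModeAlgebra B (tensorMode a n) := fun a n => by
      rw [← map_mul, ← map_mul]
      exact RingQuot.mkAlgHom_rel ℂ (ModeRel.central a n)
    simp only [ι_eq_sum_tensorMode, Finsupp.sum, map_add, map_sum, map_smul, add_mul, mul_add,
      Finset.sum_mul, Finset.mul_sum, h, smul_mul_assoc, mul_smul_comm]
  | mul a b ha hb => rw [map_mul, mul_assoc, hb, ← mul_assoc, ha, mul_assoc]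
  | add a b ha hb => rw [map_add, add_mul, mul_add, ha, hb]

theorem central_smul (v : Fock B) : toModeAlgebra B (tensorCentral 𝔥) • v = v := by
  obtain ⟨x, rfl⟩ := exists_smul_vac B v
  obtain ⟨t, rfl⟩ := toModeAlgebra_surjective B x
  rw [← mul_smul, ← toModeAlgebra_central_comm, mul_smul, central_smul_vac]

theorem mode_mul_mode_neg (a b : 𝔥) (m n : ℕ) :
    mode B a m * mode B b (-n - 1) =
      -(mode B b (-n - 1) * mode B a m) + (if m = n then B a b else 0) • 1 := by
  rw [← sub_eq_iff_eq_add', sub_neg_eq_add]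
  ext v
  have h : toModeAlgebra B _ = toModeAlgebra B _ :=
    RingQuot.mkAlgHom_rel ℂ (ModeRel.anticomm (B := B) a b m n)
  have h' : toModeAlgebra B _ • v = toModeAlgebra B _ • v := congrArg (· • v) h
  rw [map_add, map_mul, map_mul, add_smul, mul_smul, mul_smul] at h'
  simp only [LinearMap.add_apply, Module.End.mul_apply, mode_apply, h', LinearMap.smul_apply,
    Module.End.one_apply]
  split_ifs
  · rw [map_smul, smul_assoc, central_smul]
  · simp

/-- The vector `b_1(-n_1 - 1/2) ⋯ b_s(-n_s - 1/2) 𝟏` of a list of pairs `(b_j, n_j)`. -/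
def modeVec : List (𝔥 × ℕ) → Fock B
  | [] => vac B
  | y :: L => mode B y.1 (-y.2 - 1) (modeVec L)

theorem fockVec_eq {s : ℕ} (b : Fin s → 𝔥) (n : Fin s → ℕ) :
    fockVec B b n = modeVec B (List.ofFn fun j => (b j, n j)) := by
  induction s with
  | zero => simp [fockVec, modeVec]
  | succ s ih =>
    rw [List.ofFn_succ, modeVec, ← ih]
    simp [fockVec, List.ofFn_succ]

theorem mode_modeVec (a : 𝔥) (m : ℕ) (L : List (𝔥 × ℕ)) :
    mode B a m (modeVec B L) =
      contr (fun y => if m = y.2 then B a y.1 else 0) (modeVec B) L := by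
  induction L with
  | nil => exact mode_vac B a m
  | cons y L ih =>
    have h := LinearMap.congr_fun (mode_mul_mode_neg B a y.1 m y.2) (modeVec B L)
    rw [contr, modeVec]
    simp only [modeVec, ← map_contr, ← ih]
    rw [Module.End.mul_apply] at h
    rw [h, LinearMap.add_apply, LinearMap.neg_apply, Module.End.mul_apply, LinearMap.smul_apply,
      Module.End.one_apply]
    abel

theorem mode_modeVec_mem (a : 𝔥) (n : ℤ) (L : List (𝔥 × ℕ)) :
    mode B a n (modeVec B L) ∈ Submodule.span ℂ (Set.range (modeVec B)) := by
  rcases le_or_gt 0 n with h | h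
  · obtain ⟨m, rfl⟩ := Int.eq_ofNat_of_zero_le h
    rw [mode_modeVec, contr_eq_sum]
    exact Submodule.sum_mem _ fun k _ =>
      Submodule.smul_mem _ _ (Submodule.subset_span ⟨_, rfl⟩)
  · obtain ⟨m, rfl⟩ : ∃ m : ℕ, n = -m - 1 := ⟨(-n - 1).toNat, by omega⟩
    exact Submodule.subset_span ⟨(a, m) :: L, rfl⟩

/-- The span contains the vacuum and is stable under all generators: negative modes lengthen a word,
positive modes contract it, and `𝐤` acts by one. -/
theorem span_modeVec : Submodule.span ℂ (Set.range (modeVec B)) = ⊤ := by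
  have hmode : ∀ (a : 𝔥) (n : ℤ), ∀ v ∈ Submodule.span ℂ (Set.range (modeVec B)),
      mode B a n v ∈ Submodule.span ℂ (Set.range (modeVec B)) := by
    intro a n v hv
    induction hv using Submodule.span_induction with
    | mem v hv => obtain ⟨L, rfl⟩ := hv; exact mode_modeVec_mem B a n L
    | zero => simp
    | add v w _ _ hv hw => rw [map_add]; exact add_mem hv hw
    | smul c v _ hv => rw [map_smul]; exact Submodule.smul_mem _ _ hv
  have h : ∀ t : TensorAlgebra ℂ (Affinization 𝔥),
      ∀ v ∈ Submodule.span ℂ (Set.range (modeVec B)),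
      toModeAlgebra B t • v ∈ Submodule.span ℂ (Set.range (modeVec B)) := by
    intro t
    induction t using TensorAlgebra.induction with
    | algebraMap r =>
      intro v hv
      rw [AlgHom.commutes, algebraMap_smul]
      exact Submodule.smul_mem _ _ hv
    | ι f =>
      intro v hv
      rw [ι_eq_sum_tensorMode, map_add, Finsupp.sum, map_sum, map_smul, add_smul, Finset.sum_smul,
        smul_assoc, central_smul]
      exact add_mem (Submodule.sum_mem _ fun n _ => hmode _ _ v hv) (Submodule.smul_mem _ _ hv)
    | mul a b ha hb => intro v hv; rw [map_mul, mul_smul]; exact ha _ (hb v hv)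
    | add a b ha hb => intro v hv; rw [map_add, add_smul]; exact add_mem (ha v hv) (hb v hv)
  rw [eq_top_iff]
  rintro v -
  obtain ⟨x, rfl⟩ := exists_smul_vac B v
  obtain ⟨t, rfl⟩ := toModeAlgebra_surjective B x
  exact h t _ (Submodule.subset_span ⟨[], rfl⟩)

theorem fock_induction {P : Fock B → Prop} (hL : ∀ L, P (modeVec B L)) (h0 : P 0)
    (hadd : ∀ v w, P v → P w → P (v + w)) (hsmul : ∀ (c : ℂ) v, P v → P (c • v)) (v : Fock B) :
    P v := by
  have hv : v ∈ Submodule.span ℂ (Set.range (modeVec B)) := span_modeVec B ▸ Submodule.mem_top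
  induction hv using Submodule.span_induction with
  | mem v hv => obtain ⟨L, rfl⟩ := hv; exact hL L
  | zero => exact h0
  | add v w _ _ hv hw => exact hadd _ _ hv hw
  | smul c v _ hv => exact hsmul _ _ hv

/-- `N` has no relation between positive modes. On spanning words they act as interior products, and
these anticommute. -/
theorem mode_mul_mode_pos (a b : 𝔥) (m n : ℕ) :
    mode B a m * mode B b n = -(mode B b n * mode B a m) := by
  ext v
  induction v using fock_induction B with
  | hL L =>
    simp only [Module.End.mul_apply, LinearMap.neg_apply, mode_modeVec, map_contr]
    exact contr_contr _ _ _ _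
  | h0 => simp
  | hadd v w hv hw => rw [map_add, map_add, hv, hw]
  | hsmul c v hv => rw [map_smul, map_smul, hv]

end FockSpace

/-! ### Conjugation by the exponential of the quadratic operator -/

section ExpDelta

variable {𝔥 : Type*} [AddCommGroup 𝔥] [Module ℂ 𝔥] (B : LinearMap.BilinForm ℂ 𝔥)

open PowerSeries

/-- The vectors on which almost all coefficients of a series of operators vanish. -/
def finiteVectors (Q : PowerSeries (Module.End ℂ (Fock B))) : Submodule ℂ (Fock B) where
  carrier := {v | ∃ N, ∀ k, N ≤ k → coeff k Q v = 0}
  zero_mem' := ⟨0, by simp⟩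
  add_mem' := by
    rintro v w ⟨N, hN⟩ ⟨N', hN'⟩
    exact ⟨max N N', fun k hk => by
      rw [map_add, hN k (le_trans (le_max_left _ _) hk), hN' k (le_trans (le_max_right _ _) hk),
        add_zero]⟩
  smul_mem' := by
    rintro c v ⟨N, hN⟩
    exact ⟨N, fun k hk => by rw [map_smul, hN k hk, smul_zero]⟩

/-- A series of operators of which almost all coefficients vanish on any given vector. -/
def LocallyFinite (Q : PowerSeries (Module.End ℂ (Fock B))) : Prop :=
  ∀ v, ∃ N, ∀ k, N ≤ k → coeff k Q v = 0

theorem LocallyFinite.of_modeVec {Q : PowerSeries (Module.End ℂ (Fock B))}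
    (h : ∀ L, modeVec B L ∈ finiteVectors B Q) : LocallyFinite B Q :=
  fock_induction B h (zero_mem (finiteVectors B Q)) (fun _ _ => (finiteVectors B Q).add_mem)
    fun c _ => (finiteVectors B Q).smul_mem c

theorem mem_finiteVectors_mul {Q S : PowerSeries (Module.End ℂ (Fock B))} {v : Fock B}
    (hS : v ∈ finiteVectors B S) (hQ : ∀ l, coeff l S v ∈ finiteVectors B Q) :
    v ∈ finiteVectors B (Q * S) := by
  obtain ⟨N, hN⟩ := hS
  choose f hf using hQ
  refine ⟨N + (Finset.range N).sup f, fun k hk => ?_⟩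
  rw [coeff_mul, LinearMap.sum_apply]
  refine Finset.sum_eq_zero fun p hp => ?_
  rw [Module.End.mul_apply]
  rcases le_or_gt N p.2 with h | h
  · rw [hN _ h, map_zero]
  · have := Finset.le_sup (f := f) (Finset.mem_range.2 h)
    have := Finset.HasAntidiagonal.mem_antidiagonal.1 hp
    exact hf _ _ (by omega)

theorem LocallyFinite.mul {Q S : PowerSeries (Module.End ℂ (Fock B))} (hQ : LocallyFinite B Q)
    (hS : LocallyFinite B S) : LocallyFinite B (Q * S) :=
  fun v => mem_finiteVectors_mul B (hS v) fun l => hQ (coeff l S v)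

theorem locallyFinite_C (f : Module.End ℂ (Fock B)) : LocallyFinite B (C f) :=
  fun v => ⟨1, fun k hk => by rw [coeff_C, if_neg (by omega), LinearMap.zero_apply]⟩

/-- The series `∑_j C_{jn} b(j + 1/2) y^{-j-n-1}`, the commutator of `Δ(y)` and `b(-n-1/2)`. -/
def deltaComm (b : 𝔥) (n : ℕ) : PowerSeries (Module.End ℂ (Fock B)) :=
  X ^ (n + 1) * mk fun j => cCoeff j n • mode B b j

theorem coeff_deltaComm (b : 𝔥) (n k : ℕ) : coeff k (deltaComm B b n) =
    if n + 1 ≤ k then cCoeff (k - (n + 1)) n • mode B b ((k - (n + 1) : ℕ) : ℤ) else 0 := by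
  rw [deltaComm, coeff_X_pow_mul', coeff_mk]

theorem exists_le_mode_modeVec (L : List (𝔥 × ℕ)) :
    ∃ N, ∀ (b : 𝔥) (j : ℕ), N ≤ j → mode B b j (modeVec B L) = 0 := by
  refine ⟨(L.map fun y => y.2 + 1).sum, fun b j hj => ?_⟩
  rw [mode_modeVec, contr_eq_sum]
  refine Finset.sum_eq_zero fun k _ => ?_
  have h := List.single_le_sum (l := L.map fun y => y.2 + 1) (fun _ _ => Nat.zero_le _)
    ((L.get k).2 + 1) (List.mem_map.2 ⟨_, List.get_mem L k, rfl⟩)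
  rw [if_neg (by omega), mul_zero, zero_smul]

theorem locallyFinite_deltaComm (b : 𝔥) (n : ℕ) : LocallyFinite B (deltaComm B b n) := by
  refine .of_modeVec B fun L => ?_
  obtain ⟨N, hN⟩ := exists_le_mode_modeVec B L
  refine ⟨N + n + 1, fun k hk => ?_⟩
  rw [coeff_deltaComm, if_pos (by omega), LinearMap.smul_apply, hN _ _ (by omega), smul_zero]

theorem cCoeff_symm (m n : ℕ) : cCoeff m n = -cCoeff n m := by
  rw [cCoeff, cCoeff, add_comm (m : ℂ) n]
  ring

/-- Moving `b(-n-1/2)` through `e_i(p+1/2) e'_i(q+1/2)` leaves a term with `q = n` and one with `p =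
n`. They are governed by the two isotropic components of `b`, which `hb` reassembles. -/
theorem deltaSeries_mul_C {M : ℕ} (e e' : Fin M → 𝔥) (b : 𝔥)
    (hb : b = ∑ i, (B (e' i) b • e i + B (e i) b • e' i)) (n : ℕ) :
    deltaSeries B e e' * C (mode B b (-n - 1)) =
      C (mode B b (-n - 1)) * deltaSeries B e e' + deltaComm B b n := by
  ext1 N
  rw [map_add, coeff_mul_C, coeff_C_mul, coeff_deltaComm]
  cases N with
  | zero => simp [deltaSeries]
  | succ N =>
    have h1 : ∀ (i : Fin M) (p q : ℕ), mode B (e i) p * mode B (e' i) q * mode B b (-n - 1) =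
        mode B b (-n - 1) * (mode B (e i) p * mode B (e' i) q) +
          ((if q = n then B (e' i) b else 0) • mode B (e i) p -
            (if p = n then B (e i) b else 0) • mode B (e' i) q) := by
      intro i p q
      rw [mul_assoc, mode_mul_mode_neg, mul_add, mul_neg, ← mul_assoc, mode_mul_mode_neg,
        add_mul, neg_mul, smul_mul_assoc, one_mul, mul_smul_comm, mul_one, mul_assoc]
      abel
    simp only [deltaSeries, coeff_succ_X_mul, coeff_mk, Finset.sum_mul, Finset.mul_sum,
      smul_mul_assoc, mul_smul_comm, h1, smul_add, Finset.sum_add_distrib]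
    congr 1
    set u := ∑ i, B (e' i) b • e i with hu
    set u' := ∑ i, B (e i) b • e' i with hu'
    have h2 : ∀ p : ℕ × ℕ, (∑ i, cCoeff p.1 p.2 • ((if p.2 = n then B (e' i) b else 0) •
        mode B (e i) p.1 - (if p.1 = n then B (e i) b else 0) • mode B (e' i) p.2)) =
        (if p.2 = n then cCoeff p.1 p.2 • mode B u p.1 else 0) -
          if p.1 = n then cCoeff p.1 p.2 • mode B u' p.2 else 0 := by
      intro p
      simp only [← modeHom_apply, hu, hu', map_sum, map_smul, smul_sub, Finset.sum_sub_distrib,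
        Finset.smul_sum]
      congr 1 <;> split_ifs <;> simp
    rw [Finset.sum_congr rfl fun p _ => h2 p, Finset.sum_sub_distrib]
    split_ifs with hn
    -- Skew-symmetry of `C_{mn}` turns the minus sign of the second term into a plus, so both
    -- components receive the same coefficient `C_{N-n,n}`.
    · rw [Finset.sum_eq_single (N - n, n), Finset.sum_eq_single (n, N - n), if_pos rfl, if_pos rfl,
        cCoeff_symm n, hb, Finset.sum_add_distrib, Nat.add_sub_add_right]
      · simp only [← modeHom_apply, map_add, neg_smul, smul_add, sub_neg_eq_add]
        rfl
      · rintro ⟨p, q⟩ hp hpq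
        have := Finset.HasAntidiagonal.mem_antidiagonal.1 hp
        simp only [ne_eq, Prod.mk.injEq] at hpq this ⊢
        exact if_neg (by omega)
      · intro h
        exact absurd (Finset.HasAntidiagonal.mem_antidiagonal.2 (by simp; omega)) h
      · rintro ⟨p, q⟩ hp hpq
        have := Finset.HasAntidiagonal.mem_antidiagonal.1 hp
        simp only [ne_eq, Prod.mk.injEq] at hpq this ⊢
        exact if_neg (by omega)
      · intro h
        exact absurd (Finset.HasAntidiagonal.mem_antidiagonal.2 (by simp; omega)) h
    · rw [Finset.sum_eq_zero, Finset.sum_eq_zero, sub_zero]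
      all_goals
        intro p hp
        have := Finset.HasAntidiagonal.mem_antidiagonal.1 hp
        exact if_neg (by omega)

theorem commute_coeff_deltaSeries {M : ℕ} (e e' : Fin M → 𝔥) (b : 𝔥) (j N : ℕ) :
    Commute (coeff N (deltaSeries B e e')) (mode B b j) := by
  cases N with
  | zero => simp [deltaSeries]
  | succ N =>
    rw [deltaSeries, coeff_succ_X_mul, coeff_mk]
    refine Commute.sum_left _ _ _ fun p _ => Commute.sum_left _ _ _ fun i _ =>
      Commute.smul_left ?_ _
    rw [commute_iff_eq, mul_assoc, mode_mul_mode_pos, mul_neg, ← mul_assoc, mode_mul_mode_pos,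
      neg_mul, neg_neg, mul_assoc]

/-- A positive mode passes a product of two positive modes with two sign changes. -/
theorem commute_deltaComm {M : ℕ} (e e' : Fin M → 𝔥) (b : 𝔥) (n : ℕ) :
    Commute (deltaSeries B e e') (deltaComm B b n) := by
  ext1 N
  rw [coeff_mul, coeff_mul, ← Finset.Nat.sum_antidiagonal_swap]
  refine Finset.sum_congr rfl fun p _ => ?_
  have h : Commute (coeff p.2 (deltaSeries B e e')) (coeff p.1 (deltaComm B b n)) := by
    rw [coeff_deltaComm]
    split_ifs
    · exact Commute.smul_right (commute_coeff_deltaSeries B e e' b _ _) (cCoeff _ n)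
    · exact Commute.zero_right _
  exact h

theorem coeff_deltaSeries_pow {M : ℕ} (e e' : Fin M → 𝔥) {N k : ℕ} (h : N < k) :
    coeff N (deltaSeries B e e' ^ k) = 0 := by
  rw [deltaSeries, (PowerSeries.commute_X _).symm.mul_pow, coeff_X_pow_mul', if_neg (by omega)]

/-- Allows one truncation of the exponential for all the coefficients in a product. -/
theorem coeff_expDelta {M : ℕ} (e e' : Fin M → 𝔥) {N K : ℕ} (h : N < K) :
    coeff N (expDelta B e e') = ∑ k ∈ Finset.range K,
      ((k.factorial : ℂ)⁻¹) • coeff N (deltaSeries B e e' ^ k) := by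
  rw [expDelta, coeff_mk]
  refine Finset.sum_subset (Finset.range_subset_range.2 h) fun k _ hk => ?_
  rw [coeff_deltaSeries_pow B e e' (by simpa using hk), smul_zero]

/-- The Leibniz rule for a commutator that itself commutes with `Δ`. -/
theorem deltaSeries_pow_mul_C {M : ℕ} (e e' : Fin M → 𝔥) (b : 𝔥)
    (hb : b = ∑ i, (B (e' i) b • e i + B (e i) b • e' i)) (n k : ℕ) :
    deltaSeries B e e' ^ (k + 1) * C (mode B b (-n - 1)) =
      C (mode B b (-n - 1)) * deltaSeries B e e' ^ (k + 1) +
        (k + 1 : ℂ) • (deltaSeries B e e' ^ k * deltaComm B b n) := by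
  induction k with
  | zero => simpa using deltaSeries_mul_C B e e' b hb n
  | succ k ih =>
    have hD := ((commute_deltaComm B e e' b n).pow_left (k + 1)).eq
    rw [pow_succ' _ (k + 1), mul_assoc, ih, mul_add, ← mul_assoc, deltaSeries_mul_C B e e' b hb,
      add_mul, ← hD, mul_smul_comm, ← mul_assoc (deltaSeries B e e') (_ ^ k), ← pow_succ',
      mul_assoc (C _), ← pow_succ', add_assoc, Nat.cast_succ]
    module

theorem expDelta_mul_C {M : ℕ} (e e' : Fin M → 𝔥) (b : 𝔥)
    (hb : b = ∑ i, (B (e' i) b • e i + B (e i) b • e' i)) (n : ℕ) :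
    expDelta B e e' * C (mode B b (-n - 1)) =
      C (mode B b (-n - 1)) * expDelta B e e' + expDelta B e e' * deltaComm B b n := by
  ext1 N
  have h : coeff N (expDelta B e e' * deltaComm B b n) = ∑ k ∈ Finset.range (N + 1),
      ((k.factorial : ℂ)⁻¹) • coeff N (deltaSeries B e e' ^ k * deltaComm B b n) := by
    simp only [coeff_mul, Finset.smul_sum]
    rw [Finset.sum_comm]
    refine Finset.sum_congr rfl fun p hp => ?_
    have := Finset.HasAntidiagonal.mem_antidiagonal.1 hp
    rw [coeff_expDelta B e e' (show p.1 < N + 1 by omega), Finset.sum_mul]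
    simp only [smul_mul_assoc]
  -- The power `Δ^{k+1}/(k+1)!` on the left corresponds to `Δ^k/k!` on the right, so the left range
  -- is taken one longer and its term `k = 0` is split off.
  rw [map_add, coeff_mul_C, coeff_C_mul, h, coeff_expDelta B e e' (show N < N + 1 + 1 by omega),
    Finset.sum_range_succ', add_mul, mul_add, Finset.sum_mul, Finset.mul_sum, add_right_comm,
    ← Finset.sum_add_distrib]
  congr 1
  · refine Finset.sum_congr rfl fun k _ => ?_
    have hs : coeff N ((k + 1 : ℂ) • (deltaSeries B e e' ^ k * deltaComm B b n)) =
      (k + 1 : ℂ) • coeff N (deltaSeries B e e' ^ k * deltaComm B b n) := rfl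
    rw [smul_mul_assoc, ← coeff_mul_C, deltaSeries_pow_mul_C B e e' b hb, map_add, coeff_C_mul,
      mul_smul_comm, smul_add, hs, smul_smul, Nat.factorial_succ]
    congr 2
    have := Nat.cast_add_one_ne_zero (R := ℂ) k
    push_cast
    field_simp
  · rw [pow_zero, coeff_one]
    split_ifs <;> simp

theorem coeff_expDelta_vac {M : ℕ} (e e' : Fin M → 𝔥) (k : ℕ) :
    coeff k (expDelta B e e') (vac B) = if k = 0 then vac B else 0 := by
  have hΔ : ∀ N, coeff N (deltaSeries B e e') (vac B) = 0 := by
    intro N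
    cases N with
    | zero => simp [deltaSeries]
    | succ N => simp [deltaSeries, coeff_succ_X_mul, LinearMap.sum_apply, mode_vac]
  rw [coeff_expDelta B e e' (Nat.lt_succ_self k), LinearMap.sum_apply, Finset.sum_eq_single 0]
  · rw [pow_zero, coeff_one]
    split_ifs <;> simp
  · intro j _ hj
    obtain ⟨j, rfl⟩ := Nat.exists_eq_succ_of_ne_zero hj
    rw [LinearMap.smul_apply, pow_succ, coeff_mul, LinearMap.sum_apply, Finset.sum_eq_zero,
      smul_zero]
    intro p _
    rw [Module.End.mul_apply, hΔ, map_zero]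
  · simp

/-- By induction on the length of a word: the commutation rule replaces a word by a shorter one with
a creation operator in front, or by contractions that are shorter still. -/
theorem locallyFinite_expDelta {M : ℕ} (e e' : Fin M → 𝔥)
    (hb : ∀ b, b = ∑ i, (B (e' i) b • e i + B (e i) b • e' i)) :
    LocallyFinite B (expDelta B e e') := by
  refine .of_modeVec B fun L => ?_
  induction hn : L.length using Nat.strong_induction_on generalizing L with
  | _ n ih =>
  subst hn
  cases L with
  | nil =>
    exact ⟨1, fun k hk => by rw [modeVec, coeff_expDelta_vac, if_neg (by omega)]⟩
  | cons y L =>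
    have h1 : modeVec B L ∈ finiteVectors B (expDelta B e e' * deltaComm B y.1 y.2) := by
      refine mem_finiteVectors_mul B (locallyFinite_deltaComm B _ _ _) fun l => ?_
      rw [coeff_deltaComm]
      split_ifs
      · rw [LinearMap.smul_apply, mode_modeVec, contr_eq_sum]
        refine Submodule.smul_mem _ _ (Submodule.sum_mem _ fun k _ => Submodule.smul_mem _ _ ?_)
        exact ih _ (Nat.lt_succ_of_le (List.length_eraseIdx_le L k)) _ rfl
      · exact zero_mem _
    obtain ⟨N, hN⟩ := h1
    obtain ⟨N', hN'⟩ := ih _ (Nat.lt_succ_self _) L rfl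
    refine ⟨max N N', fun k hk => ?_⟩
    have h := congrArg (fun Q : PowerSeries (Module.End ℂ (Fock B)) => coeff k Q (modeVec B L))
      (expDelta_mul_C B e e' y.1 (hb y.1) y.2)
    simp only [coeff_mul_C, map_add, coeff_C_mul, Module.End.mul_apply, LinearMap.add_apply] at h
    rw [modeVec, h, hN' k (le_trans (le_max_right _ _) hk), map_zero, zero_add]
    exact hN k (le_trans (le_max_left _ _) hk)

end ExpDelta

end FermionicFock
end


noncomputable section
namespace FermionicFock

theorem finsum_eq_finsum_comp {ι κ A : Type*} [AddCommMonoid A] {f : ι → A} {g : κ → ι}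
    (hg : Function.Injective g) (hf : ∀ i, i ∉ Set.range g → f i = 0) :
    ∑ᶠ i, f i = ∑ᶠ k, f (g k) := by
  rw [← finsum_mem_range hg]
  refine finsum_congr fun i => ?_
  by_cases h : i ∈ Set.range g
  · simp [h]
  · simp [h, hf i h]

theorem ofPowerSeries_coeff_of_neg {R : Type*} [Semiring R] (P : PowerSeries R) {N : ℤ}
    (hN : N < 0) : (HahnSeries.ofPowerSeries ℤ R P).coeff N = 0 := by
  rw [HahnSeries.ofPowerSeries_apply]
  refine HahnSeries.embDomain_of_notMem_range ?_
  rintro ⟨k, hk⟩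
  simp at hk
  omega

/-! ### Laurent series with vector coefficients -/

section LaurentModule

variable (R X : Type*) [CommRing R] [AddCommGroup X] [Module R X]

/-- The module `X((x))` over the ring `End(X)((x))`. -/
def LaurentModule : Type _ := HahnModule ℤ (Module.End R X) X

instance : AddCommGroup (LaurentModule R X) :=
  inferInstanceAs (AddCommGroup (HahnModule ℤ (Module.End R X) X))

instance : Module (HahnSeries ℤ (Module.End R X)) (LaurentModule R X) :=
  inferInstanceAs (Module (HahnSeries ℤ (Module.End R X)) (HahnModule ℤ (Module.End R X) X))

/-- The inclusion of `R((x))` into `End(X)((x))`. -/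
def scalarHom : HahnSeries ℤ R →+* HahnSeries ℤ (Module.End R X) where
  toFun f := f.map (algebraMap R (Module.End R X))
  map_one' := by
    ext1
    funext N
    by_cases h : N = 0 <;> simp [HahnSeries.coeff_one, h]
  map_mul' f g := by
    ext1
    funext N
    exact congrArg (fun h : HahnSeries ℤ (Module.End R X) => h.coeff N)
      (HahnSeries.map_mul (algebraMap R (Module.End R X) : R →ₙ+* Module.End R X))
  map_zero' := by
    ext1
    funext N
    simp
  map_add' f g := by
    ext1
    funext N
    simp

instance : Module (HahnSeries ℤ R) (LaurentModule R X) :=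
  Module.compHom _ (scalarHom R X)

variable {R X}

theorem scalar_smul (f : HahnSeries ℤ R) (w : LaurentModule R X) : f • w = scalarHom R X f • w :=
  rfl

/-- Scalar series are central among operator series, so operator series act linearly over `R((x))`,
as the contraction formula requires. -/
theorem scalarHom_comm (f : HahnSeries ℤ R) (A : HahnSeries ℤ (Module.End R X)) :
    A * scalarHom R X f = scalarHom R X f * A := by
  ext1
  funext N
  rw [HahnSeries.coeff_mul, HahnSeries.coeff_mul]
  refine Finset.sum_nbij' Prod.swap Prod.swap ?_ ?_ ?_ ?_ ?_
  · intro p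
    simp only [Finset.mem_antidiagonal, Prod.fst_swap, Prod.snd_swap]
    rintro ⟨h1, h2, h3⟩
    exact ⟨h2, h1, by rw [add_comm, h3]⟩
  · intro p
    simp only [Finset.mem_antidiagonal, Prod.fst_swap, Prod.snd_swap]
    rintro ⟨h1, h2, h3⟩
    exact ⟨h2, h1, by rw [add_comm, h3]⟩
  · simp
  · simp
  · intro p _
    exact (Algebra.commutes (f.coeff p.2) (A.coeff p.1)).symm

theorem scalarHom_ofPowerSeries (c : ℕ → R) :
    scalarHom R X (HahnSeries.ofPowerSeries ℤ R (PowerSeries.mk c)) =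
      HahnSeries.ofPowerSeries ℤ _ (PowerSeries.mk fun k => algebraMap R (Module.End R X) (c k)) := by
  ext1
  funext N
  change algebraMap R (Module.End R X) (HahnSeries.coeff _ N) = _
  rcases lt_or_ge N 0 with h | h
  · rw [ofPowerSeries_coeff_of_neg _ h, ofPowerSeries_coeff_of_neg _ h, map_zero]
  · obtain ⟨k, rfl⟩ := Int.eq_ofNat_of_zero_le h
    have h1 := HahnSeries.ofPowerSeries_apply_coeff (Γ := ℤ) (PowerSeries.mk c) k
    have h2 := HahnSeries.ofPowerSeries_apply_coeff (Γ := ℤ)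
      (PowerSeries.mk fun k => algebraMap R (Module.End R X) (c k)) k
    rw [PowerSeries.coeff_mk] at h1 h2
    exact (congrArg _ h1).trans h2.symm

/-- A power series of operators as an operator on `X((x))`. -/
def seriesOp (P : PowerSeries (Module.End R X)) :
    LaurentModule R X →ₗ[HahnSeries ℤ R] LaurentModule R X where
  toFun w := HahnSeries.ofPowerSeries ℤ _ P • w
  map_add' := smul_add _
  map_smul' f w := by
    rw [RingHom.id_apply, scalar_smul, scalar_smul, ← mul_smul, ← mul_smul, scalarHom_comm]

theorem seriesOp_mul (P Q : PowerSeries (Module.End R X)) (w : LaurentModule R X) :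
    seriesOp (P * Q) w = seriesOp P (seriesOp Q w) := by
  change HahnSeries.ofPowerSeries ℤ _ (P * Q) • w = _
  rw [map_mul, mul_smul]
  rfl

theorem seriesOp_add (P Q : PowerSeries (Module.End R X)) (w : LaurentModule R X) :
    seriesOp (P + Q) w = seriesOp P w + seriesOp Q w := by
  change HahnSeries.ofPowerSeries ℤ _ (P + Q) • w = _
  rw [map_add, add_smul]
  rfl

theorem seriesOp_neg (P : PowerSeries (Module.End R X)) (w : LaurentModule R X) :
    seriesOp (-P) w = -seriesOp P w := by
  change HahnSeries.ofPowerSeries ℤ _ (-P) • w = _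
  rw [map_neg, neg_smul]
  rfl

theorem seriesOp_one (w : LaurentModule R X) : seriesOp (1 : PowerSeries (Module.End R X)) w = w := by
  change HahnSeries.ofPowerSeries ℤ (Module.End R X) 1 • w = _
  rw [map_one, one_smul]

theorem seriesOp_scalar (c : ℕ → R) (w : LaurentModule R X) :
    seriesOp (PowerSeries.mk fun k => algebraMap R (Module.End R X) (c k)) w =
      HahnSeries.ofPowerSeries ℤ R (PowerSeries.mk c) • w := by
  rw [scalar_smul, scalarHom_ofPowerSeries]
  rfl

/-- The coefficient of `x^N`. -/
def laurentCoeff (N : ℤ) : LaurentModule R X →+ X where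
  toFun w := ((HahnModule.of (Module.End R X)).symm w).coeff N
  map_zero' := rfl
  map_add' _ _ := rfl

theorem laurentModule_ext {w w' : LaurentModule R X}
    (h : ∀ N, laurentCoeff N w = laurentCoeff N w') : w = w' :=
  HahnModule.ext _ _ (funext h)

/-- A constant series. -/
def laurentConst (u : X) : LaurentModule R X := HahnModule.of _ (HahnSeries.single 0 u)

theorem laurentCoeff_const (u : X) (N : ℤ) :
    laurentCoeff N (laurentConst u : LaurentModule R X) = if N = 0 then u else 0 := by
  change (HahnSeries.single 0 u).coeff N = _
  rw [HahnSeries.coeff_single]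
  congr

theorem hasFiniteSupport_laurentCoeff_smul (A : HahnSeries ℤ (Module.End R X))
    (w : LaurentModule R X) (N : ℤ) :
    (Function.support fun i => A.coeff i (laurentCoeff (N - i) w)).Finite := by
  refine Set.Finite.subset (Set.Finite.image Prod.fst (Set.VAddAntidiagonal.finite_of_isPWO
    A.isPWO_support ((HahnModule.of (Module.End R X)).symm w).isPWO_support N)) ?_
  intro i hi
  refine ⟨(i, N - i), ⟨fun h => hi ?_, fun h => hi ?_, by simp⟩, rfl⟩
  · simp only at h
    simp [h]
  · change A.coeff i (((HahnModule.of (Module.End R X)).symm w).coeff (N - i)) = 0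
    rw [h, map_zero]

theorem laurentCoeff_smul (A : HahnSeries ℤ (Module.End R X)) (w : LaurentModule R X) (N : ℤ) :
    laurentCoeff N (A • w) = ∑ᶠ i, A.coeff i (laurentCoeff (N - i) w) := by
  symm
  refine (finsum_eq_sum_of_support_subset _ (s := (Finset.VAddAntidiagonal N
    (Set.VAddAntidiagonal.finite_of_isPWO A.isPWO_support
      ((HahnModule.of (Module.End R X)).symm w).isPWO_support N)).image Prod.fst) ?_).trans
    ((Finset.sum_image ?_).trans ((Finset.sum_congr rfl ?_).trans
      (HahnModule.coeff_smul A w N).symm))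
  · intro i hi
    simp only [Finset.coe_image, Set.mem_image, Finset.mem_coe, Finset.mem_vaddAntidiagonal]
    refine ⟨(i, N - i), ⟨fun h => hi ?_, fun h => hi ?_, by simp⟩, rfl⟩
    · simp only at h
      simp [h]
    · change A.coeff i (((HahnModule.of (Module.End R X)).symm w).coeff (N - i)) = 0
      rw [h, map_zero]
  · rintro ⟨p, q⟩ h ⟨p', q'⟩ h' rfl
    simp only [Finset.mem_coe, Finset.mem_vaddAntidiagonal, vadd_eq_add] at h h'
    rw [Prod.mk.injEq]
    omega
  · rintro ⟨p, q⟩ h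
    simp only [Finset.mem_vaddAntidiagonal, vadd_eq_add] at h
    obtain rfl : q = N - p := by omega
    rfl

theorem laurentCoeff_seriesOp (P : PowerSeries (Module.End R X)) (w : LaurentModule R X) (N : ℤ) :
    laurentCoeff N (seriesOp P w) =
      ∑ᶠ k : ℕ, PowerSeries.coeff k P (laurentCoeff (N - k) w) := by
  refine (laurentCoeff_smul _ w N).trans
    ((finsum_eq_finsum_comp (g := fun k : ℕ => (k : ℤ)) Nat.cast_injective ?_).trans ?_)
  · intro i hi
    rw [ofPowerSeries_coeff_of_neg, LinearMap.zero_apply]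
    by_contra h
    exact hi ⟨i.toNat, by simp; omega⟩
  · exact finsum_congr fun k => by rw [HahnSeries.ofPowerSeries_apply_coeff]

theorem laurentCoeff_seriesOp_C (E : Module.End R X) (w : LaurentModule R X) (N : ℤ) :
    laurentCoeff N (seriesOp (PowerSeries.C E) w) = E (laurentCoeff N w) := by
  rw [laurentCoeff_seriesOp, finsum_eq_single _ 0]
  · simp
  · intro k hk
    simp [PowerSeries.coeff_C, hk]

theorem laurentCoeff_seriesOp_const (P : PowerSeries (Module.End R X)) (u : X) (N : ℤ) :
    laurentCoeff N (seriesOp P (laurentConst u)) =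
      if 0 ≤ N then PowerSeries.coeff N.toNat P u else 0 := by
  rw [laurentCoeff_seriesOp]
  split_ifs with h
  · rw [finsum_eq_single _ N.toNat]
    · rw [laurentCoeff_const, if_pos (by omega)]
    · intro k hk
      rw [laurentCoeff_const, if_neg (by omega), map_zero]
  · refine finsum_eq_zero_of_forall_eq_zero fun k => ?_
    rw [laurentCoeff_const, if_neg (by omega), map_zero]

theorem laurentCoeff_single_smul (d : ℤ) (c : R) (w : LaurentModule R X) (N : ℤ) :
    laurentCoeff N ((HahnSeries.single d c : HahnSeries ℤ R) • w) = c • laurentCoeff (N - d) w := by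
  rw [scalar_smul, laurentCoeff_smul, finsum_eq_single _ d]
  · simp [scalarHom]
  · intro k hk
    simp [scalarHom, HahnSeries.coeff_single_of_ne hk]

theorem seriesOp_C_const (f : Module.End R X) (u : X) :
    seriesOp (PowerSeries.C f) (laurentConst u) = laurentConst (f u) := by
  refine laurentModule_ext fun N => ?_
  rw [laurentCoeff_seriesOp_C, laurentCoeff_const, laurentCoeff_const]
  split_ifs <;> simp

end LaurentModule

end FermionicFock
end


noncomputable section
namespace FermionicFock

open PowerSeries TensorProduct

/-! ### Evaluation of locally finite operator series -/

section ExtendedFock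

variable {𝔥 : Type*} [AddCommGroup 𝔥] [Module ℂ 𝔥] (B : LinearMap.BilinForm ℂ 𝔥)
  {R : Type*} [CommRing R] [Algebra ℂ R] (η : R)

variable {B} in
theorem finite_support_tmul {Q : PowerSeries (Module.End ℂ (Fock B))} (hQ : LocallyFinite B Q)
    (v : Fock B) :
    (Function.support fun k => ((η ^ k) ⊗ₜ[ℂ] coeff k Q v : R ⊗[ℂ] Fock B)).Finite := by
  obtain ⟨N, hN⟩ := hQ v
  refine (Set.finite_lt_nat N).subset fun k hk => ?_
  by_contra h
  exact hk (by simp [hN k (not_lt.mp h)])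

variable {B} in
/-- The map `v ↦ ∑_k η^k ⊗ Q_k v` for a locally finite series `Q`. -/
def evalFun {Q : PowerSeries (Module.End ℂ (Fock B))} (hQ : LocallyFinite B Q) :
    Fock B →ₗ[ℂ] R ⊗[ℂ] Fock B where
  toFun v := ∑ᶠ k : ℕ, (η ^ k) ⊗ₜ[ℂ] coeff k Q v
  map_add' v w := by
    rw [← finsum_add_distrib (finite_support_tmul η hQ v) (finite_support_tmul η hQ w)]
    simp only [map_add, tmul_add]
  map_smul' c v := by
    rw [RingHom.id_apply, smul_finsum' c (finite_support_tmul η hQ v)]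
    simp only [map_smul, tmul_smul]

variable {B} in
/-- The operator `∑_k η^k Q_k` on the extended Fock space for a locally finite series. -/
def evalOp {Q : PowerSeries (Module.End ℂ (Fock B))} (hQ : LocallyFinite B Q) :
    Module.End R (R ⊗[ℂ] Fock B) :=
  LinearMap.liftBaseChange R (evalFun η hQ)

variable {B} in
theorem evalOp_tmul_eq_finsum {Q : PowerSeries (Module.End ℂ (Fock B))} (hQ : LocallyFinite B Q)
    (v : Fock B) : evalOp η hQ (1 ⊗ₜ v) = ∑ᶠ k : ℕ, (η ^ k) ⊗ₜ[ℂ] coeff k Q v := by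
  rw [evalOp, LinearMap.liftBaseChange_tmul, one_smul]
  rfl

variable {B} in
theorem evalOp_tmul {Q : PowerSeries (Module.End ℂ (Fock B))} (hQ : LocallyFinite B Q) (v : Fock B)
    {N : ℕ} (hN : ∀ k, N ≤ k → coeff k Q v = 0) :
    evalOp η hQ (1 ⊗ₜ v) = ∑ k ∈ Finset.range N, (η ^ k) ⊗ₜ[ℂ] coeff k Q v := by
  rw [evalOp_tmul_eq_finsum]
  refine finsum_eq_sum_of_support_subset _ fun k hk => ?_
  by_contra h
  exact hk (by simp [hN k (by simpa using h)])

theorem extFock_end_ext {f g : Module.End R (R ⊗[ℂ] Fock B)}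
    (h : ∀ v : Fock B, f (1 ⊗ₜ v) = g (1 ⊗ₜ v)) : f = g := by
  refine TensorProduct.AlgebraTensorModule.ext fun r v => ?_
  have h' : (r ⊗ₜ[ℂ] v : R ⊗[ℂ] Fock B) = r • (1 ⊗ₜ v) := by simp [smul_tmul']
  rw [h', map_smul, map_smul, h]

/-- Evaluation is multiplicative because, on a fixed vector, both factors may be truncated and the
Cauchy product becomes a finite rearrangement. -/
theorem evalOp_mul {Q S T : PowerSeries (Module.End ℂ (Fock B))} (hQ : LocallyFinite B Q)
    (hS : LocallyFinite B S) (hT : LocallyFinite B T) (h : T = Q * S) :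
    evalOp η hT = evalOp η hQ * evalOp η hS := by
  subst h
  refine extFock_end_ext B fun v => ?_
  obtain ⟨N, hN⟩ := hS v
  choose f hf using fun l => hQ (coeff l S v)
  set M := (Finset.range N).sup f with hM
  -- One bound works for all `l`: only the `l < N` give a nonzero vector.
  have hfM : ∀ l, ∀ k, M ≤ k → coeff k Q (coeff l S v) = 0 := by
    intro l k hk
    rcases le_or_gt N l with h | h
    · rw [hN l h, map_zero]
    · exact hf l k (le_trans (Finset.le_sup (f := f) (Finset.mem_range.2 h)) hk)
  have hT' : ∀ k, M + N ≤ k → coeff k (Q * S) v = 0 := by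
    intro k hk
    rw [coeff_mul, LinearMap.sum_apply]
    refine Finset.sum_eq_zero fun p hp => ?_
    have := Finset.HasAntidiagonal.mem_antidiagonal.1 hp
    rw [Module.End.mul_apply]
    rcases le_or_gt N p.2 with h | h
    · rw [hN _ h, map_zero]
    · exact hfM _ _ (by omega)
  have h1 : ∀ u : Fock B, ∀ k, ((η ^ k) ⊗ₜ[ℂ] u : R ⊗[ℂ] Fock B) = η ^ k • (1 ⊗ₜ u) := by
    intro u k
    simp [smul_tmul']
  rw [Module.End.mul_apply, evalOp_tmul η hS v hN, map_sum, evalOp_tmul η hT v hT']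
  simp only [h1 _ _, map_smul]
  simp only [evalOp_tmul η hQ _ (hfM _), h1 _ _, Finset.smul_sum, smul_smul, ← pow_add]
  rw [← Finset.sum_product', ← Finset.sum_fiberwise_of_maps_to (t := Finset.range (M + N))
    (g := fun p : ℕ × ℕ => p.1 + p.2)]
  · refine Finset.sum_congr rfl fun k _ => ?_
    rw [coeff_mul, LinearMap.sum_apply, tmul_sum, Finset.smul_sum]
    rw [← Finset.Nat.sum_antidiagonal_swap]
    symm
    refine Finset.sum_subset_zero_on_sdiff ?_ ?_ ?_
    · intro p hp
      simp only [Finset.mem_filter] at hp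
      exact Finset.HasAntidiagonal.mem_antidiagonal.2 hp.2
    · intro p hp
      simp only [Finset.mem_sdiff, Finset.mem_filter, Finset.mem_product, Finset.mem_range] at hp
      have := Finset.HasAntidiagonal.mem_antidiagonal.1 hp.1
      rw [Module.End.mul_apply, Prod.fst_swap, Prod.snd_swap]
      rcases le_or_gt N p.1 with h | h
      · rw [hN _ h, map_zero, tmul_zero, smul_zero]
      · rw [hfM _ _ (by omega), tmul_zero, smul_zero]
    · intro p hp
      rw [(Finset.mem_filter.1 hp).2]
      rfl
  · intro p hp
    simp only [Finset.mem_product, Finset.mem_range] at hp ⊢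
    omega

theorem evalOp_add {Q S T : PowerSeries (Module.End ℂ (Fock B))} (hQ : LocallyFinite B Q)
    (hS : LocallyFinite B S) (hT : LocallyFinite B T) (h : T = Q + S) :
    evalOp η hT = evalOp η hQ + evalOp η hS := by
  subst h
  refine extFock_end_ext B fun v => ?_
  obtain ⟨N, hN⟩ := hQ v
  obtain ⟨N', hN'⟩ := hS v
  have hQ' : ∀ k, max N N' ≤ k → coeff k Q v = 0 := fun k hk => hN k (le_of_max_le_left hk)
  have hS' : ∀ k, max N N' ≤ k → coeff k S v = 0 := fun k hk => hN' k (le_of_max_le_right hk)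
  rw [LinearMap.add_apply, evalOp_tmul η hQ v hQ', evalOp_tmul η hS v hS', evalOp_tmul η hT v
    fun k hk => by rw [map_add, LinearMap.add_apply, hQ' k hk, hS' k hk, add_zero],
    ← Finset.sum_add_distrib]
  simp only [map_add, LinearMap.add_apply, tmul_add]

theorem evalOp_neg {Q S : PowerSeries (Module.End ℂ (Fock B))} (hQ : LocallyFinite B Q)
    (hS : LocallyFinite B S) (h : S = -Q) : evalOp η hS = -evalOp η hQ := by
  subst h
  refine extFock_end_ext B fun v => ?_
  obtain ⟨N, hN⟩ := hQ v
  rw [LinearMap.neg_apply, evalOp_tmul η hQ v hN, evalOp_tmul η hS v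
    fun k hk => by rw [map_neg, LinearMap.neg_apply, hN k hk, neg_zero]]
  simp only [map_neg, LinearMap.neg_apply, tmul_neg, Finset.sum_neg_distrib]

theorem locallyFinite_monomial (d : ℕ) (f : Module.End ℂ (Fock B)) :
    LocallyFinite B (monomial d f) :=
  fun v => ⟨d + 1, fun k hk => by rw [coeff_monomial, if_neg (by omega), LinearMap.zero_apply]⟩

theorem evalOp_monomial (d : ℕ) (f : Module.End ℂ (Fock B)) :
    evalOp η (locallyFinite_monomial B d f) = η ^ d • f.baseChange R := by
  refine extFock_end_ext B fun v => ?_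
  rw [evalOp_tmul_eq_finsum, finsum_eq_single _ d]
  · simp [smul_tmul']
  · intro k hk
    rw [coeff_monomial, if_neg hk]
    simp

theorem evalOp_C (f : Module.End ℂ (Fock B)) :
    evalOp η (locallyFinite_C B f) = f.baseChange R := by
  refine extFock_end_ext B fun v => ?_
  rw [evalOp_tmul_eq_finsum, finsum_eq_single _ 0]
  · simp
  · intro k hk
    rw [coeff_C, if_neg hk]
    simp

/-! ### The operators of the contraction formula -/

/-- The creation operator `b(-n-1/2)` on the extended Fock space. -/
def creation (b : 𝔥) (n : ℕ) : Module.End R (R ⊗[ℂ] Fock B) :=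
  (mode B b (-n - 1)).baseChange R

/-- The operator `∑_j C_{jn} η^{j+n+1} b(j + 1/2)` on the extended Fock space. -/
def shiftOp (b : 𝔥) (n : ℕ) : Module.End R (R ⊗[ℂ] Fock B) :=
  evalOp η (locallyFinite_deltaComm B b n)

/-- The contraction of `b(-n-1/2)` and `b'(-n'-1/2)` in `exp Δ`. -/
def pairing (η : R) (y y' : 𝔥 × ℕ) : R :=
  algebraMap ℂ R (B y.1 y'.1 * cCoeff y'.2 y.2) * η ^ (y'.2 + y.2 + 1)

/-- Of all modes `b(j+1/2)` only `j = n'` contracts with `b'(-n'-1/2)`, so the constant term sits in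
the single degree `n' + n + 1`. -/
theorem deltaComm_mul_C (b b' : 𝔥) (n n' : ℕ) :
    deltaComm B b n * C (mode B b' (-n' - 1)) = -(C (mode B b' (-n' - 1)) * deltaComm B b n) +
      monomial (n' + n + 1) ((B b b' * cCoeff n' n) • (1 : Module.End ℂ (Fock B))) := by
  ext1 k
  rw [map_add, map_neg, coeff_mul_C, coeff_C_mul, coeff_deltaComm, coeff_monomial]
  by_cases h : n + 1 ≤ k
  · obtain ⟨j, rfl⟩ := Nat.exists_eq_add_of_le h
    rw [if_pos h, Nat.add_sub_cancel_left, smul_mul_assoc, mode_mul_mode_neg, smul_add,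
      mul_smul_comm, smul_neg]
    congr 1
    by_cases hj : j = n'
    · subst hj
      rw [if_pos rfl, if_pos (by ring), smul_smul, mul_comm]
    · rw [if_neg hj, if_neg (by omega), zero_smul, smul_zero]
  · rw [if_neg h, if_neg (by omega)]
    simp

theorem shiftOp_mul_creation (y y' : 𝔥 × ℕ) :
    shiftOp B η y.1 y.2 * creation B y'.1 y'.2 =
      -(creation B y'.1 y'.2 * shiftOp B η y.1 y.2) +
        algebraMap R (Module.End R (R ⊗[ℂ] Fock B)) (pairing B η y y') := by
  have hD := locallyFinite_deltaComm B y.1 y.2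
  have hC := locallyFinite_C B (mode B y'.1 (-y'.2 - 1))
  have hneg : LocallyFinite B (-(C (mode B y'.1 (-y'.2 - 1)) * deltaComm B y.1 y.2)) := fun v => by
    obtain ⟨N, hN⟩ := hC.mul B hD v
    exact ⟨N, fun k hk => by rw [map_neg, LinearMap.neg_apply, hN k hk, neg_zero]⟩
  have h := evalOp_add B η hneg (locallyFinite_monomial B _ _) (hD.mul B hC)
    (deltaComm_mul_C B y.1 y'.1 y.2 y'.2)
  rw [evalOp_mul B η hD hC _ rfl, evalOp_neg B η (hC.mul B hD) hneg rfl,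
    evalOp_mul B η hC hD _ rfl, evalOp_monomial, evalOp_C] at h
  refine h.trans ?_
  congr 1
  refine extFock_end_ext B fun v => ?_
  rw [pairing, Module.algebraMap_end_apply, LinearMap.smul_apply, LinearMap.baseChange_tmul,
    LinearMap.smul_apply, Module.End.one_apply, tmul_smul, smul_tmul', smul_tmul', smul_tmul',
    ← Algebra.smul_def, smul_eq_mul, smul_eq_mul, mul_smul_comm, smul_mul_assoc]

variable {M : ℕ} (e e' : Fin M → 𝔥)
  (hb : ∀ b, b = ∑ i, (B (e' i) b • e i + B (e i) b • e' i))

/-- The operator `exp Δ` on the extended Fock space. -/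
def expOp : Module.End R (R ⊗[ℂ] Fock B) := evalOp η (locallyFinite_expDelta B e e' hb)

theorem expOp_mul_creation (y : 𝔥 × ℕ) :
    expOp B η e e' hb * creation B y.1 y.2 =
      creation B y.1 y.2 * expOp B η e e' hb + expOp B η e e' hb * shiftOp B η y.1 y.2 := by
  have hD := locallyFinite_deltaComm B y.1 y.2
  have hC := locallyFinite_C B (mode B y.1 (-y.2 - 1))
  have hE := locallyFinite_expDelta B e e' hb
  have h := evalOp_add B η (hC.mul B hE) (hE.mul B hD) (hE.mul B hC)
    (expDelta_mul_C B e e' y.1 (hb y.1) y.2)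
  rwa [evalOp_mul B η hE hC _ rfl, evalOp_mul B η hC hE _ rfl, evalOp_mul B η hE hD _ rfl,
    evalOp_C] at h

theorem expOp_vac : expOp B η e e' hb (1 ⊗ₜ vac B) = 1 ⊗ₜ vac B := by
  rw [expOp, evalOp_tmul_eq_finsum, finsum_eq_single _ 0]
  · rw [coeff_expDelta_vac, if_pos rfl, pow_zero]
  · intro k hk
    rw [coeff_expDelta_vac, if_neg hk, tmul_zero]

theorem shiftOp_vac (b : 𝔥) (n : ℕ) : shiftOp B η b n (1 ⊗ₜ vac B) = 0 := by
  rw [shiftOp, evalOp_tmul η _ _ (N := 0)]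
  · simp
  · intro k _
    rw [coeff_deltaComm]
    split_ifs
    · rw [LinearMap.smul_apply, mode_vac, smul_zero]
    · rfl

end ExtendedFock

end FermionicFock
end


noncomputable section
namespace FermionicFock

open PowerSeries

/-! ### The contraction formula for fields -/

section FieldOperators

variable {A R X : Type*} [CommRing R] [AddCommGroup X] [Module R X]

/-- The series `∑_k (k + m choose m) f(a, k + m) x^k` of a family `f` of operators. -/
def fieldSeries (f : A × ℕ → Module.End R X) (x : A × ℕ) : PowerSeries (Module.End R X) :=
  mk fun k => ((k + x.2).choose x.2 : R) • f (x.1, k + x.2)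

theorem coeff_fieldSeries (f : A × ℕ → Module.End R X) (x : A × ℕ) (k : ℕ) :
    coeff k (fieldSeries f x) = ((k + x.2).choose x.2 : R) • f (x.1, k + x.2) :=
  coeff_mk _ _

/-- The contraction of two fields. -/
def fieldPairing (θ : A × ℕ → A × ℕ → R) (x z : A × ℕ) : HahnSeries ℤ R :=
  HahnSeries.ofPowerSeries ℤ R (mk fun k => ∑ p ∈ Finset.HasAntidiagonal.antidiagonal k,
    ((p.1 + x.2).choose x.2 : R) * ((p.2 + z.2).choose z.2 : R) *
      θ (x.1, p.1 + x.2) (z.1, p.2 + z.2))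

/-- The contraction of a field and a mode. -/
def mixedPairing (θ : A × ℕ → A × ℕ → R) (x y : A × ℕ) : HahnSeries ℤ R :=
  HahnSeries.ofPowerSeries ℤ R (mk fun k => ((k + x.2).choose x.2 : R) * θ (x.1, k + x.2) y)

variable {cr sh : A × ℕ → Module.End R X} {θ : A × ℕ → A × ℕ → R}

theorem fieldSeries_mul_fieldSeries
    (h : ∀ y y', sh y * cr y' = -(cr y' * sh y) + algebraMap R (Module.End R X) (θ y y'))
    (x z : A × ℕ) :
    fieldSeries sh x * fieldSeries cr z = -(fieldSeries cr z * fieldSeries sh x) +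
      mk fun k => algebraMap R (Module.End R X)
        (∑ p ∈ Finset.HasAntidiagonal.antidiagonal k,
          ((p.1 + x.2).choose x.2 : R) * ((p.2 + z.2).choose z.2 : R) *
            θ (x.1, p.1 + x.2) (z.1, p.2 + z.2)) := by
  ext1 k
  rw [map_add, map_neg, coeff_mul, coeff_mul, coeff_mk,
    ← Finset.Nat.sum_antidiagonal_swap (n := k)
      (f := fun p => coeff p.1 (fieldSeries cr z) * coeff p.2 (fieldSeries sh x)),
    map_sum, ← Finset.sum_neg_distrib, ← Finset.sum_add_distrib]
  refine Finset.sum_congr rfl fun p _ => ?_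
  simp only [coeff_fieldSeries, Prod.fst_swap, Prod.snd_swap, smul_mul_smul_comm, h, smul_add,
    smul_neg]
  rw [mul_comm ((p.2 + z.2).choose z.2 : R), map_mul, ← Algebra.smul_def]

theorem fieldSeries_mul_C
    (h : ∀ y y', sh y * cr y' = -(cr y' * sh y) + algebraMap R (Module.End R X) (θ y y'))
    (x y : A × ℕ) :
    fieldSeries sh x * C (cr y) = -(C (cr y) * fieldSeries sh x) +
      mk fun k => algebraMap R (Module.End R X)
        (((k + x.2).choose x.2 : R) * θ (x.1, k + x.2) y) := by
  ext1 k
  rw [map_add, map_neg, coeff_mul_C, coeff_C_mul, coeff_mk, coeff_fieldSeries, smul_mul_assoc,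
    h, mul_smul_comm, smul_add, smul_neg, map_mul, ← Algebra.smul_def]

/-- The vector obtained from `ω` by a list of operators, as a constant series. -/
def constVec (cr : A × ℕ → Module.End R X) (ω : X) : List (A × ℕ) → LaurentModule R X
  | [] => laurentConst ω
  | y :: L => seriesOp (C (cr y)) (constVec cr ω L)

theorem apply_eq_contr {K W β : Type*} [CommRing K] [AddCommGroup W] [Module K W]
    (T : W →ₗ[K] W) (ψ : β → W →ₗ[K] W) (v : List β → W) (c : β → K)
    (hv : ∀ y L, v (y :: L) = ψ y (v L)) (h : ∀ y w, T (ψ y w) = -ψ y (T w) + c y • w)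
    (h0 : T (v []) = 0) (L : List β) : T (v L) = contr c v L := by
  induction L with
  | nil => exact h0
  | cons y L ih =>
    rw [contr, funext fun L' => hv y L', ← map_contr, ← ih, hv, h]
    abel

theorem seriesOp_C_algebraMap (c : R) (w : LaurentModule R X) :
    seriesOp (C (algebraMap R (Module.End R X) c)) w = (HahnSeries.C c : HahnSeries ℤ R) • w := by
  refine laurentModule_ext fun N => ?_
  rw [laurentCoeff_seriesOp_C]
  exact ((laurentCoeff_single_smul 0 c w N).trans (by rw [sub_zero]; rfl)).symm

/-- The product of the series of a list of fields as an operator. -/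
def fieldProd (cr : A × ℕ → Module.End R X) (L : List (A × ℕ)) :
    LaurentModule R X →ₗ[HahnSeries ℤ R] LaurentModule R X :=
  seriesOp (L.map (fieldSeries cr)).prod

theorem fieldProd_nil (w : LaurentModule R X) : fieldProd cr [] w = w := by
  rw [fieldProd, List.map_nil, List.prod_nil, seriesOp_one]

theorem fieldProd_cons (x : A × ℕ) (L : List (A × ℕ)) (w : LaurentModule R X) :
    fieldProd cr (x :: L) w = seriesOp (fieldSeries cr x) (fieldProd cr L w) := by
  rw [fieldProd, List.map_cons, List.prod_cons, seriesOp_mul]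
  rfl

theorem laurentConst_zero : (laurentConst 0 : LaurentModule R X) = 0 :=
  laurentModule_ext fun N => by rw [laurentCoeff_const, ite_self, map_zero]

/-- A field is a linear combination of the `cr` in each degree in `x`, so its shift is the field
with the same coefficients built from `sh`. The contractions of fields follow from `θ` by
bilinearity. -/
theorem field_contraction_formula (E : Module.End R X) (ω : X)
    (h : ∀ y y', sh y * cr y' = -(cr y' * sh y) + algebraMap R (Module.End R X) (θ y y'))
    (hE : ∀ y, E * cr y = cr y * E + E * sh y) (hω : E ω = ω) (hsh : ∀ y, sh y ω = 0)
    (vp : A × ℕ → A × ℕ → HahnSeries ℤ R) (La Lb : List (A × ℕ)) :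
    seriesOp (C E) (normalWord (fun x => seriesOp (fieldSeries cr x)) vp (constVec cr ω) La Lb) =
      contractionSum (fieldPairing θ) (fun y y' => HahnSeries.C (θ y y'))
        (fun x y => vp x y + mixedPairing θ x y)
        (fun L L' => fieldProd cr L (constVec cr ω L')) La Lb := by
  have hsh0 : ∀ x, seriesOp (fieldSeries sh x) (laurentConst ω) = 0 := fun x =>
    laurentModule_ext fun N => by
      rw [laurentCoeff_seriesOp_const, coeff_fieldSeries, LinearMap.smul_apply, hsh, smul_zero,
        ite_self, map_zero]
  refine contraction_formula _ (fun x => seriesOp (fieldSeries sh x))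
    (fun y => seriesOp (C (cr y))) (fun y => seriesOp (C (sh y)))
    _ _ _ _ _ _ ?_ (fun x => ?_) ?_ (fun _ _ => rfl) (fun y => ?_) ?_ ?_ _
    (fun L => fieldProd_nil _) (fun x L L' => fieldProd_cons x L _) La Lb
  · intro x z w
    rw [← seriesOp_mul, fieldSeries_mul_fieldSeries h, seriesOp_add, seriesOp_neg, seriesOp_mul,
      seriesOp_scalar]
    rfl
  · refine apply_eq_contr _ (fun y => seriesOp (C (cr y))) _ _ (fun _ _ => rfl) ?_ (hsh0 x)
    intro y w
    rw [← seriesOp_mul, fieldSeries_mul_C h, seriesOp_add, seriesOp_neg, seriesOp_mul,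
      seriesOp_scalar]
    rfl
  · intro x w
    have hx : C E * fieldSeries cr x = fieldSeries cr x * C E + C E * fieldSeries sh x := by
      ext1 k
      rw [map_add, coeff_C_mul, coeff_mul_C, coeff_C_mul, coeff_fieldSeries, coeff_fieldSeries,
        mul_smul_comm, hE, smul_mul_assoc, mul_smul_comm, smul_add]
    rw [← seriesOp_mul, hx, seriesOp_add, seriesOp_mul, seriesOp_mul]
  · refine apply_eq_contr _ (fun y => seriesOp (C (cr y))) _ _ (fun _ _ => rfl) ?_ ?_
    · intro y' w
      rw [← seriesOp_mul, ← map_mul, h, map_add, map_neg, seriesOp_add, seriesOp_neg, map_mul,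
        seriesOp_mul, seriesOp_C_algebraMap]
    · rw [constVec, seriesOp_C_const, hsh, laurentConst_zero]
  · intro y w
    rw [← seriesOp_mul, ← seriesOp_mul, ← seriesOp_mul, ← seriesOp_add, ← map_mul, ← map_mul,
      ← map_mul, ← map_add, hE]
  · rw [constVec, seriesOp_C_const, hω]

end FieldOperators

end FermionicFock
end


noncomputable section
namespace FermionicFock

open PowerSeries TensorProduct

/-! ### Normal-ordered products as recursive words -/

section NormalOrdering

variable {𝔥 : Type*} [AddCommGroup 𝔥] [Module ℂ 𝔥] (B : LinearMap.BilinForm ℂ 𝔥)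

/-- `a_1^{(m_1)}(x)⁻ ⋯ a_r^{(m_r)}(x)⁻` for a list of pairs `(a_i, m_i)`. -/
def negProdList (L : List (𝔥 × ℕ)) : PowerSeries (Module.End ℂ (Fock B)) :=
  (L.map fun x => negSeries B x.1 x.2).prod

/-- `a_1^{(m_1)}(x)⁺ ⋯ a_r^{(m_r)}(x)⁺` for a list of pairs `(a_i, m_i)`. -/
def posProdList (L : List (𝔥 × ℕ)) : PowerSeries (Module.End ℂ (Fock B)) :=
  (L.map fun x => posSeries B x.1 x.2).prod

theorem negProd_eq {r : ℕ} (a : Fin r → 𝔥) (m : Fin r → ℕ) :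
    negProd B a m = negProdList B (List.ofFn fun i => (a i, m i)) := by
  rw [negProd, negProdList, List.map_ofFn]
  rfl

theorem posProd_eq {r : ℕ} (a : Fin r → 𝔥) (m : Fin r → ℕ) :
    posProd B a m = posProdList B (List.ofFn fun i => (a i, m i)) := by
  rw [posProd, posProdList, List.map_ofFn]
  rfl

theorem coeff_posSeries (a : 𝔥) (m k : ℕ) : coeff k (posSeries B a m) =
    if m + 1 ≤ k then Ring.choose (-((k - (m + 1) : ℕ) : ℂ) - 1) m •
      mode B a ((k - (m + 1) : ℕ) : ℤ) else 0 := by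
  rw [posSeries, coeff_X_pow_mul', coeff_mk]

theorem coeff_posSeries_modeVec (a : 𝔥) (m k : ℕ) (L : List (𝔥 × ℕ)) :
    coeff k (posSeries B a m) (modeVec B L) = contr (fun y => if y.2 + m + 1 = k then
      Ring.choose (-(y.2 : ℂ) - 1) m * B a y.1 else 0) (modeVec B) L := by
  rw [coeff_posSeries, contr_eq_sum]
  split_ifs with h
  · obtain ⟨j, rfl⟩ := Nat.exists_eq_add_of_le h
    rw [Nat.add_sub_cancel_left, LinearMap.smul_apply, mode_modeVec, contr_eq_sum, Finset.smul_sum]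
    refine Finset.sum_congr rfl fun i _ => ?_
    rw [smul_smul]
    congr 1
    by_cases hj : j = (L.get i).2
    · rw [if_pos hj, if_pos (by omega), ← hj]
      ring
    · rw [if_neg hj, if_neg (by omega)]
      ring
  · symm
    refine Finset.sum_eq_zero fun i _ => ?_
    rw [if_neg (by omega), mul_zero, zero_smul]

theorem coeff_mul_posSeries_modeVec (Q : PowerSeries (Module.End ℂ (Fock B))) (x : 𝔥 × ℕ) (K : ℕ)
    (L : List (𝔥 × ℕ)) :
    coeff K (Q * posSeries B x.1 x.2) (modeVec B L) = ∑ k : Fin L.length,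
      if (L.get k).2 + x.2 + 1 ≤ K then
        ((-1) ^ (k : ℕ) * (Ring.choose (-((L.get k).2 : ℂ) - 1) x.2 * B x.1 (L.get k).1)) •
          coeff (K - ((L.get k).2 + x.2 + 1)) Q (modeVec B (L.eraseIdx k)) else 0 := by
  rw [coeff_mul, LinearMap.sum_apply]
  simp only [Module.End.mul_apply, coeff_posSeries_modeVec, contr_eq_sum, map_sum, map_smul]
  rw [Finset.sum_comm]
  refine Finset.sum_congr rfl fun k _ => ?_
  split_ifs with h
  · rw [Finset.sum_eq_single (K - ((L.get k).2 + x.2 + 1), (L.get k).2 + x.2 + 1), if_pos rfl]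
    · intro p hp hne
      have := Finset.HasAntidiagonal.mem_antidiagonal.1 hp
      rw [if_neg, mul_zero, zero_smul]
      intro h'
      exact hne (Prod.ext (by simp only; omega) h'.symm)
    · intro h'
      exact absurd (Finset.HasAntidiagonal.mem_antidiagonal.2 (Nat.sub_add_cancel h)) h'
  · refine Finset.sum_eq_zero fun p hp => ?_
    have := Finset.HasAntidiagonal.mem_antidiagonal.1 hp
    rw [if_neg (by omega), mul_zero, zero_smul]

theorem locallyFinite_posSeries (a : 𝔥) (m : ℕ) : LocallyFinite B (posSeries B a m) := by
  refine .of_modeVec B fun L => ?_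
  obtain ⟨N, hN⟩ := exists_le_mode_modeVec B L
  refine ⟨N + m + 1, fun k hk => ?_⟩
  rw [coeff_posSeries, if_pos (by omega), LinearMap.smul_apply, hN _ _ (by omega), smul_zero]

theorem locallyFinite_posProdList (L : List (𝔥 × ℕ)) : LocallyFinite B (posProdList B L) := by
  induction L with
  | nil =>
    rw [posProdList, List.map_nil, List.prod_nil, ← map_one C]
    exact locallyFinite_C B 1
  | cons x L ih =>
    rw [posProdList, List.map_cons, List.prod_cons]
    exact (locallyFinite_posSeries B x.1 x.2).mul B ih

theorem posSeries_mul_posSeries (a b : 𝔥) (m n : ℕ) :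
    posSeries B a m * posSeries B b n = -(posSeries B b n * posSeries B a m) := by
  ext1 k
  rw [map_neg, coeff_mul, coeff_mul, ← Finset.Nat.sum_antidiagonal_swap, ← Finset.sum_neg_distrib]
  refine Finset.sum_congr rfl fun p _ => ?_
  rw [Prod.fst_swap, Prod.snd_swap, coeff_posSeries, coeff_posSeries]
  split_ifs
  · rw [smul_mul_smul_comm, smul_mul_smul_comm, mode_mul_mode_pos, smul_neg,
      mul_comm (Ring.choose _ m)]
  all_goals simp

/-- The recursion for normal-ordered words lets the first positive part act on the vector first.
This is the sign for moving it there. -/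
theorem posSeries_mul_posProdList (x : 𝔥 × ℕ) (c : List (𝔥 × ℕ)) :
    posSeries B x.1 x.2 * posProdList B c =
      (-1 : ℤ) ^ c.length • (posProdList B c * posSeries B x.1 x.2) := by
  induction c with
  | nil => simp [posProdList]
  | cons z c ih =>
    have h : posProdList B (z :: c) = posSeries B z.1 z.2 * posProdList B c := by
      rw [posProdList, List.map_cons, List.prod_cons, posProdList]
    rw [h, ← mul_assoc, posSeries_mul_posSeries, neg_mul, mul_assoc, ih, mul_smul_comm,
      List.length_cons, pow_succ, mul_neg_one, neg_smul, mul_assoc]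

variable (R : Type*) [CommRing R] [Algebra ℂ R]

/-- The contraction of the positive part of a field and a mode. -/
def vacuumPairing (x y : 𝔥 × ℕ) : HahnSeries ℤ R :=
  HahnSeries.single (-(y.2 : ℤ) - 1 - x.2)
    (algebraMap ℂ R (Ring.choose (-(y.2 : ℂ) - 1) x.2 * B x.1 y.1))

/-- The extension of operators on the Fock space to the extended Fock space. -/
def extHom : Module.End ℂ (Fock B) →+* Module.End R (R ⊗[ℂ] Fock B) :=
  (Module.End.baseChangeHom ℂ R (Fock B)).toRingHom

theorem extHom_tmul (f : Module.End ℂ (Fock B)) (v : Fock B) :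
    extHom B R f (1 ⊗ₜ v) = 1 ⊗ₜ f v := rfl

/-- The creation operator of a pair `(a, n)`. -/
def creationOp (y : 𝔥 × ℕ) : Module.End R (R ⊗[ℂ] Fock B) := creation B y.1 y.2

theorem constVec_creationOp (L : List (𝔥 × ℕ)) :
    constVec (creationOp B R) (1 ⊗ₜ vac B) L = laurentConst (1 ⊗ₜ modeVec B L) := by
  induction L with
  | nil => rfl
  | cons y L ih =>
    rw [constVec, ih, seriesOp_C_const]
    rfl

theorem fieldSeries_creationOp (x : 𝔥 × ℕ) :
    fieldSeries (creationOp B R) x = PowerSeries.map (extHom B R) (negSeries B x.1 x.2) := by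
  ext1 k
  refine extFock_end_ext B fun v => ?_
  rw [coeff_fieldSeries, coeff_map, negSeries, coeff_mk, extHom_tmul, LinearMap.smul_apply,
    LinearMap.smul_apply, tmul_smul, Nat.cast_smul_eq_nsmul, Nat.cast_smul_eq_nsmul]
  rfl

theorem fieldProd_creationOp (L : List (𝔥 × ℕ)) :
    fieldProd (creationOp B R) L = seriesOp (PowerSeries.map (extHom B R) (negProdList B L)) := by
  rw [fieldProd, negProdList, map_list_prod, List.map_map]
  congr 2
  exact List.map_congr_left fun x _ => fieldSeries_creationOp B R x

/-- A product of positive parts of fields, applied to a vector of the Fock space. -/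
def positiveWord : List (𝔥 × ℕ) → List (𝔥 × ℕ) → LaurentModule R (R ⊗[ℂ] Fock B)
  | [], Lb => constVec (creationOp B R) (1 ⊗ₜ vac B) Lb
  | x :: c, Lb => (-1 : ℤ) ^ c.length • contr (vacuumPairing B R x) (positiveWord c) Lb

theorem laurentCoeff_positiveWord (c Lb : List (𝔥 × ℕ)) (N : ℤ) :
    laurentCoeff N (positiveWord B R c Lb) =
      if N ≤ 0 then 1 ⊗ₜ coeff (-N).toNat (posProdList B c) (modeVec B Lb) else 0 := by
  induction c generalizing Lb N with
  | nil =>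
    rw [positiveWord, constVec_creationOp, laurentCoeff_const, posProdList, List.map_nil,
      List.prod_nil, coeff_one]
    by_cases h0 : N = 0
    · subst h0
      simp
    · rw [if_neg h0]
      split_ifs with h h'
      · omega
      · rw [LinearMap.zero_apply, tmul_zero]
      · rfl
  | cons x c ih =>
    have h : posProdList B (x :: c) = posSeries B x.1 x.2 * posProdList B c := by
      rw [posProdList, List.map_cons, List.prod_cons, posProdList]
    have h1 : ∀ k : Fin Lb.length, laurentCoeff N
        (((-1) ^ (k : ℕ) * vacuumPairing B R x (Lb.get k)) • positiveWord B R c (Lb.eraseIdx k)) =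
        if N + ((Lb.get k).2 + x.2 + 1 : ℕ) ≤ 0 then
          1 ⊗ₜ (((-1) ^ (k : ℕ) * (Ring.choose (-((Lb.get k).2 : ℂ) - 1) x.2 * B x.1 (Lb.get k).1)) •
            coeff (-N - ((Lb.get k).2 + x.2 + 1 : ℕ)).toNat (posProdList B c)
              (modeVec B (Lb.eraseIdx k))) else 0 := by
      intro k
      have hp : (-1) ^ (k : ℕ) * vacuumPairing B R x (Lb.get k) =
          HahnSeries.single (-((Lb.get k).2 : ℤ) - 1 - x.2) (algebraMap ℂ R ((-1) ^ (k : ℕ) *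
            (Ring.choose (-((Lb.get k).2 : ℂ) - 1) x.2 * B x.1 (Lb.get k).1))) := by
        rw [vacuumPairing]
        rcases Nat.even_or_odd (k : ℕ) with h' | h'
        · rw [h'.neg_one_pow, h'.neg_one_pow, one_mul, one_mul]
        · rw [h'.neg_one_pow, h'.neg_one_pow, neg_one_mul, neg_one_mul, map_neg, HahnSeries.single_neg]
      rw [hp, laurentCoeff_single_smul, ih]
      by_cases hN : N + ((Lb.get k).2 + x.2 + 1 : ℕ) ≤ 0
      · rw [if_pos hN, if_pos (by omega), tmul_smul, algebraMap_smul]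
        have h3 : (-(N - (-((Lb.get k).2 : ℤ) - 1 - x.2))).toNat =
          (-N - ((Lb.get k).2 + x.2 + 1 : ℕ)).toNat := by omega
        rw [h3]
      · rw [if_neg hN, if_neg (by omega), smul_zero]
    rw [positiveWord, map_zsmul, h, posSeries_mul_posProdList, contr_eq_sum, map_sum,
      Finset.sum_congr rfl fun k _ => h1 k]
    split_ifs with hN
    · obtain ⟨K, rfl⟩ : ∃ K : ℕ, N = -K := ⟨(-N).toNat, by omega⟩
      rw [neg_neg, Int.toNat_natCast, map_zsmul, LinearMap.smul_apply, coeff_mul_posSeries_modeVec]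
      have h2 : ∀ (z : ℤ) (u : Fock B), (1 ⊗ₜ[ℂ] (z • u) : R ⊗[ℂ] Fock B) = z • (1 ⊗ₜ[ℂ] u) :=
        fun z u => map_zsmul (TensorProduct.mk ℂ R (Fock B) 1) z u
      rw [h2, tmul_sum]
      congr 1
      refine Finset.sum_congr rfl fun k _ => ?_
      by_cases hk : (Lb.get k).2 + x.2 + 1 ≤ K
      · rw [if_pos hk, if_pos (by omega)]
        have h3 : (K - ((Lb.get k).2 + x.2 + 1 : ℕ) : ℤ).toNat = K - ((Lb.get k).2 + x.2 + 1) := by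
          omega
        rw [h3]
      · rw [if_neg hk, if_neg (by omega), tmul_zero]
    · rw [Finset.sum_eq_zero, smul_zero]
      intro k _
      rw [if_neg (by omega)]

/-- Each letter chooses its negative part, which stays in front, or its positive part, which passes
all of `La`. The sign `(-1)^|La|` splits as `(-1)^|p|`, belonging to the unshuffle, and `(-1)^|c|`,
belonging to `positiveWord`. -/
theorem normalWord_eq_splitSum (La Lb : List (𝔥 × ℕ)) :
    normalWord (fun x => seriesOp (fieldSeries (creationOp B R) x)) (vacuumPairing B R)
        (constVec (creationOp B R) (1 ⊗ₜ vac B)) La Lb =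
      splitSum (fun p c => fieldProd (creationOp B R) p (positiveWord B R c Lb)) La := by
  induction La generalizing Lb with
  | nil => rw [normalWord, splitSum, fieldProd_nil, positiveWord]
  | cons x La ih =>
    rw [normalWord, splitSum, funext ih, ← LinearMap.toAddMonoidHom_coe, map_splitSum,
      contr_splitSum, ← splitSum_zsmul]
    congr 1
    · exact splitSum_congr La fun p c _ => (fieldProd_cons x p _).symm
    · refine splitSum_congr La fun p c hpc => ?_
      rw [positiveWord, map_zsmul, map_contr, smul_smul, ← pow_add, hpc]

theorem laurentCoeff_fieldProd_positiveWord (p c Lb : List (𝔥 × ℕ)) (N : ℤ) :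
    laurentCoeff N (fieldProd (creationOp B R) p (positiveWord B R c Lb)) =
      1 ⊗ₜ applyNegPos B (negProdList B p) (posProdList B c) (modeVec B Lb) N := by
  set P := negProdList B p
  set Q := posProdList B c
  set v := modeVec B Lb
  -- The degree in `x⁻¹` is forced to be `k - N`, so the sum over pairs reduces to one over `k`.
  have h1 : applyNegPos B P Q v N =
      ∑ᶠ k : ℕ, if N - k ≤ 0 then coeff k P (coeff (-(N - k)).toNat Q v) else 0 := by
    rw [applyNegPos, finsum_eq_finsum_comp (g := fun k : ℕ => (k, (-(N - k) : ℤ).toNat))]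
    · refine finsum_congr fun k => ?_
      by_cases hk : N - k ≤ 0
      · rw [if_pos hk, if_pos (by simp only; omega)]
      · rw [if_neg hk, if_neg (by simp only; omega)]
    · exact fun k k' h => (Prod.ext_iff.1 h).1
    · rintro ⟨k, l⟩ h
      refine if_neg fun h' => h ⟨k, Prod.ext rfl ?_⟩
      simp only at h' ⊢
      omega
  have h2 : (Function.support fun k : ℕ =>
      if N - k ≤ 0 then coeff k P (coeff (-(N - k)).toNat Q v) else 0).Finite := by
    obtain ⟨K, hK⟩ := locallyFinite_posProdList B c v
    refine (Set.finite_lt_nat (K + N).toNat).subset fun k hk => ?_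
    by_contra h
    simp only [Set.mem_ofPred_eq, not_lt] at h
    refine hk ?_
    simp only
    rw [hK _ (by omega), map_zero, ite_self]
  have h3 := (TensorProduct.mk ℂ R (Fock B) 1).toAddMonoidHom.map_finsum h2
  rw [h1, fieldProd_creationOp, laurentCoeff_seriesOp]
  refine Eq.trans (finsum_congr fun k => ?_) h3.symm
  rw [laurentCoeff_positiveWord, coeff_map]
  split_ifs
  · rfl
  · rw [map_zero, map_zero]

theorem laurentCoeff_normalWord {r : ℕ} (a : Fin r → 𝔥) (m : Fin r → ℕ) (Lb : List (𝔥 × ℕ))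
    (N : ℤ) :
    laurentCoeff N (normalWord (fun x => seriesOp (fieldSeries (creationOp B R) x))
        (vacuumPairing B R) (constVec (creationOp B R) (1 ⊗ₜ vac B))
          (List.ofFn fun i => (a i, m i)) Lb) =
      1 ⊗ₜ normalOrdered B a m (modeVec B Lb) N := by
  have h : normalOrdered B a m (modeVec B Lb) N =
      splitSum (fun p c => applyNegPos B (negProdList B p) (posProdList B c) (modeVec B Lb) N)
        (List.ofFn fun i => (a i, m i)) := by
    rw [splitSum_ofFn, normalOrdered, Finset.sum_apply]
    refine Finset.sum_congr rfl fun μ _ => ?_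
    rw [Finset.sum_apply]
    refine Finset.sum_congr rfl fun p _ => ?_
    rw [Pi.smul_apply, negProd_eq, posProd_eq, ← Int.cast_smul_eq_zsmul ℂ]
    push_cast
    rfl
  rw [normalWord_eq_splitSum, map_splitSum, h]
  refine Eq.trans ?_ (map_splitSum (TensorProduct.mk ℂ R (Fock B) 1).toAddMonoidHom _ _).symm
  exact splitSum_congr _ fun p c _ => laurentCoeff_fieldProd_positiveWord B R p c Lb N

end NormalOrdering

end FermionicFock
end


noncomputable section
namespace FermionicFock

/-! ### Identities for the coefficients `C_{mn}` -/

section Binomials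

theorem succ_mul_choose_succ (α : ℂ) (k : ℕ) :
    (k + 1 : ℂ) * Ring.choose α (k + 1) = (α - k) * Ring.choose α k := by
  have h1 := Ring.descPochhammer_eq_factorial_smul_choose α (k + 1)
  have h2 := Ring.descPochhammer_eq_factorial_smul_choose α k
  have h3 : (descPochhammer ℤ (k + 1)).smeval α = (descPochhammer ℤ k).smeval α * (α - k) := by
    rw [descPochhammer_succ_right, Polynomial.smeval_mul, Polynomial.smeval_sub,
      Polynomial.smeval_X, pow_one, ← Polynomial.C_eq_natCast, Polynomial.smeval_C, pow_zero]
    simp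
  rw [h3, h2, Nat.factorial_succ, nsmul_eq_mul, nsmul_eq_mul] at h1
  push_cast at h1
  have h4 : (k ! : ℂ) ≠ 0 := Nat.cast_ne_zero.2 k.factorial_ne_zero
  refine mul_left_cancel₀ h4 ?_
  linear_combination -h1

theorem mul_choose_sub_one (α : ℂ) (k : ℕ) :
    α * Ring.choose (α - 1) k = (k + 1 : ℂ) * Ring.choose α (k + 1) := by
  have h1 := Ring.choose_succ_succ (α - 1) k
  rw [sub_add_cancel] at h1
  have h2 := succ_mul_choose_succ (α - 1) k
  linear_combination -(k + 1 : ℂ) * h1 - h2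

/-- The differential equation `(∂_X + ∂_Z) f = ∂_y f` for `f = ∑ C_{mn} X^m Z^n y^{-m-n-1}`, read
off coefficientwise. -/
theorem cCoeff_succ (m n : ℕ) :
    (m + 1 : ℂ) * cCoeff (m + 1) n + (n + 1 : ℂ) * cCoeff m (n + 1) =
      -((m : ℂ) + n + 1) * cCoeff m n := by
  have hm := succ_mul_choose_succ (-1 / 2) m
  have hn := succ_mul_choose_succ (-1 / 2) n
  have h1 : (m : ℂ) + n + 1 ≠ 0 := by exact_mod_cast Nat.succ_ne_zero (m + n)
  have h2 : (m : ℂ) + n + 2 ≠ 0 := by exact_mod_cast Nat.succ_ne_zero (m + n + 1)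
  have e1 : (m + 1 : ℂ) * cCoeff (m + 1) n = 1 / 2 * (((m : ℂ) + 1 - n) / ((m : ℂ) + n + 2)) *
      ((-1 / 2 - m) * Ring.choose (-1 / 2 : ℂ) m) * Ring.choose (-1 / 2 : ℂ) n := by
    rw [← hm, cCoeff]
    push_cast
    rw [show (m : ℂ) + 1 + n + 1 = m + n + 2 by ring]
    ring
  have e2 : (n + 1 : ℂ) * cCoeff m (n + 1) = 1 / 2 * (((m : ℂ) - (n + 1)) / ((m : ℂ) + n + 2)) *
      Ring.choose (-1 / 2 : ℂ) m * ((-1 / 2 - n) * Ring.choose (-1 / 2 : ℂ) n) := by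
    rw [← hn, cCoeff]
    push_cast
    rw [show (m : ℂ) + (n + 1) + 1 = m + n + 2 by ring]
    ring
  rw [e1, e2, cCoeff]
  field_simp
  ring

/-- The coefficient form of `f(X + x, Z + x; y) = f(X, Z; y + x)`, the integrated version of
`cCoeff_succ`. -/
theorem sum_choose_mul_cCoeff (k m n : ℕ) :
    ∑ p ∈ Finset.HasAntidiagonal.antidiagonal k,
      ((p.1 + m).choose m : ℂ) * ((p.2 + n).choose n : ℂ) * cCoeff (p.1 + m) (p.2 + n) =
      cCoeff m n * Ring.choose (-((m : ℂ) + n + 1)) k := by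
  induction k generalizing m n with
  | zero => simp
  | succ k ih =>
    have h : ∀ p m : ℕ, ((p + 1 : ℕ) : ℂ) * ((p + 1 + m).choose m : ℂ) =
        (m + 1 : ℂ) * ((p + (m + 1)).choose (m + 1) : ℂ) := by
      intro p m
      have h' := Nat.choose_succ_right_eq (p + 1 + m) m
      rw [Nat.add_sub_cancel, show p + 1 + m = p + (m + 1) by ring] at h'
      rw [show p + 1 + m = p + (m + 1) by ring]
      have h'' := congrArg (Nat.cast (R := ℂ)) h'
      push_cast at h'' ⊢
      linear_combination -h''
    have hk : ((k + 1 : ℕ) : ℂ) ≠ 0 := Nat.cast_ne_zero.2 k.succ_ne_zero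
    refine mul_left_cancel₀ hk ?_
    -- The factor `k + 1 = p.1 + p.2` is distributed over the two indices; absorbing `p.1` raises
    -- `m` and absorbing `p.2` raises `n`, which reduces to `k`.
    have h1 : ((k + 1 : ℕ) : ℂ) * ∑ p ∈ Finset.HasAntidiagonal.antidiagonal (k + 1),
        ((p.1 + m).choose m : ℂ) * ((p.2 + n).choose n : ℂ) * cCoeff (p.1 + m) (p.2 + n) =
        (∑ p ∈ Finset.HasAntidiagonal.antidiagonal (k + 1), (p.1 : ℂ) * ((p.1 + m).choose m : ℂ) *
          (((p.2 + n).choose n : ℂ) * cCoeff (p.1 + m) (p.2 + n))) +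
        ∑ p ∈ Finset.HasAntidiagonal.antidiagonal (k + 1), (p.2 : ℂ) * ((p.2 + n).choose n : ℂ) *
          (((p.1 + m).choose m : ℂ) * cCoeff (p.1 + m) (p.2 + n)) := by
      rw [Finset.mul_sum, ← Finset.sum_add_distrib]
      refine Finset.sum_congr rfl fun p hp => ?_
      rw [← Finset.HasAntidiagonal.mem_antidiagonal.1 hp]
      push_cast
      ring
    rw [h1, Finset.Nat.sum_antidiagonal_succ, Finset.Nat.sum_antidiagonal_succ']
    simp only [h, Nat.cast_zero, zero_mul, zero_add]
    have e1 := ih (m + 1) n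
    have e2 := ih m (n + 1)
    have h2 : ∀ (p : ℕ × ℕ), (m + 1 : ℂ) * ((p.1 + (m + 1)).choose (m + 1) : ℂ) *
        (((p.2 + n).choose n : ℂ) * cCoeff (p.1 + 1 + m) (p.2 + n)) =
        (m + 1 : ℂ) * (((p.1 + (m + 1)).choose (m + 1) : ℂ) * ((p.2 + n).choose n : ℂ) *
          cCoeff (p.1 + (m + 1)) (p.2 + n)) := by
      intro p
      rw [show p.1 + 1 + m = p.1 + (m + 1) by ring]
      ring
    have h3 : ∀ (p : ℕ × ℕ), (n + 1 : ℂ) * ((p.2 + (n + 1)).choose (n + 1) : ℂ) *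
        (((p.1 + m).choose m : ℂ) * cCoeff (p.1 + m) (p.2 + 1 + n)) =
        (n + 1 : ℂ) * (((p.1 + m).choose m : ℂ) * ((p.2 + (n + 1)).choose (n + 1) : ℂ) *
          cCoeff (p.1 + m) (p.2 + (n + 1))) := by
      intro p
      rw [show p.2 + 1 + n = p.2 + (n + 1) by ring]
      ring
    simp only [h2, h3, ← Finset.mul_sum]
    rw [e1, e2]
    have h4 := mul_choose_sub_one (-((m : ℂ) + n + 1)) k
    have h5 := cCoeff_succ m n
    push_cast
    rw [show -((m : ℂ) + 1 + n + 1) = -((m : ℂ) + n + 1) - 1 by ring,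
      show -((m : ℂ) + (n + 1) + 1) = -((m : ℂ) + n + 1) - 1 by ring]
    linear_combination Ring.choose (-((m : ℂ) + n + 1) - 1) k * h5 + cCoeff m n * h4

end Binomials

/-! ### Expansion of the functions `g_{mn}` -/

section Expansions

theorem coeff_expandBinom (α : ℂ) (d i j : ℤ) :
    ((expandBinom α d).coeff i).coeff j =
      if 0 ≤ i ∧ j = d - i then Ring.choose α i.toNat else 0 := by
  rcases lt_or_ge i 0 with h | h
  · rw [expandBinom, ofPowerSeries_coeff_of_neg _ h, if_neg (by omega)]
    rfl
  · obtain ⟨k, rfl⟩ := Int.eq_ofNat_of_zero_le h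
    rw [expandBinom]
    erw [HahnSeries.ofPowerSeries_apply_coeff]
    rw [PowerSeries.coeff_mk, HahnSeries.coeff_single]
    by_cases hj : j = d - k
    · rw [if_pos hj, if_pos ⟨h, hj⟩, Int.toNat_natCast]
    · rw [if_neg hj, if_neg fun h' => hj h'.2]

theorem coeff_iotaYX_single (t : ℤ × ℤ × ℤ) (z : ℂ) (i j : ℤ) :
    ((iotaYX (Finsupp.single t z)).coeff i).coeff j = z *
      if 0 ≤ i - t.2.2 ∧ j = t.1 + t.2.1 - 1 - (i - t.2.2) then
        Ring.choose ((t.1 : ℂ) - 1 / 2) (i - t.2.2).toNat else 0 := by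
  rw [iotaYX, Finsupp.linearCombination_single]
  have h : ∀ f : ScalarSeries, ((z • f).coeff i).coeff j = z * (f.coeff i).coeff j := fun f => rfl
  rw [h, xPow, HahnSeries.coeff_single_mul, one_mul, coeff_expandBinom]

theorem coeff_iotaYX_add (F G : AlgFun) (i j : ℤ) : ((iotaYX (F + G)).coeff i).coeff j =
    ((iotaYX F).coeff i).coeff j + ((iotaYX G).coeff i).coeff j := by
  rw [map_add]
  rfl

theorem coeff_iotaYX_smul (z : ℂ) (F : AlgFun) (i j : ℤ) :
    ((iotaYX (z • F)).coeff i).coeff j = z * ((iotaYX F).coeff i).coeff j := by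
  rw [map_smul]
  rfl

theorem coeff_iotaYX_zero (i j : ℤ) : ((iotaYX 0).coeff i).coeff j = 0 := by
  rw [map_zero]
  rfl

theorem mul_choose_toNat (α : ℂ) {k : ℤ} (hk : 0 ≤ k) :
    (k + 1 : ℂ) * Ring.choose α (k + 1).toNat = (α - k) * Ring.choose α k.toNat := by
  obtain ⟨n, rfl⟩ := Int.eq_ofNat_of_zero_le hk
  exact succ_mul_choose_succ α n

/-- Under `X = x + y`, `Y = y` the derivative in `X` becomes `∂_x`. -/
theorem coeff_iotaYX_partialX (F : AlgFun) (i j : ℤ) : ((iotaYX (partialX F)).coeff i).coeff j =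
    (i + 1 : ℂ) * ((iotaYX F).coeff (i + 1)).coeff j := by
  induction F using Finsupp.induction_linear with
  | zero => rw [map_zero, coeff_iotaYX_zero, coeff_iotaYX_zero, mul_zero]
  | add F G hF hG => rw [map_add, coeff_iotaYX_add, hF, hG, coeff_iotaYX_add, mul_add]
  | single t z =>
    obtain ⟨a, b, c⟩ := t
    rw [partialX, Finsupp.linearCombination_single, coeff_iotaYX_smul, coeff_iotaYX_add,
      coeff_iotaYX_single, coeff_iotaYX_single, coeff_iotaYX_single]
    simp only
    obtain ⟨k, hk⟩ : ∃ k, k = i - c := ⟨_, rfl⟩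
    have hi : (i : ℂ) = k + c := by rw [hk]; push_cast; ring
    rw [← hk, show i - (c - 1) = k + 1 by omega, show i + 1 - c = k + 1 by omega]
    by_cases hj : j = a + b - 1 - (k + 1)
    · rcases lt_trichotomy k (-1) with h | h | h
      · rw [if_neg (by omega), if_neg (by omega)]
        ring
      -- The lowest power of `x`, to which only the derivative of `(X - Y)^c` contributes.
      · subst h
        rw [if_neg (by omega), if_pos (by omega), hi]
        push_cast
        ring
      · have h1 := mul_choose_toNat ((a : ℂ) - 1 / 2) (k := k) (by omega)
        obtain ⟨n, rfl⟩ := Int.eq_ofNat_of_zero_le (show 0 ≤ k by omega)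
        have h2 := mul_choose_sub_one ((a : ℂ) - 1 / 2) n
        rw [if_pos (by omega), if_pos (by omega), hi]
        push_cast at h2 ⊢
        rw [show (a : ℂ) - 1 - 1 / 2 = a - 1 / 2 - 1 by ring, Int.toNat_natCast,
          show ((n : ℤ) + 1).toNat = n + 1 by omega]
        linear_combination z * h2
    · rw [if_neg (by omega), if_neg (by omega)]
      ring

/-- Under `X = x + y`, `Y = y` the derivative in `Y` becomes `∂_y - ∂_x`. -/
theorem coeff_iotaYX_partialY (F : AlgFun) (i j : ℤ) : ((iotaYX (partialY F)).coeff i).coeff j =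
    (j + 1 : ℂ) * ((iotaYX F).coeff i).coeff (j + 1) -
      (i + 1 : ℂ) * ((iotaYX F).coeff (i + 1)).coeff j := by
  induction F using Finsupp.induction_linear with
  | zero =>
    rw [map_zero, coeff_iotaYX_zero, coeff_iotaYX_zero, coeff_iotaYX_zero, mul_zero, mul_zero,
      sub_zero]
  | add F G hF hG =>
    rw [map_add, coeff_iotaYX_add, hF, hG, coeff_iotaYX_add, coeff_iotaYX_add]
    ring
  | single t z =>
    obtain ⟨a, b, c⟩ := t
    rw [partialY, Finsupp.linearCombination_single, coeff_iotaYX_smul, sub_eq_add_neg,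
      ← Finsupp.single_neg, coeff_iotaYX_add, coeff_iotaYX_single, coeff_iotaYX_single,
      coeff_iotaYX_single, coeff_iotaYX_single]
    simp only
    obtain ⟨k, hk⟩ : ∃ k, k = i - c := ⟨_, rfl⟩
    have hi : (i : ℂ) = k + c := by rw [hk]; push_cast; ring
    rw [← hk, show i - (c - 1) = k + 1 by omega, show i + 1 - c = k + 1 by omega]
    by_cases hj : j = a + b - 1 - (k + 1)
    · have hj' : (j : ℂ) = a + b - 1 - (k + 1) := by rw [hj]; push_cast; ring
      rcases lt_trichotomy k (-1) with h | h | h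
      · rw [if_neg (by omega), if_neg (by omega), if_neg (by omega)]
        ring
      · subst h
        rw [if_neg (by omega), if_pos (by omega), if_neg (by omega), hi]
        push_cast
        ring
      · have h1 := mul_choose_toNat ((a : ℂ) - 1 / 2) (k := k) (by omega)
        rw [if_pos (by omega), if_pos (by omega), if_pos (by omega), hi, hj']
        linear_combination z * h1
    · rw [if_neg (by omega), if_neg (by omega), if_neg (by omega)]
      ring

theorem coeff_iotaYX_partialX_pow (m : ℕ) (F : AlgFun) (i j : ℤ) :
    ((iotaYX ((partialX ^ m) F)).coeff i).coeff j =
      (m ! : ℂ) * Ring.choose ((i : ℂ) + m) m * ((iotaYX F).coeff (i + m)).coeff j := by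
  induction m generalizing i with
  | zero => simp
  | succ m ih =>
    have h := succ_mul_choose_succ ((i : ℂ) + (m + 1)) m
    rw [pow_succ', Module.End.mul_apply, coeff_iotaYX_partialX, ih, Nat.factorial_succ]
    push_cast
    rw [show (i : ℂ) + 1 + m = i + (m + 1) by ring, show i + 1 + (m : ℤ) = i + (m + 1) by ring]
    linear_combination -(m ! : ℂ) * ((iotaYX F).coeff (i + (m + 1))).coeff j * h

theorem coeff_iotaYX_gFun (i j : ℤ) : ((iotaYX gFun).coeff i).coeff j =
    if i = -1 ∧ j = 0 then 1 else if 0 ≤ i ∧ j = -i - 1 then cCoeff 0 i.toNat else 0 := by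
  rw [gFun, coeff_iotaYX_add, coeff_iotaYX_single, coeff_iotaYX_single]
  simp only
  rw [show i - -1 = i + 1 by ring]
  by_cases hj : j = -i - 1
  · rcases lt_trichotomy i (-1) with h | h | h
    · rw [if_neg (by omega), if_neg (by omega), if_neg (by omega), if_neg (by omega)]
      ring
    · subst h
      rw [if_pos (by omega), if_pos (by omega), if_pos (by omega)]
      norm_num
    · obtain ⟨k, rfl⟩ := Int.eq_ofNat_of_zero_le (show 0 ≤ i by omega)
      rw [if_pos (by omega), if_pos (by omega), if_neg (by omega), if_pos (by omega),
        Int.toNat_natCast, show ((k : ℤ) + 1).toNat = k + 1 by omega, cCoeff, Ring.choose_zero_right]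
      have h1 := mul_choose_sub_one (1 / 2) k
      have h2 := succ_mul_choose_succ (-1 / 2) k
      have h3 : (k + 1 : ℂ) ≠ 0 := by exact_mod_cast k.succ_ne_zero
      rw [show (1 / 2 - 1 : ℂ) = -1 / 2 by norm_num] at h1
      push_cast
      rw [show (1 - 1 / 2 : ℂ) = 1 / 2 by norm_num, show (0 - 1 / 2 : ℂ) = -1 / 2 by norm_num]
      generalize Ring.choose (1 / 2 : ℂ) (k + 1) = u at h1 ⊢
      generalize Ring.choose (-1 / 2 : ℂ) (k + 1) = u' at h2 ⊢
      generalize Ring.choose (-1 / 2 : ℂ) k = w at h1 h2 ⊢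
      refine mul_left_cancel₀ h3 ?_
      have h4 : (k + 1 : ℂ) * (1 / 2 * ((0 - k) / (0 + k + 1)) * 1 * w) = 1 / 2 * (-k) * w := by
        field_simp
        ring
      rw [h4]
      linear_combination -1 / 2 * h1 + 1 / 2 * h2
  · rw [if_neg (by omega), if_neg (by omega), if_neg (by omega), if_neg (by omega)]
    ring

/-- Applying `∂_y - ∂_x` to the polar term `x^{-n-1}` multiplies it by `n + 1` and lowers its
exponent, while on the regular part `cCoeff_succ` turns `C_{nk}` into `(n + 1) C_{n+1,k}`. -/
theorem coeff_iotaYX_partialY_pow (n : ℕ) (i j : ℤ) :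
    ((iotaYX ((partialY ^ n) gFun)).coeff i).coeff j =
      (n ! : ℂ) * if i = -n - 1 ∧ j = 0 then 1 else
        if 0 ≤ i ∧ j = -n - i - 1 then cCoeff n i.toNat else 0 := by
  induction n generalizing i j with
  | zero =>
    rw [pow_zero, Module.End.one_apply, coeff_iotaYX_gFun]
    simp
  | succ n ih =>
    rw [pow_succ', Module.End.mul_apply, coeff_iotaYX_partialY, ih, ih, Nat.factorial_succ]
    push_cast
    by_cases h1 : i = -(n + 1 : ℤ) - 1 ∧ j = 0
    · obtain ⟨rfl, rfl⟩ := h1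
      rw [if_neg (by omega), if_neg (by omega), if_pos (by omega), if_pos (by omega)]
      push_cast
      ring
    · rw [if_neg h1]
      by_cases h2 : 0 ≤ i ∧ j = -(n + 1 : ℤ) - i - 1
      · obtain ⟨h, hj⟩ := h2
        obtain ⟨k, rfl⟩ := Int.eq_ofNat_of_zero_le h
        have h3 := cCoeff_succ n k
        rw [if_neg (by omega), if_pos (by omega), if_neg (by omega), if_pos (by omega),
          if_pos (by omega), Int.toNat_natCast, show ((k : ℤ) + 1).toNat = k + 1 by omega, hj]
        push_cast
        linear_combination -(n ! : ℂ) * h3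
      · rw [if_neg h2, if_neg (show ¬ (i + 1 = -n - 1 ∧ j = 0) by omega)]
        -- The coefficients that remain sit at `j = -1` or `i = -1`, where the factor produced by
        -- differentiation vanishes.
        have e1 : (j + 1 : ℂ) * ((n ! : ℂ) * if i = -(n : ℤ) - 1 ∧ j + 1 = 0 then 1 else
            if 0 ≤ i ∧ j + 1 = -n - i - 1 then cCoeff n i.toNat else 0) = 0 := by
          by_cases h : i = -(n : ℤ) - 1 ∧ j + 1 = 0
          · have h' : (j + 1 : ℂ) = 0 := by exact_mod_cast h.2
            rw [h', zero_mul]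
          · rw [if_neg h, if_neg (by omega), mul_zero, mul_zero]
        have e2 : (i + 1 : ℂ) * ((n ! : ℂ) *
            if 0 ≤ i + 1 ∧ j = -n - (i + 1) - 1 then cCoeff n (i + 1).toNat else 0) = 0 := by
          by_cases h : 0 ≤ i + 1 ∧ j = -n - (i + 1) - 1
          · have h' : (i + 1 : ℂ) = 0 := by
              have : i + 1 = 0 := by omega
              exact_mod_cast this
            rw [h', zero_mul]
          · rw [if_neg h, mul_zero, mul_zero]
        rw [e1, e2]
        ring

theorem coeff_iotaYX_gDeriv (m n : ℕ) (i j : ℤ) : ((iotaYX (gDeriv m n)).coeff i).coeff j =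
    Ring.choose ((i : ℂ) + m) m * if i + m = -n - 1 ∧ j = 0 then 1 else
      if 0 ≤ i + m ∧ j = -n - (i + m) - 1 then cCoeff n (i + m).toNat else 0 := by
  rw [gDeriv, coeff_iotaYX_smul, coeff_iotaYX_partialX_pow, coeff_iotaYX_partialY_pow]
  have hm : (m ! : ℂ) ≠ 0 := Nat.cast_ne_zero.2 m.factorial_ne_zero
  have hn : (n ! : ℂ) ≠ 0 := Nat.cast_ne_zero.2 n.factorial_ne_zero
  field_simp

/-- The Vandermonde convolution of binomial coefficients. -/
theorem expandBinom_mul (α β : ℂ) (d d' : ℤ) :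
    expandBinom α d * expandBinom β d' = expandBinom (α + β) (d + d') := by
  rw [expandBinom, expandBinom, expandBinom, ← map_mul]
  congr 1
  ext1 k
  rw [PowerSeries.coeff_mul, PowerSeries.coeff_mk, Ring.add_choose_eq k (Commute.all α β)]
  have h : ∀ (s : Finset (ℕ × ℕ)) (f : ℕ × ℕ → ℂ) (c : ℤ),
      (HahnSeries.single c (∑ p ∈ s, f p) : LaurentSeries ℂ) =
        ∑ p ∈ s, HahnSeries.single c (f p) :=
    fun s f c => map_sum (HahnSeries.single.addMonoidHom (R := ℂ) c) f s
  rw [h]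
  refine Finset.sum_congr rfl fun p hp => ?_
  rw [PowerSeries.coeff_mk, PowerSeries.coeff_mk, HahnSeries.single_mul_single,
    ← Finset.HasAntidiagonal.mem_antidiagonal.1 hp, Nat.cast_add, add_sub_add_comm]

theorem expandBinom_zero : expandBinom 0 0 = 1 := by
  rw [expandBinom, ← map_one (HahnSeries.ofPowerSeries ℤ (LaurentSeries ℂ))]
  congr 1
  ext1 k
  rw [PowerSeries.coeff_mk, PowerSeries.coeff_one, Ring.choose_zero_ite]
  split_ifs with h
  · subst h
    rfl
  · exact HahnSeries.single_eq_zero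

theorem expandBinom_pow (s : ℕ) : expandBinom (-1) (-1) ^ s = expandBinom (-s) (-s) := by
  induction s with
  | zero => simpa using expandBinom_zero.symm
  | succ s ih =>
    rw [pow_succ, ih, expandBinom_mul]
    push_cast
    congr 1 <;> ring

theorem yPow_pow (s : ℕ) : yPow (-1) ^ s = yPow (-s) := by
  rw [yPow, ← map_pow, HahnSeries.single_pow, one_pow, nsmul_eq_mul, mul_neg_one, yPow]

end Expansions

end FermionicFock
end


noncomputable section
namespace FermionicFock

/-! ### The contraction sum in indexed form -/

section Expansion

variable {α β ι K W : Type*} [CommRing K] [AddCommGroup W] [Module K W]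

theorem contr_map (f : ι → α) (χ : α → K) (F : List α → W) (L : List ι) :
    contr χ F (L.map f) = contr (fun i => χ (f i)) (fun L' => F (L'.map f)) L := by
  induction L generalizing F with
  | nil => rfl
  | cons i L ih => rw [List.map_cons, contr, contr, ih]; rfl

theorem pf_map (f : ι → α) (χ : α → α → K) (n : ℕ) (L : List ι) (hn : L.length ≤ n) :
    pf χ (L.map f) = pf (fun i j => χ (f i) (f j)) L := by
  induction n generalizing L with
  | zero =>
    rw [List.length_eq_zero_iff.1 (Nat.le_zero.1 hn), List.map_nil, pf, pf]
  | succ n ih =>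
    cases L with
    | nil => rw [List.map_nil, pf, pf]
    | cons i L =>
      rw [List.map_cons, pf_cons, pf_cons, contr_map]
      exact contr_congr L fun L' hL' => ih L' (by simp at hn; omega)

/-- Each of the `t` pairs contributes a sign and `ε^{d_i + d_j + 1}`. Every index occurs in one
pair, so the exponents add up independently of the pairing and factor out. -/
theorem pf_eq_contractList (κ : ℂ →+* K) (ε : K) (c : ι → ι → ℂ) (d : ι → ℕ) (χ : ι → ι → K)
    (hχ : ∀ i j, χ i j = -(κ (c i j) * ε ^ (d i + d j + 1))) (t : ℕ) (L : List ι)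
    (hL : L.length = 2 * t) :
    pf χ L = (-1) ^ t * κ (contractList c t L) * ε ^ ((L.map d).sum + t) := by
  induction t generalizing L with
  | zero => simp [List.length_eq_zero_iff.1 hL, pf, contractList]
  | succ t ih =>
    cases L with
    | nil => simp at hL
    | cons i L =>
      rw [pf, contractList, map_sum, Finset.mul_sum, Finset.sum_mul]
      refine Finset.sum_congr rfl fun k _ => ?_
      have h : d (L.get k) + ((L.eraseIdx k).map d).sum = (L.map d).sum := by
        have h' := (List.getElem_cons_eraseIdx_perm k.2).map d
        rw [← h'.sum_eq, List.map_cons, List.sum_cons]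
        rfl
      rw [hχ, ih _ (by rw [List.length_eraseIdx_of_lt k.2]; simp at hL; omega), map_mul, map_mul,
        map_pow, map_neg, map_one, List.map_cons, List.sum_cons, ← h]
      ring

theorem pf_ofFn (κ : ℂ →+* K) (ε : K) {r t : ℕ} (f : Fin r → α) (χ : α → α → K)
    (c : Fin r → Fin r → ℂ) (d : Fin r → ℕ)
    (hχ : ∀ i j, χ (f i) (f j) = -(κ (c i j) * ε ^ (d i + d j + 1))) (p : Fin (2 * t) ↪o Fin r) :
    (-1 : K) ^ t * pf χ (List.ofFn (f ∘ p)) =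
      κ (contractList c t (List.ofFn p)) * ε ^ (∑ i, d (p i) + t) := by
  rw [← List.map_ofFn, pf_map f χ _ _ le_rfl,
    pf_eq_contractList κ ε c d _ hχ t _ (List.length_ofFn), List.map_ofFn, List.sum_ofFn,
    ← mul_assoc, ← mul_assoc, ← pow_add, ← two_mul, pow_mul, neg_one_sq, one_pow, one_mul]
  rfl

theorem contractionSum_ofFn {r s : ℕ} (fa : Fin r → α) (fb : Fin s → β) (χ : α → α → K)
    (θ : β → β → K) (g : α → β → K) (w : List α → List β → W) :
    contractionSum χ θ g w (List.ofFn fa) (List.ofFn fb) =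
      ∑ k ∈ Finset.range (r / 2 + 1), ∑ p : Fin (2 * k) ↪o Fin r,
      ∑ l ∈ Finset.range (s / 2 + 1), ∑ q : Fin (2 * l) ↪o Fin s,
      ∑ ρ ∈ Finset.range (min (r - 2 * k) (s - 2 * l) + 1),
      ∑ i : Fin ρ ↪o Fin (r - 2 * k), ∑ j : Fin ρ ↪o Fin (s - 2 * l),
        (((-1) ^ seqSum p * ((-1) ^ k * pf χ (List.ofFn (fa ∘ p)))) *
          ((-1) ^ seqSum q * ((-1) ^ l * pf θ (List.ofFn (fb ∘ q)))) *
          ((-1) ^ (seqSum i + seqSum j) * (-1) ^ ((r - 2 * k) * ρ + ρ * (ρ + 1) / 2) *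
            Matrix.det (Matrix.of fun α β : Fin ρ =>
              g (fa (complSeq p (i α))) (fb (complSeq q (j β)))))) •
          w (List.ofFn fun α => fa (complSeq p (complSeq i α)))
            (List.ofFn fun β => fb (complSeq q (complSeq j β))) := by
  have hz : ∀ (z : ℤ) (u : W), z • u = (z : K) • u := fun z u => (Int.cast_smul_eq_zsmul K z u).symm
  have hm : ∀ {c c' : ℕ} (f : Fin c → α) (f' : Fin c' → β),
      matchSum g w (List.ofFn f) (List.ofFn f') = ∑ ρ ∈ Finset.range (min c c' + 1),
        ∑ i : Fin ρ ↪o Fin c, ∑ j : Fin ρ ↪o Fin c',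
        ((-1) ^ (seqSum i + seqSum j) * (-1) ^ (c * ρ + ρ * (ρ + 1) / 2) *
          Matrix.det (Matrix.of fun α β : Fin ρ => g (f (i α)) (f' (j β)))) •
            w (List.ofFn (f ∘ complSeq i)) (List.ofFn (f' ∘ complSeq j)) := by
    intro c c' f f'
    rw [matchSum, splitSum_splitSum_ofFn]
    · refine Finset.sum_congr rfl fun ρ _ => Finset.sum_congr rfl fun i _ =>
        Finset.sum_congr rfl fun j _ => ?_
      rw [detList_ofFn, List.length_ofFn, List.length_ofFn, hz, hz, smul_smul, smul_smul]
      push_cast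
      rfl
    · intro i ic j jc h
      rw [detList_eq_zero g i j h, zero_smul, smul_zero]
  rw [contractionSum, splitSum_ofFn_of_even]
  · refine Finset.sum_congr rfl fun k _ => Finset.sum_congr rfl fun p _ => ?_
    rw [splitSum_ofFn_of_even]
    · rw [hz, hz, smul_smul, smul_smul, Finset.smul_sum]
      refine Finset.sum_congr rfl fun l _ => ?_
      rw [Finset.smul_sum]
      refine Finset.sum_congr rfl fun q _ => ?_
      rw [hz, hz, smul_smul, smul_smul, smul_smul, hm, Finset.smul_sum]
      refine Finset.sum_congr rfl fun ρ _ => ?_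
      rw [Finset.smul_sum]
      refine Finset.sum_congr rfl fun i _ => ?_
      rw [Finset.smul_sum]
      refine Finset.sum_congr rfl fun j _ => ?_
      rw [smul_smul]
      push_cast
      simp only [mul_assoc, Function.comp_def]
    · intro q c h
      rw [pf_eq_zero θ _ q le_rfl h, zero_smul]
  · intro p c h
    rw [pf_eq_zero χ _ p le_rfl h, zero_smul]

end Expansion

end FermionicFock
end


noncomputable section
namespace FermionicFock

open TensorProduct

/-! ### The contractions over `ℂ((y))((x))` -/

section ScalarSeries

/-- The field `ℂ((y))` as an algebra over its constants. -/
abbrev laurentAlgebra : Algebra ℂ (LaurentSeries ℂ) := HahnSeries.instAlgebra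

attribute [local instance] laurentAlgebra

/-- The element `y⁻¹` of `ℂ((y))`. -/
def invY : LaurentSeries ℂ := HahnSeries.single (-1) 1

theorem invY_pow (k : ℕ) : invY ^ k = HahnSeries.single (-(k : ℤ)) 1 := by
  rw [invY, HahnSeries.single_pow, one_pow, nsmul_eq_mul, mul_neg_one]

/-- The inclusion of the constants into `ℂ((y))((x))`. -/
def constHom : ℂ →+* ScalarSeries := HahnSeries.C.comp HahnSeries.C

theorem coeff_const_mul (z : ℂ) (f : ScalarSeries) (i j : ℤ) :
    ((const z * f).coeff i).coeff j = z * (f.coeff i).coeff j := by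
  have h : (const z * f).coeff i = HahnSeries.single 0 z * f.coeff i :=
    HahnSeries.coeff_single_zero_mul
  rw [h, HahnSeries.coeff_single_zero_mul]

theorem natCast_mul_single (k : ℕ) (d : ℤ) (z : ℂ) :
    (k : LaurentSeries ℂ) * HahnSeries.single d z = HahnSeries.single d (k * z) := by
  have h : (k : LaurentSeries ℂ) = HahnSeries.single 0 (k : ℂ) :=
    (HahnSeries.single_zero_natCast k).symm
  rw [h, HahnSeries.single_mul_single, zero_add]

theorem coeff_ofPowerSeries_mk (c : ℕ → LaurentSeries ℂ) (i : ℤ) :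
    HahnSeries.coeff (HahnSeries.ofPowerSeries ℤ (LaurentSeries ℂ) (PowerSeries.mk c)) i =
      if 0 ≤ i then c i.toNat else 0 := by
  split_ifs with h
  · obtain ⟨k, rfl⟩ := Int.eq_ofNat_of_zero_le h
    refine (HahnSeries.ofPowerSeries_apply_coeff (Γ := ℤ) (PowerSeries.mk c) k).trans ?_
    rw [PowerSeries.coeff_mk, Int.toNat_natCast]
  · exact ofPowerSeries_coeff_of_neg _ (not_le.1 h)

variable {𝔥 : Type*} [AddCommGroup 𝔥] [Module ℂ 𝔥] (B : LinearMap.BilinForm ℂ 𝔥)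

theorem pairing_invY (y y' : 𝔥 × ℕ) : pairing B invY y y' =
    HahnSeries.single (-((y'.2 : ℤ) + y.2 + 1)) (B y.1 y'.1 * cCoeff y'.2 y.2) := by
  have h : algebraMap ℂ (LaurentSeries ℂ) (B y.1 y'.1 * cCoeff y'.2 y.2) =
    HahnSeries.single 0 (B y.1 y'.1 * cCoeff y'.2 y.2) := rfl
  rw [pairing, invY_pow, h, HahnSeries.single_mul_single, zero_add, mul_one]
  push_cast
  rfl

/-- The convolution `sum_choose_mul_cCoeff` resums the contraction of two fields to `(y +
x)^{-m-n-1}`. The minus sign is the skew-symmetry of `C_{mn}`: the shift carries the indices in the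
opposite order. -/
theorem fieldPairing_invY (x z : 𝔥 × ℕ) : fieldPairing (pairing B invY) x z =
    -(constHom (B x.1 z.1 * cCoeff x.2 z.2) * expandBinom (-1) (-1) ^ (x.2 + z.2 + 1)) := by
  ext i j
  have h1 : HahnSeries.coeff (fieldPairing (pairing B invY) x z) i = if 0 ≤ i then
      HahnSeries.single (-((i.toNat : ℤ) + x.2 + z.2 + 1))
        (-(B x.1 z.1 * (cCoeff x.2 z.2 * Ring.choose (-((x.2 : ℂ) + z.2 + 1)) i.toNat)))
      else 0 := by
    rw [fieldPairing, coeff_ofPowerSeries_mk]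
    split_ifs with h
    · rw [← sum_choose_mul_cCoeff, Finset.mul_sum, ← Finset.sum_neg_distrib]
      refine Eq.trans (Finset.sum_congr rfl fun p hp => ?_)
        (map_sum (HahnSeries.single.addMonoidHom (R := ℂ) _) _ _).symm
      rw [pairing_invY, mul_assoc, natCast_mul_single, natCast_mul_single, cCoeff_symm,
        ← Finset.HasAntidiagonal.mem_antidiagonal.1 hp]
      refine congrArg₂ (fun d c => HahnSeries.single (d : ℤ) (c : ℂ)) ?_ ?_
      · push_cast
        ring
      · ring
    · rfl
  have h2 : ∀ f : ScalarSeries, ((-f).coeff i).coeff j = -(f.coeff i).coeff j := fun f => rfl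
  rw [h1, h2]
  erw [coeff_const_mul]
  rw [expandBinom_pow, coeff_expandBinom]
  by_cases h : 0 ≤ i
  · rw [if_pos h, HahnSeries.coeff_single]
    by_cases hj : j = -((i.toNat : ℤ) + x.2 + z.2 + 1)
    · rw [if_pos hj, if_pos ⟨h, by push_cast; omega⟩]
      push_cast
      ring
    · rw [if_neg hj, if_neg (by push_cast; omega)]
      ring
  · rw [if_neg h, if_neg (by omega)]
    simp

theorem C_pairing_invY (y y' : 𝔥 × ℕ) : HahnSeries.C (pairing B invY y y') =
    -(constHom (B y.1 y'.1 * cCoeff y.2 y'.2) * yPow (-1) ^ (y.2 + y'.2 + 1)) := by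
  have h : constHom (B y.1 y'.1 * cCoeff y.2 y'.2) =
    HahnSeries.C (HahnSeries.single 0 (B y.1 y'.1 * cCoeff y.2 y'.2)) := rfl
  rw [yPow_pow, yPow, h, ← map_mul, HahnSeries.single_mul_single, pairing_invY, cCoeff_symm,
    mul_neg, HahnSeries.single_neg, mul_one, zero_add]
  push_cast
  rw [add_comm (y'.2 : ℤ)]
  exact map_neg (HahnSeries.C (Γ := ℤ) (R := LaurentSeries ℂ)) _

/-- The positive part of the field yields the pole of `ι_{yx} g_{mn}` and the shift yields its part
regular in `x`. -/
theorem mixedPairing_invY (x y : 𝔥 × ℕ) :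
    vacuumPairing B (LaurentSeries ℂ) x y + mixedPairing (pairing B invY) x y =
      const (B x.1 y.1) * iotaYX (gDeriv x.2 y.2) := by
  ext i j
  rw [coeff_const_mul, coeff_iotaYX_gDeriv, HahnSeries.coeff_add, HahnSeries.coeff_add,
    mixedPairing, coeff_ofPowerSeries_mk, vacuumPairing, HahnSeries.coeff_single]
  by_cases h : i = -(y.2 : ℤ) - 1 - x.2
  · rw [if_pos h, if_neg (by omega)]
    have hi : (i : ℂ) + x.2 = -y.2 - 1 := by rw [h]; push_cast; ring
    have h0 : ∀ z : ℂ, (algebraMap ℂ (LaurentSeries ℂ) z).coeff j = if j = 0 then z else 0 :=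
      fun z => by
        refine (HahnSeries.coeff_single (a := (0 : ℤ)) (r := z) (b := j)).trans ?_
        congr
    rw [h0, HahnSeries.coeff_zero, hi]
    by_cases hj : j = 0
    · rw [if_pos hj, if_pos ⟨by omega, hj⟩]
      ring
    · rw [if_neg hj, if_neg (by omega), if_neg (by omega)]
      ring
  · have h' : ¬ (i + x.2 = -(y.2 : ℤ) - 1 ∧ j = 0) := fun h' => h (by omega)
    rw [if_neg h, HahnSeries.coeff_zero, if_neg h', zero_add]
    by_cases h0 : 0 ≤ i
    · obtain ⟨k, rfl⟩ := Int.eq_ofNat_of_zero_le h0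
      have h1 : ((k : ℤ) : ℂ) + x.2 = ((k + x.2 : ℕ) : ℂ) := by push_cast; rfl
      rw [if_pos h0, Int.toNat_natCast, pairing_invY, natCast_mul_single, HahnSeries.coeff_single,
        h1, Ring.choose_natCast, show ((k : ℤ) + x.2).toNat = k + x.2 by omega]
      by_cases hj : j = -(y.2 : ℤ) - (k + x.2) - 1
      · rw [if_pos (by push_cast; omega), if_pos (by omega)]
        ring
      · rw [if_neg (by push_cast; omega), if_neg (by omega)]
        ring
    · rw [if_neg h0, HahnSeries.coeff_zero]
      split_ifs with h1
      · obtain ⟨k, hk⟩ := Int.eq_ofNat_of_zero_le h1.1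
        have h2 : (i : ℂ) + x.2 = (k : ℕ) := by exact_mod_cast hk
        -- For `-m ≤ i < 0` the `m`-th derivative has annihilated the term: the upper entry `i + m`
        -- is a natural number below `m`.
        rw [h2, Ring.choose_natCast, Nat.choose_eq_zero_of_lt (by omega)]
        simp
      · simp

/-- The coefficient of `y^j` of an element of `ℂ((y)) ⊗ V`. -/
def tensorCoeff (j : ℤ) : LaurentSeries ℂ ⊗[ℂ] Fock B →ₗ[ℂ] Fock B :=
  TensorProduct.lift (LinearMap.mk₂ ℂ (fun (f : LaurentSeries ℂ) (v : Fock B) => f.coeff j • v)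
    (fun f g v => add_smul (f.coeff j) (g.coeff j) v)
    (fun c f v => mul_smul c (f.coeff j) v)
    (fun f v w => smul_add (f.coeff j) v w)
    (fun c f v => smul_comm (f.coeff j) c v))

theorem tensorCoeff_tmul (j : ℤ) (f : LaurentSeries ℂ) (v : Fock B) :
    tensorCoeff B j (f ⊗ₜ v) = f.coeff j • v := rfl

/-- The coefficient of `x^i y^j` of an element of `(ℂ((y)) ⊗ V)((x))`. -/
def vectorCoeff (i j : ℤ) : LaurentModule (LaurentSeries ℂ) (LaurentSeries ℂ ⊗[ℂ] Fock B) →+ Fock B :=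
  (tensorCoeff B j).toAddMonoidHom.comp (laurentCoeff i)

theorem vectorCoeff_expOp {M : ℕ} (e e' : Fin M → 𝔥)
    (hb : ∀ b, b = ∑ i, (B (e' i) b • e i + B (e i) b • e' i)) (w : ℤ → Fock B)
    (u : LaurentModule (LaurentSeries ℂ) (LaurentSeries ℂ ⊗[ℂ] Fock B))
    (hu : ∀ i, laurentCoeff i u = 1 ⊗ₜ w i) (i j : ℤ) :
    vectorCoeff B i j (seriesOp (PowerSeries.C (expOp B invY e e' hb)) u) =
      expDeltaApply B e e' w i j := by
  change tensorCoeff B j (laurentCoeff i _) = _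
  rw [laurentCoeff_seriesOp_C, hu, expOp, evalOp_tmul_eq_finsum]
  refine ((tensorCoeff B j).toAddMonoidHom.map_finsum
    (finite_support_tmul invY (locallyFinite_expDelta B e e' hb) (w i))).trans ?_
  have h : ∀ k : ℕ, (tensorCoeff B j).toAddMonoidHom
      ((invY ^ k) ⊗ₜ[ℂ] PowerSeries.coeff k (expDelta B e e') (w i)) =
      if j = -(k : ℤ) then PowerSeries.coeff k (expDelta B e e') (w i) else 0 := by
    intro k
    refine (tensorCoeff_tmul B j _ _).trans ?_
    rw [invY_pow, HahnSeries.coeff_single]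
    by_cases hj : j = -(k : ℤ)
    · rw [if_pos hj, if_pos hj, one_smul]
    · rw [if_neg hj, if_neg hj, zero_smul]
  rw [finsum_congr h, expDeltaApply]
  split_ifs with hj
  · rw [finsum_eq_single _ (-j).toNat, if_pos (by omega)]
    intro k hk
    exact if_neg (by omega)
  · exact finsum_eq_zero_of_forall_eq_zero fun k => if_neg (by omega)

theorem vectorCoeff_smul_fieldProd (f : ScalarSeries) (L L' : List (𝔥 × ℕ)) (i j : ℤ) :
    vectorCoeff B i j (f • fieldProd (creationOp B (LaurentSeries ℂ)) L
      (constVec (creationOp B (LaurentSeries ℂ)) (1 ⊗ₜ vac B) L')) =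
      scalarMul B f (fun d => PowerSeries.coeff d (negProdList B L) (modeVec B L')) i j := by
  change tensorCoeff B j (laurentCoeff i _) = _
  have hfin := hasFiniteSupport_laurentCoeff_smul (R := LaurentSeries ℂ)
    (X := LaurentSeries ℂ ⊗[ℂ] Fock B) (scalarHom (LaurentSeries ℂ) (LaurentSeries ℂ ⊗[ℂ] Fock B) f)
    (fieldProd (creationOp B (LaurentSeries ℂ)) L
      (constVec (creationOp B (LaurentSeries ℂ)) (1 ⊗ₜ vac B) L')) i
  rw [scalar_smul, laurentCoeff_smul]
  refine ((tensorCoeff B j).toAddMonoidHom.map_finsum hfin).trans ?_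
  have h : ∀ k : ℤ, (tensorCoeff B j).toAddMonoidHom
      ((scalarHom (LaurentSeries ℂ) (LaurentSeries ℂ ⊗[ℂ] Fock B) f).coeff k
        (laurentCoeff (i - k) (fieldProd (creationOp B (LaurentSeries ℂ)) L
          (constVec (creationOp B (LaurentSeries ℂ)) (1 ⊗ₜ vac B) L')))) =
      if 0 ≤ i - k then (f.coeff k).coeff j •
        PowerSeries.coeff (i - k).toNat (negProdList B L) (modeVec B L') else 0 := by
    intro k
    rw [constVec_creationOp, fieldProd_creationOp, laurentCoeff_seriesOp_const]
    split_ifs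
    · rw [PowerSeries.coeff_map, extHom_tmul]
      have h1 : (scalarHom (LaurentSeries ℂ) (LaurentSeries ℂ ⊗[ℂ] Fock B) f).coeff k
          (1 ⊗ₜ PowerSeries.coeff (i - k).toNat (negProdList B L) (modeVec B L')) =
          (f.coeff k * 1) ⊗ₜ PowerSeries.coeff (i - k).toNat (negProdList B L) (modeVec B L') :=
        rfl
      rw [h1, mul_one]
      exact tensorCoeff_tmul B j _ _
    · rw [map_zero, map_zero]
  rw [finsum_congr h, finsum_eq_finsum_comp (g := fun d : ℕ => i - (d : ℤ)), scalarMul]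
  · refine finsum_congr fun d => ?_
    rw [if_pos (by omega), sub_sub_cancel, Int.toNat_natCast]
  · intro d d' hd
    simp only at hd
    omega
  · intro k hk
    refine if_neg fun h0 => hk ⟨(i - k).toNat, ?_⟩
    simp only
    omega

end ScalarSeries

/-! ### Dual bases of the two isotropic subspaces -/

section Polarization

variable {𝔥 : Type*} [AddCommGroup 𝔥] [Module ℂ 𝔥] {B : LinearMap.BilinForm ℂ 𝔥}

/-- By isotropy, pairing with `e'_i` sees only the component in `𝔭`, and pairing with `e_i` only the
one in `𝔮`. -/
theorem eq_sum_of_dual_bases (hsymm : B.IsSymm) {𝔭 𝔮 : Submodule ℂ 𝔥} (hpq : IsCompl 𝔭 𝔮)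
    (h𝔭 : ∀ u ∈ 𝔭, ∀ v ∈ 𝔭, B u v = 0) (h𝔮 : ∀ u ∈ 𝔮, ∀ v ∈ 𝔮, B u v = 0)
    {M : ℕ} (e : Module.Basis (Fin M) ℂ 𝔭) (e' : Module.Basis (Fin M) ℂ 𝔮)
    (hdual : ∀ i j, B (e i) (e' j) = if i = j then 1 else 0) (b : 𝔥) :
    b = ∑ i, (B (e' i) b • (e i : 𝔥) + B (e i) b • (e' i : 𝔥)) := by
  obtain ⟨u, hu, v, hv, rfl⟩ := Submodule.mem_sup.1 (hpq.sup_eq_top ▸ Submodule.mem_top (x := b))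
  have h1 : u = ∑ i, e.repr ⟨u, hu⟩ i • (e i : 𝔥) := by
    exact (congrArg 𝔭.subtype (e.sum_repr ⟨u, hu⟩)).symm.trans (map_sum 𝔭.subtype _ _)
  have h2 : v = ∑ i, e'.repr ⟨v, hv⟩ i • (e' i : 𝔥) := by
    exact (congrArg 𝔮.subtype (e'.sum_repr ⟨v, hv⟩)).symm.trans (map_sum 𝔮.subtype _ _)
  have h3 : ∀ i, B (e' i) (u + v) = e.repr ⟨u, hu⟩ i := by
    intro i
    rw [map_add, h𝔮 _ (e' i).2 _ hv, add_zero, hsymm.eq]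
    conv_lhs => rw [h1]
    simp [hdual]
  have h4 : ∀ i, B (e i) (u + v) = e'.repr ⟨v, hv⟩ i := by
    intro i
    rw [map_add, h𝔭 _ (e i).2 _ hu, zero_add]
    conv_lhs => rw [h2]
    simp [hdual]
  simp only [h3, h4, Finset.sum_add_distrib]
  rw [← h1, ← h2]

end Polarization

end FermionicFock
end


noncomputable section
namespace FermionicFock

open TensorProduct

/-! ### Assembly of the formula -/

section Formula

attribute [local instance] laurentAlgebra

variable {𝔥 : Type*} [AddCommGroup 𝔥] [Module ℂ 𝔥] (B : LinearMap.BilinForm ℂ 𝔥)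

theorem pf_fieldPairing {r k : ℕ} (a : Fin r → 𝔥) (m : Fin r → ℕ) (p : Fin (2 * k) ↪o Fin r) :
    (-1) ^ k * pf (fieldPairing (pairing B invY)) (List.ofFn ((fun i => (a i, m i)) ∘ p)) =
      const (totalContraction B a m p) *
        expandBinom (-(∑ α, (m (p α) : ℂ)) - k) (-(∑ α, (m (p α) : ℤ)) - k) := by
  rw [pf_ofFn constHom (expandBinom (-1) (-1)) (fun i => (a i, m i)) _ _ m
    fun i j => fieldPairing_invY B (a i, m i) (a j, m j), expandBinom_pow]
  push_cast
  rw [neg_add', neg_add']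
  rfl

theorem pf_pairing {s l : ℕ} (b : Fin s → 𝔥) (n : Fin s → ℕ) (q : Fin (2 * l) ↪o Fin s) :
    (-1) ^ l * pf (fun y y' => (HahnSeries.C (pairing B invY y y') : ScalarSeries))
        (List.ofFn ((fun j => (b j, n j)) ∘ q)) =
      const (totalContraction B b n q) * yPow (-(∑ β, (n (q β) : ℤ)) - l) := by
  rw [pf_ofFn constHom (yPow (-1)) (fun j => (b j, n j)) _ _ n
    fun i j => C_pairing_invY B (b i, n i) (b j, n j), yPow_pow]
  push_cast
  rw [neg_add']
  rfl

/-- The normal-ordered word has coefficients `1 ⊗ w_i` in the extended module, so conjugation there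
can be read off coefficientwise in `V`. -/
theorem expDeltaApply_normalOrdered {M : ℕ} (e e' : Fin M → 𝔥)
    (hb : ∀ b, b = ∑ i, (B (e' i) b • e i + B (e i) b • e' i))
    {r s : ℕ} (a : Fin r → 𝔥) (b : Fin s → 𝔥) (m : Fin r → ℕ) (n : Fin s → ℕ) (x y : ℤ) :
    expDeltaApply B e e' (normalOrdered B a m (fockVec B b n)) x y =
      vectorCoeff B x y (contractionSum (fieldPairing (pairing B invY))
        (fun y y' => HahnSeries.C (pairing B invY y y'))
        (fun x y => vacuumPairing B (LaurentSeries ℂ) x y + mixedPairing (pairing B invY) x y)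
        (fun L L' => fieldProd (creationOp B (LaurentSeries ℂ)) L
          (constVec (creationOp B (LaurentSeries ℂ)) (1 ⊗ₜ vac B) L'))
        (List.ofFn fun i => (a i, m i)) (List.ofFn fun j => (b j, n j))) := by
  rw [← field_contraction_formula (expOp B invY e e' hb) (1 ⊗ₜ vac B)
    (shiftOp_mul_creation B invY) (expOp_mul_creation B invY e e' hb) (expOp_vac B invY e e' hb)
    (fun y => shiftOp_vac B invY y.1 y.2), fockVec_eq]
  exact (vectorCoeff_expOp B e e' hb _ _ (laurentCoeff_normalWord B _ a m _) x y).symm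

end Formula

end FermionicFock
end

theorem mainTheorem3 {𝔥 : Type*} [AddCommGroup 𝔥] [Module ℂ 𝔥]
    (B : LinearMap.BilinForm ℂ 𝔥) (hsymm : B.IsSymm) (hnondeg : B.Nondegenerate)
    (𝔭 𝔮 : Submodule ℂ 𝔥) (hpq : IsCompl 𝔭 𝔮)
    (h𝔭 : ∀ u ∈ 𝔭, ∀ v ∈ 𝔭, B u v = 0) (h𝔮 : ∀ u ∈ 𝔮, ∀ v ∈ 𝔮, B u v = 0)
    {M : ℕ} (e : Module.Basis (Fin M) ℂ 𝔭) (e' : Module.Basis (Fin M) ℂ 𝔮)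
    (hdual : ∀ i j, B (e i) (e' j) = if i = j then 1 else 0)
    {r s : ℕ} (a : Fin r → 𝔥) (b : Fin s → 𝔥) (m : Fin r → ℕ) (n : Fin s → ℕ) :
    expDeltaApply B (fun i => (e i : 𝔥)) (fun i => (e' i : 𝔥))
        (normalOrdered B a m (fockVec B b n)) =
      ∑ k ∈ Finset.range (r / 2 + 1), ∑ p : Fin (2 * k) ↪o Fin r,
      ∑ l ∈ Finset.range (s / 2 + 1), ∑ q : Fin (2 * l) ↪o Fin s,
      ∑ ρ ∈ Finset.range (min (r - 2 * k) (s - 2 * l) + 1),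
      ∑ i : Fin ρ ↪o Fin (r - 2 * k), ∑ j : Fin ρ ↪o Fin (s - 2 * l),
        scalarMul B
          ((-1) ^ seqSum p * const (totalContraction B a m p) *
              expandBinom (-(∑ α, (m (p α) : ℂ)) - k) (-(∑ α, (m (p α) : ℤ)) - k) *
            ((-1) ^ seqSum q * const (totalContraction B b n q) *
              yPow (-(∑ β, (n (q β) : ℤ)) - l)) *
            ((-1) ^ (seqSum i + seqSum j) * (-1) ^ ((r - 2 * k) * ρ + ρ * (ρ + 1) / 2) *
              Matrix.det (Matrix.of fun α β : Fin ρ =>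
                const (B (a (complSeq p (i α))) (b (complSeq q (j β)))) *
                  iotaYX (gDeriv (m (complSeq p (i α))) (n (complSeq q (j β)))))))
          (fun d => PowerSeries.coeff d
            (negProd B (fun α => a (complSeq p (complSeq i α))) (fun α => m (complSeq p (complSeq i α))))
            (fockVec B (fun β => b (complSeq q (complSeq j β))) (fun β => n (complSeq q (complSeq j β))))) := by
  funext x y
  rw [expDeltaApply_normalOrdered B _ _ (eq_sum_of_dual_bases hsymm hpq h𝔭 h𝔮 e e' hdual),
    contractionSum_ofFn]
  simp only [map_sum, Finset.sum_apply]
  refine Finset.sum_congr rfl fun k _ => Finset.sum_congr rfl fun p _ =>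
    Finset.sum_congr rfl fun l _ => Finset.sum_congr rfl fun q _ =>
    Finset.sum_congr rfl fun ρ _ => Finset.sum_congr rfl fun i _ =>
    Finset.sum_congr rfl fun j _ => ?_
  -- The factors `(-1)^k` and `(-1)^l` from the unshuffles are absorbed here by the signs of the
  -- contractions.
  rw [vectorCoeff_smul_fieldProd, pf_fieldPairing, pf_pairing, negProd_eq, fockVec_eq,
    ← mul_assoc ((-1) ^ seqSum p), ← mul_assoc ((-1) ^ seqSum q)]
  simp only [mixedPairing_invY]
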